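/- **Logic.** We use classical two-sorted first-order logic with equality, with sorts $B$ (bodies) and $Q$ (quantities). The base language has unary $IOb$ (inertial observer) and $Ph$ (light signal) on $B$, operations $+,\cdot$ and the relation $\le$ on $Q$, and a relation $W$ on $B^2\times Q^4$; $W(k,b,\bar x)$ reads "$k$ coordinatizes $b$ at $\bar x=(x_0,x_1,x_2,x_3)$". The ether language adds a unary $E$ on $B$. $\vdash$ is syntactic consequence. A translation between such languages replaces each of $IOb,Ph,W$ (and $E$, if present) by a formula with the corresponding free variables, leaves mathematical expressions ($+,\cdot,\le$) unchanged, and preserves equality, connectives and quantifiers. It is an interpretation of $\mathsf{Th}_1$ in $\mathsf{Th}_2$ if $\mathsf{Th}_1\vdash\varphi$ implies $\mathsf{Th}_2\vdash Tr(\varphi)$ for every formula $\varphi$. Using a partial function in an atomic formula asserts that it is defined there. **Abbreviations.** $wl_k(b)=\{\bar x: W(k,b,\bar x)\}$; $ev_k(\bar x)=\{b:W(k,b,\bar x)\}$; $w_{kh}(\bar x,\bar y)$ iff $ev_k(\bar x)=ev_h(\bar y)$; $space(\bar x,\bar y)=\sqrt{\sum_{i=1}^3(x_i-y_i)^2}$;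 $time(\bar x,\bar y)=|x_0-y_0|$. $speed_k(b)=v$ (resp. $\bar v_k(b)=\bar v$) means that $wl_k(b)$ has at least two points and all $\bar x,\bar y\in wl_k(b)$ satisfy $space(\bar x,\bar y)=v\cdot time(\bar x,\bar y)$ (resp. $y_i-x_i=v_i(y_0-x_0)$ for $i=1,2,3$). $L(c,k)$ says: for all $\bar x,\bar y$, some $p\in Ph$ has $\bar x,\bar y\in wl_k(p)$ iff $space(\bar x,\bar y)=c\cdot time(\bar x,\bar y)$. $Ether(e)$ means $IOb(e)\wedge\exists c>0\,L(c,e)$. $\mathfrak c_e$ is the $c>0$ such that $L(c,e)$ for all $e\in Ether$; $\mathfrak c$ is the $c>0$ such that $L(c,k)$ for all $k\in IOb$. A trivial transformation is a map $(t,\bar s)\mapsto(t+z_0,A\bar s+\bar z)$ with $A$ an orthogonal $3\times3$ matrix. **Axioms.** - AxEField: $\langle Q,+,\cdot,\le\rangle$ is an ordered field in which positive elements have square roots. - AxEv: for $k,h\in IOb$ and every $\bar x$ there is $\bar y$ with $ev_k(\bar x)=ev_h(\bar y)$. - AxSelf: for $k\in IOb$, $W(k,k,\bar x)$ iff $x_1=x_2=x_3=0$.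 - AxSymD: if $k,k'\in IOb$, $ev_k(\bar x)=ev_{k'}(\bar x')$, $ev_k(\bar y)=ev_{k'}(\bar y')$ and $time(\bar x,\bar y)=time(\bar x',\bar y')=0$, then $space(\bar x,\bar y)=space(\bar x',\bar y')$. - AxLine: for $k,h\in IOb$ and $\bar x,\bar y,\bar z\in wl_k(h)$ there is $a\in Q$ with $\bar z-\bar x=a(\bar y-\bar x)$ or $\bar y-\bar z=a(\bar z-\bar x)$. - AxTriv: for every trivial $T$ and $k\in IOb$ there is $k'\in IOb$ with $w_{kk'}=T$. - AxNoAcc: if $W(k,b,\bar x)$ for some $b,\bar x$, then $IOb(k)$. - AxAbsTime: if $k,k'\in IOb$, $ev_k(\bar x)=ev_{k'}(\bar x')$ and $ev_k(\bar y)=ev_{k'}(\bar y')$, then $time(\bar x,\bar y)=time(\bar x',\bar y')$. - AxEther: some $e$ satisfies $Ether(e)$. - AxNoFTL: $speed_e(k)<\mathfrak c_e$ for $k\in IOb$, $e\in Ether$. - AxThExp$^{STL}$: $IOb\ne\emptyset$, and for $e\in Ether$, if $space(\bar x,\bar y)<\mathfrak c_e\cdot time(\bar x,\bar y)$ then $\bar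 x,\bar y\in wl_e(k)$ for some $k\in IOb$. - AxPh$_c$: there is $c>0$ such that $L(c,k)$ for all $k\in IOb$. - AxThExp: $IOb\ne\emptyset$, and for $k\in IOb$, if $space(\bar x,\bar y)<\mathfrak c\cdot time(\bar x,\bar y)$ then $\bar x,\bar y\in wl_k(k')$ for some $k'\in IOb$. - AxPrimitiveEther: there is $e\in IOb$ such that for all $k$: $E(k)$ iff $IOb(k)$ and $w_{ek}$ is a trivial transformation. $\mathsf{Kin_{Full}}$ consists of the first seven axioms. $\mathsf{ClassicalKin^{STL}_{Full}}$, in the base language, is $\mathsf{Kin_{Full}}$ plus AxAbsTime, AxEther, AxNoFTL and AxThExp$^{STL}$. $\mathsf{SpecRel^e_{Full}}$, in the ether language, is $\mathsf{Kin_{Full}}$ plus AxPh$_c$, AxThExp and AxPrimitiveEther. **Radarization.** For $\bar v=(v_x,v_y,v_z)\in Q^3$ with $v=|\bar v|<\mathfrak c$, put $Rad_{\bar v}=R_{\bar v}^{-1}\circ S_v\circ E_v\circ G_v\circ R_{\bar v}$, where $S_v=\sqrt{1-v^2/\mathfrak c^2}$ is a scaling, $$E_v=\begin{bmatrix}\frac{1}{S_v^2}&\frac{-v/\mathfrak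 c^2}{S_v^2}&0&0\\ \frac{-v}{S_v^2}&\frac1{S_v^2}&0&0\\0&0&\frac1{S_v}&0\\0&0&0&\frac1{S_v}\end{bmatrix},\qquad G_v=\begin{bmatrix}1&0&0&0\\v&1&0&0\\0&0&1&0\\0&0&0&1\end{bmatrix},$$ and $R_{\bar v}$ fixes the time coordinate and acts on space by the orthogonal matrix $$\frac1{v}\begin{bmatrix}-v_x&-v_y&-v_z\\ v_y&-v_x-v_z^2r&v_yv_zr\\ v_z&v_yv_zr&-v_x-v_y^2r\end{bmatrix},\qquad r=\frac{v-v_x}{v_y^2+v_z^2},$$ if $v_y\ne0$ or $v_z\ne0$; by the identity if $v_y=v_z=0$ and $v_x\le0$; and by minus the identity if $v_y=v_z=0$ and $v_x>0$. **Theorem.** Let $Tr'_+$ be the translation from the base language to the ether language with $Tr'_+(IOb(k))=IOb(k)$, $Tr'_+(Ph(p))=Ph(p)$ and $$Tr'_+\big(W(k,b,\bar x)\big)=\forall e\,\Big(E(e)\to W\big(k,b,Rad_{\bar v_k(e)}(\bar x)\big)\Big).$$ Then $Tr'_+$ is an interpretation of $\mathsf{ClassicalKin^{STL}_{Full}}$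 in $\mathsf{SpecRel^e_{Full}}$: for every formula $\varphi$, if $\mathsf{ClassicalKin^{STL}_{Full}}\vdash\varphi$ then $\mathsf{SpecRel^e_{Full}}\vdash Tr'_+(\varphi)$. In particular, $\mathsf{SpecRel^e_{Full}}\vdash Tr'_+(\varphi)$ for every axiom $\varphi$ of $\mathsf{ClassicalKin^{STL}_{Full}}$. -/

import Mathlib

namespace KinLogic

/-! ### Two-sorted first-order logic with equality

Sort `B` (bodies) has no function symbols, so body terms are body variables; sort `Q` (quantities)
has the function symbols `+` and `·`.  Variables of each sort are de Bruijn indices, counted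
separately for the two sorts; indices that point beyond the enclosing quantifiers of their sort are
free variables. -/

/-- Quantity terms. -/
inductive Term : Type
  | var (n : ℕ) : Term
  | add (s t : Term) : Term
  | mul (s t : Term) : Term

instance : Add Term := ⟨Term.add⟩
instance : Mul Term := ⟨Term.mul⟩

/-- Formulas of the language `{B, Q; IOb, Ph, +, ·, ≤, W}` extended by one unary relation symbol
of sort `B` for every element of `X`.  The other connectives and `∃` are the usual classical
abbreviations. -/
inductive Formula (X : Type) : Type
  | bot : Formula X
  | imp (φ ψ : Formula X) : Formula X
  | allB (φ : Formula X) : Formula X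
  | allQ (φ : Formula X) : Formula X
  | eqB (k b : ℕ) : Formula X
  | eqQ (s t : Term) : Formula X
  | le (s t : Term) : Formula X
  | IOb (k : ℕ) : Formula X
  | Ph (p : ℕ) : Formula X
  | ext (x : X) (k : ℕ) : Formula X
  | W (k b : ℕ) (t₀ t₁ t₂ t₃ : Term) : Formula X

/-- The language of classical kinematics and of special relativity without ether. -/
abbrev BaseFormula := Formula Empty

/-- The language extended by the single unary relation symbol `E` of sort `B`. -/
abbrev EtherFormula := Formula Unit

/-! ### Substitution -/

/-- Simultaneous substitution in a quantity term. -/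
def Term.subst (σ : ℕ → Term) : Term → Term
  | .var n => σ n
  | .add s t => .add (s.subst σ) (t.subst σ)
  | .mul s t => .mul (s.subst σ) (t.subst σ)

/-- A renaming of body variables, pushed under a body quantifier. -/
def liftB (ρ : ℕ → ℕ) : ℕ → ℕ
  | 0 => 0
  | n + 1 => ρ n + 1

/-- A substitution for quantity variables, pushed under a quantity quantifier. -/
def liftQ (σ : ℕ → Term) : ℕ → Term
  | 0 => .var 0
  | n + 1 => (σ n).subst fun i => .var (i + 1)

/-- Simultaneous capture-avoiding substitution of `ρ` for the free body variables and of `σ` for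
the free quantity variables. -/
def Formula.subst {X : Type} : Formula X → (ℕ → ℕ) → (ℕ → Term) → Formula X
  | .bot, _, _ => .bot
  | .imp φ ψ, ρ, σ => .imp (φ.subst ρ σ) (ψ.subst ρ σ)
  | .allB φ, ρ, σ => .allB (φ.subst (liftB ρ) σ)
  | .allQ φ, ρ, σ => .allQ (φ.subst ρ (liftQ σ))
  | .eqB k b, ρ, _ => .eqB (ρ k) (ρ b)
  | .eqQ s t, _, σ => .eqQ (s.subst σ) (t.subst σ)
  | .le s t, _, σ => .le (s.subst σ) (t.subst σ)
  | .IOb k, ρ, _ => .IOb (ρ k)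
  | .Ph p, ρ, _ => .Ph (ρ p)
  | .ext x k, ρ, _ => .ext x (ρ k)
  | .W k b t₀ t₁ t₂ t₃, ρ, σ =>
      .W (ρ k) (ρ b) (t₀.subst σ) (t₁.subst σ) (t₂.subst σ) (t₃.subst σ)

/-- Rename every free body variable `i` to `i + 1`. -/
def Formula.shiftB {X : Type} (φ : Formula X) : Formula X := φ.subst Nat.succ Term.var

/-- Rename every free quantity variable `i` to `i + 1`. -/
def Formula.shiftQ {X : Type} (φ : Formula X) : Formula X := φ.subst id fun i => .var (i + 1)

/-- Instantiate the body variable `0` by `k`, lowering the others. -/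
def Formula.instB {X : Type} (φ : Formula X) (k : ℕ) : Formula X :=
  φ.subst (fun | 0 => k | n + 1 => n) Term.var

/-- Instantiate the quantity variable `0` by the term `t`, lowering the others. -/
def Formula.instQ {X : Type} (φ : Formula X) (t : Term) : Formula X :=
  φ.subst id (fun | 0 => t | n + 1 => .var n)

/-- All variables of the term are among `0, …, n - 1`. -/
def Term.closedAt (n : ℕ) : Term → Bool
  | .var i => decide (i < n)
  | .add s t => s.closedAt n && t.closedAt n
  | .mul s t => s.closedAt n && t.closedAt n

/-- The free body variables are among `0, …, m - 1`, the free quantity variables among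
`0, …, n - 1`. -/
def Formula.closedAt {X : Type} : Formula X → ℕ → ℕ → Bool
  | .bot, _, _ => true
  | .imp φ ψ, m, n => φ.closedAt m n && ψ.closedAt m n
  | .allB φ, m, n => φ.closedAt (m + 1) n
  | .allQ φ, m, n => φ.closedAt m (n + 1)
  | .eqB k b, m, _ => decide (k < m) && decide (b < m)
  | .eqQ s t, _, n => s.closedAt n && t.closedAt n
  | .le s t, _, n => s.closedAt n && t.closedAt n
  | .IOb k, m, _ => decide (k < m)
  | .Ph p, m, _ => decide (p < m)
  | .ext _ k, m, _ => decide (k < m)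
  | .W k b t₀ t₁ t₂ t₃, m, n => decide (k < m) && decide (b < m) &&
      t₀.closedAt n && t₁.closedAt n && t₂.closedAt n && t₃.closedAt n

/-! ### Syntactic consequence -/

/-- `Γ ⊢ φ`: natural deduction for classical two-sorted first-order logic with equality. -/
inductive Provable {X : Type} : Set (Formula X) → Formula X → Prop
  | assumption {Γ : Set (Formula X)} {φ : Formula X} : φ ∈ Γ → Provable Γ φ
  | impI {Γ : Set (Formula X)} {φ ψ : Formula X} :
      Provable (insert φ Γ) ψ → Provable Γ (.imp φ ψ)
  | impE {Γ : Set (Formula X)} {φ ψ : Formula X} :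
      Provable Γ (.imp φ ψ) → Provable Γ φ → Provable Γ ψ
  | byContra {Γ : Set (Formula X)} {φ : Formula X} :
      Provable (insert (.imp φ .bot) Γ) .bot → Provable Γ φ
  | allBI {Γ : Set (Formula X)} {φ : Formula X} :
      Provable (Formula.shiftB '' Γ) φ → Provable Γ (.allB φ)
  | allBE {Γ : Set (Formula X)} {φ : Formula X} (k : ℕ) :
      Provable Γ (.allB φ) → Provable Γ (φ.instB k)
  | allQI {Γ : Set (Formula X)} {φ : Formula X} :
      Provable (Formula.shiftQ '' Γ) φ → Provable Γ (.allQ φ)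
  | allQE {Γ : Set (Formula X)} {φ : Formula X} (t : Term) :
      Provable Γ (.allQ φ) → Provable Γ (φ.instQ t)
  | eqBRefl {Γ : Set (Formula X)} (k : ℕ) : Provable Γ (.eqB k k)
  | eqBSubst {Γ : Set (Formula X)} {φ : Formula X} {k b : ℕ} :
      Provable Γ (.eqB k b) → Provable Γ (φ.instB k) → Provable Γ (φ.instB b)
  | eqQRefl {Γ : Set (Formula X)} (t : Term) : Provable Γ (.eqQ t t)
  | eqQSubst {Γ : Set (Formula X)} {φ : Formula X} {s t : Term} :
      Provable Γ (.eqQ s t) → Provable Γ (φ.instQ s) → Provable Γ (φ.instQ t)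

/-! ### Translations and interpretations -/

/-- A translation between two such languages.  Each relation symbol of sort `B` and `W` is
translated into a formula with the corresponding free variables: the body variable `0` for unary
symbols; the body variables `0, 1` and the quantity variables `0, 1, 2, 3` for `W`.  Mathematical
expressions (`+`, `·`, `≤`) are translated into themselves. -/
structure Translation (X Y : Type) where
  IOb : Formula Y
  IOb_closed : IOb.closedAt 1 0 = true
  Ph : Formula Y
  Ph_closed : Ph.closedAt 1 0 = true
  ext : X → Formula Y
  ext_closed : ∀ x, (ext x).closedAt 1 0 = true
  W : Formula Y
  W_closed : W.closedAt 2 4 = true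

/-- The translation of a formula: equality, connectives and quantifiers are preserved, and the
arguments of a relation symbol are substituted into the translation of that symbol. -/
def Translation.apply {X Y : Type} (T : Translation X Y) : Formula X → Formula Y
  | .bot => .bot
  | .imp φ ψ => .imp (T.apply φ) (T.apply ψ)
  | .allB φ => .allB (T.apply φ)
  | .allQ φ => .allQ (T.apply φ)
  | .eqB k b => .eqB k b
  | .eqQ s t => .eqQ s t
  | .le s t => .le s t
  | .IOb k => T.IOb.subst (fun _ => k) Term.var
  | .Ph p => T.Ph.subst (fun _ => p) Term.var
  | .ext x k => (T.ext x).subst (fun _ => k) Term.var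
  | .W k b t₀ t₁ t₂ t₃ =>
      T.W.subst (fun | 0 => k | _ => b) (fun | 0 => t₀ | 1 => t₁ | 2 => t₂ | _ => t₃)

/-- `T` is an interpretation of `Th₁` in `Th₂`: it translates every theorem of `Th₁` into a
theorem of `Th₂`. -/
def Translation.IsInterpretation {X Y : Type} (T : Translation X Y)
    (Th₁ : Set (Formula X)) (Th₂ : Set (Formula Y)) : Prop :=
  ∀ φ : Formula X, Provable Th₁ φ → Provable Th₂ (T.apply φ)

/-! ### Writing formulas with bound-variable names

A formula under construction is a function of the numbers `m` and `n` of body and quantity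
quantifiers that enclose it; a body variable or a quantity term under construction is a function of
the number of enclosing quantifiers of its sort.  So `allB fun k => …` binds a variable `k` that can
be used at any depth inside. -/

/-- Body variables under construction. -/
abbrev BTok := ℕ → ℕ

/-- Quantity terms under construction; `+` and `*` act pointwise. -/
abbrev QTok := ℕ → Term

/-- Formulas under construction. -/
abbrev Fml (X : Type) := ℕ → ℕ → Formula X

/-- The free body variable `i` of a finished formula. -/
def freeB (i : ℕ) : BTok := fun m => i + m

/-- The free quantity variable `i` of a finished formula. -/
def freeQ (i : ℕ) : QTok := fun n => .var (i + n)

/-- The finished formula. -/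
def Fml.done {X : Type} (φ : Fml X) : Formula X := φ 0 0

section Builders

variable {X : Type}

def imp (φ ψ : Fml X) : Fml X := fun m n => .imp (φ m n) (ψ m n)
def not (φ : Fml X) : Fml X := fun m n => .imp (φ m n) .bot

infixr:25 " ⇒ᶠ " => KinLogic.imp
prefix:max "¬ᶠ " => KinLogic.not

def and (φ ψ : Fml X) : Fml X := ¬ᶠ (φ ⇒ᶠ ¬ᶠ ψ)
def or (φ ψ : Fml X) : Fml X := ¬ᶠ φ ⇒ᶠ ψ

infixr:35 " ∧ᶠ " => KinLogic.and
infixr:30 " ∨ᶠ " => KinLogic.or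

def iff (φ ψ : Fml X) : Fml X := (φ ⇒ᶠ ψ) ∧ᶠ (ψ ⇒ᶠ φ)

infix:20 " ⇔ᶠ " => KinLogic.iff

def allB (f : BTok → Fml X) : Fml X :=
  fun m n => .allB (f (fun m' => m' - (m + 1)) (m + 1) n)
def exB (f : BTok → Fml X) : Fml X := ¬ᶠ (allB fun k => ¬ᶠ (f k))
def allQ (f : QTok → Fml X) : Fml X :=
  fun m n => .allQ (f (fun n' => .var (n' - (n + 1))) m (n + 1))
def exQ (f : QTok → Fml X) : Fml X := ¬ᶠ (allQ fun x => ¬ᶠ (f x))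

def allQ3 (f : (Fin 3 → QTok) → Fml X) : Fml X :=
  allQ fun a => allQ fun b => allQ fun c => f ![a, b, c]
def exQ3 (f : (Fin 3 → QTok) → Fml X) : Fml X :=
  exQ fun a => exQ fun b => exQ fun c => f ![a, b, c]
def allQ4 (f : (Fin 4 → QTok) → Fml X) : Fml X :=
  allQ fun a => allQ fun b => allQ fun c => allQ fun d => f ![a, b, c, d]
def exQ4 (f : (Fin 4 → QTok) → Fml X) : Fml X :=
  exQ fun a => exQ fun b => exQ fun c => exQ fun d => f ![a, b, c, d]

def eqB (k b : BTok) : Fml X := fun m _ => .eqB (k m) (b m)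
def eqQ (s t : QTok) : Fml X := fun _ n => .eqQ (s n) (t n)
def le (s t : QTok) : Fml X := fun _ n => .le (s n) (t n)

infix:50 " =ᶠ " => KinLogic.eqQ
infix:50 " ≤ᶠ " => KinLogic.le

def lt (s t : QTok) : Fml X := s ≤ᶠ t ∧ᶠ ¬ᶠ (s =ᶠ t)

infix:50 " <ᶠ " => KinLogic.lt

def IOb (k : BTok) : Fml X := fun m _ => .IOb (k m)
def Ph (p : BTok) : Fml X := fun m _ => .Ph (p m)
def W (k b : BTok) (x : Fin 4 → QTok) : Fml X :=
  fun m n => .W (k m) (b m) (x 0 n) (x 1 n) (x 2 n) (x 3 n)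

/-- Conjunction over three indices. -/
def conj3 (f : Fin 3 → Fml X) : Fml X := f 0 ∧ᶠ f 1 ∧ᶠ f 2

def eqPt (x y : Fin 4 → QTok) : Fml X :=
  x 0 =ᶠ y 0 ∧ᶠ x 1 =ᶠ y 1 ∧ᶠ x 2 =ᶠ y 2 ∧ᶠ x 3 =ᶠ y 3

/-! ### Shorthands of arithmetic -/

/-- `u = 0` -/
def isZero (u : QTok) : Fml X := allQ fun x => x + u =ᶠ x
/-- `u = 1` -/
def isOne (u : QTok) : Fml X := allQ fun x => x * u =ᶠ x
/-- `0 ≤ u` -/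
def nonneg (u : QTok) : Fml X := exQ fun z => isZero z ∧ᶠ z ≤ᶠ u
/-- `0 < u` -/
def pos (u : QTok) : Fml X := exQ fun z => isZero z ∧ᶠ z <ᶠ u

/-- `s = √((x₁-y₁)² + (x₂-y₂)² + (x₃-y₃)²)`, the spatial distance of `x` and `y` -/
def isSpace (s : QTok) (x y : Fin 4 → QTok) : Fml X :=
  nonneg s ∧ᶠ exQ3 fun d =>
    (conj3 fun i => x i.succ =ᶠ y i.succ + d i) ∧ᶠ
    s * s =ᶠ d 0 * d 0 + d 1 * d 1 + d 2 * d 2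

/-- `t = |x₀ - y₀|`, the time difference of `x` and `y` -/
def isTime (t : QTok) (x y : Fin 4 → QTok) : Fml X :=
  nonneg t ∧ᶠ (x 0 =ᶠ y 0 + t ∨ᶠ y 0 =ᶠ x 0 + t)

/-- `space(x, y) = c · time(x, y)` -/
def spaceEq (c : QTok) (x y : Fin 4 → QTok) : Fml X :=
  exQ fun s => exQ fun t => isSpace s x y ∧ᶠ isTime t x y ∧ᶠ s =ᶠ c * t

/-- `space(x, y) < c · time(x, y)` -/
def spaceLt (c : QTok) (x y : Fin 4 → QTok) : Fml X :=
  exQ fun s => exQ fun t => isSpace s x y ∧ᶠ isTime t x y ∧ᶠ s <ᶠ c * t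

/-- `space(x, y) = space(x', y')` -/
def sameSpace (x y x' y' : Fin 4 → QTok) : Fml X :=
  exQ fun s => isSpace s x y ∧ᶠ isSpace s x' y'

/-- `time(x, y) = time(x', y')` -/
def sameTime (x y x' y' : Fin 4 → QTok) : Fml X :=
  exQ fun t => isTime t x y ∧ᶠ isTime t x' y'

/-! ### Worldlines, events, speed, velocity -/

/-- `ev_k(x) = ev_h(y)`, that is, the worldview transformation `w_{kh}(x, y)` -/
def sameEvent (k h : BTok) (x y : Fin 4 → QTok) : Fml X := allB fun b => W k b x ⇔ᶠ W h b y

/-- `speed_k(b) = v` -/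
def isSpeed (k b : BTok) (v : QTok) : Fml X :=
  (exQ4 fun x => exQ4 fun y => W k b x ∧ᶠ W k b y ∧ᶠ ¬ᶠ (eqPt x y)) ∧ᶠ
  (allQ4 fun x => allQ4 fun y => W k b x ∧ᶠ W k b y ⇒ᶠ spaceEq v x y)

/-- `v̄_k(b) = v`; the equations `yᵢ - xᵢ = vᵢ · (y₀ - x₀)` are written without subtraction -/
def isVelocity (k b : BTok) (v : Fin 3 → QTok) : Fml X :=
  (exQ4 fun x => exQ4 fun y => W k b x ∧ᶠ W k b y ∧ᶠ ¬ᶠ (eqPt x y)) ∧ᶠ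
  (allQ4 fun x => allQ4 fun y => W k b x ∧ᶠ W k b y ⇒ᶠ
    conj3 fun i => y i.succ + v i * x 0 =ᶠ x i.succ + v i * y 0)

/-- `Ob(k)`: `k` coordinatizes some body somewhere. -/
def Ob (k : BTok) : Fml X := exB fun b => exQ4 fun x => W k b x

/-- According to `k`, some light signal passes through `x` and `y` exactly if
`space(x, y) = c · time(x, y)`. -/
def lightSpeed (c : QTok) (k : BTok) : Fml X :=
  allQ4 fun x => allQ4 fun y =>
    (exB fun p => Ph p ∧ᶠ W k p x ∧ᶠ W k p y) ⇔ᶠ spaceEq c x y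

/-- The observer-independent speed of light `𝔠` is `c`. -/
def isC (c : QTok) : Fml X := pos c ∧ᶠ allB fun k => IOb k ⇒ᶠ lightSpeed c k

/-- `Ether(e)` -/
def Ether (e : BTok) : Fml X := IOb e ∧ᶠ exQ fun c => pos c ∧ᶠ lightSpeed c e

/-- The speed of light `𝔠ₑ` on which all ether observers agree is `c`, that is, `c` is the constant
in the definition of `Ether` for each of them. -/
def isCe (c : QTok) : Fml X := pos c ∧ᶠ allB fun e => Ether e ⇒ᶠ lightSpeed c e

/-! ### Trivial transformations

A trivial transformation maps `(t, x)` to `(t + z₀, A x + z)` with `A` an orthogonal `3 × 3` matrix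
(an isometry of space and a translation of time). -/

/-- `Aᵀ A = 1` -/
def orthogonal (A : Fin 3 → Fin 3 → QTok) : Fml X :=
  conj3 fun i => conj3 fun j =>
    if i = j then isOne (A 0 i * A 0 j + A 1 i * A 1 j + A 2 i * A 2 j)
    else isZero (A 0 i * A 0 j + A 1 i * A 1 j + A 2 i * A 2 j)

/-- The trivial transformation with parameters `A` and `z` maps `x` to `y`. -/
def trivMap (A : Fin 3 → Fin 3 → QTok) (z x y : Fin 4 → QTok) : Fml X :=
  y 0 =ᶠ x 0 + z 0 ∧ᶠ
  conj3 fun i => y i.succ =ᶠ A i 0 * x 1 + A i 1 * x 2 + A i 2 * x 3 + z i.succ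

/-- `w_{kh}` is the trivial transformation with parameters `A` and `z`. -/
def worldviewIs (k h : BTok) (A : Fin 3 → Fin 3 → QTok) (z : Fin 4 → QTok) : Fml X :=
  allQ4 fun x => allQ4 fun y => sameEvent k h x y ⇔ᶠ trivMap A z x y

/-- For all trivial transformations. -/
def allTriv (f : (Fin 3 → Fin 3 → QTok) → (Fin 4 → QTok) → Fml X) : Fml X :=
  allQ3 fun a => allQ3 fun b => allQ3 fun c => allQ4 fun z =>
    orthogonal ![a, b, c] ⇒ᶠ f ![a, b, c] z

/-- For some trivial transformation. -/
def exTriv (f : (Fin 3 → Fin 3 → QTok) → (Fin 4 → QTok) → Fml X) : Fml X :=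
  exQ3 fun a => exQ3 fun b => exQ3 fun c => exQ4 fun z =>
    orthogonal ![a, b, c] ∧ᶠ f ![a, b, c] z

/-! ### The axioms -/

/-- `⟨Q, +, ·, ≤⟩` is a Euclidean field. -/
def AxEField : Fml X :=
  -- commutative, associative, distributive
  (allQ fun x => allQ fun y => allQ fun z =>
    x + y =ᶠ y + x ∧ᶠ (x + y) + z =ᶠ x + (y + z) ∧ᶠ
    x * y =ᶠ y * x ∧ᶠ (x * y) * z =ᶠ x * (y * z) ∧ᶠ
    x * (y + z) =ᶠ x * y + x * z) ∧ᶠ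
  -- zero, one, negatives, reciprocals
  (exQ fun o => exQ fun u => isZero o ∧ᶠ isOne u ∧ᶠ ¬ᶠ (o =ᶠ u) ∧ᶠ
    allQ fun x => (exQ fun y => x + y =ᶠ o) ∧ᶠ (¬ᶠ (x =ᶠ o) ⇒ᶠ exQ fun y => x * y =ᶠ u)) ∧ᶠ
  -- linear ordering
  (allQ fun x => allQ fun y => allQ fun z =>
    x ≤ᶠ x ∧ᶠ (x ≤ᶠ y ∧ᶠ y ≤ᶠ x ⇒ᶠ x =ᶠ y) ∧ᶠ (x ≤ᶠ y ∧ᶠ y ≤ᶠ z ⇒ᶠ x ≤ᶠ z) ∧ᶠ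
    (x ≤ᶠ y ∨ᶠ y ≤ᶠ x)) ∧ᶠ
  -- compatibility with the operations
  (allQ fun x => allQ fun y => allQ fun z => x ≤ᶠ y ⇒ᶠ x + z ≤ᶠ y + z) ∧ᶠ
  (allQ fun x => allQ fun y => nonneg x ∧ᶠ nonneg y ⇒ᶠ nonneg (x * y)) ∧ᶠ
  -- square roots
  (allQ fun x => pos x ⇒ᶠ exQ fun y => y * y =ᶠ x)

/-- All inertial observers coordinatize the same events. -/
def AxEv : Fml X :=
  allB fun k => allB fun h => IOb k ∧ᶠ IOb h ⇒ᶠ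
    allQ4 fun x => exQ4 fun y => sameEvent k h x y

/-- The worldline of an inertial observer is a straight line according to inertial observers:
for `x, y, z` on it there is `a` with `z - x = a(y - x)` or `y - z = a(z - x)`. -/
def AxLine : Fml X :=
  allB fun k => allB fun h => IOb k ∧ᶠ IOb h ⇒ᶠ
    allQ4 fun x => allQ4 fun y => allQ4 fun z => W k h x ∧ᶠ W k h y ∧ᶠ W k h z ⇒ᶠ
      exQ fun a =>
        eqPt (fun i => z i + a * x i) (fun i => x i + a * y i) ∨ᶠ
        eqPt (fun i => y i + a * x i) (fun i => z i + a * z i)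

/-- Any inertial observer is stationary in his own coordinate system. -/
def AxSelf : Fml X :=
  allB fun k => IOb k ⇒ᶠ allQ4 fun x => W k k x ⇔ᶠ isZero (x 1) ∧ᶠ isZero (x 2) ∧ᶠ isZero (x 3)

/-- Two inertial observers agree as to the spatial distance between two events that are
simultaneous for both of them. -/
def AxSymD : Fml X :=
  allB fun k => allB fun h => IOb k ∧ᶠ IOb h ⇒ᶠ
    allQ4 fun x => allQ4 fun y => allQ4 fun x' => allQ4 fun y' =>
      (exQ fun t => isZero t ∧ᶠ isTime t x y ∧ᶠ isTime t x' y') ∧ᶠ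
      sameEvent k h x x' ∧ᶠ sameEvent k h y y' ⇒ᶠ sameSpace x y x' y'

/-- Any trivial transformation of an inertial coordinate system is also one. -/
def AxTriv : Fml X :=
  allTriv fun A z => allB fun k => IOb k ⇒ᶠ exB fun h => IOb h ∧ᶠ worldviewIs k h A z

/-- All observers are inertial observers. -/
def AxNoAcc : Fml X := allB fun k => Ob k ⇒ᶠ IOb k

/-- The time difference between two events is the same for all inertial observers. -/
def AxAbsTime : Fml X :=
  allB fun k => allB fun h => IOb k ∧ᶠ IOb h ⇒ᶠ
    allQ4 fun x => allQ4 fun y => allQ4 fun x' => allQ4 fun y' =>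
      sameEvent k h x x' ∧ᶠ sameEvent k h y y' ⇒ᶠ sameTime x y x' y'

/-- Inertial observers can move along any non-horizontal straight line. -/
def AxThExpPlus : Fml X :=
  (exB fun h => IOb h) ∧ᶠ
  allB fun k => IOb k ⇒ᶠ allQ4 fun x => allQ4 fun y => ¬ᶠ (x 0 =ᶠ y 0) ⇒ᶠ
    exB fun h => IOb h ∧ᶠ W k h x ∧ᶠ W k h y

/-- There is an ether observer. -/
def AxEther : Fml X := exB fun e => Ether e

/-- All inertial observers move slower than light with respect to the ether observers. -/
def AxNoFTL : Fml X :=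
  allB fun k => allB fun e => IOb k ∧ᶠ Ether e ⇒ᶠ
    exQ fun v => isSpeed e k v ∧ᶠ exQ fun c => isCe c ∧ᶠ v <ᶠ c

/-- Inertial observers can move with any speed which is slower than that of light in the ether
frame. -/
def AxThExpSTL : Fml X :=
  (exB fun h => IOb h) ∧ᶠ
  allB fun e => Ether e ⇒ᶠ allQ4 fun x => allQ4 fun y =>
    (exQ fun c => isCe c ∧ᶠ spaceLt c x y) ⇒ᶠ exB fun k => IOb k ∧ᶠ W e k x ∧ᶠ W e k y

/-- The speed of light is the same for all inertial observers, everywhere and in every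
direction. -/
def AxPhc : Fml X := exQ fun c => isC c

/-- Inertial observers can move along any straight line of any speed less than the speed of
light. -/
def AxThExp : Fml X :=
  (exB fun h => IOb h) ∧ᶠ
  allB fun k => IOb k ⇒ᶠ allQ4 fun x => allQ4 fun y =>
    (exQ fun c => isC c ∧ᶠ spaceLt c x y) ⇒ᶠ exB fun h => IOb h ∧ᶠ W k h x ∧ᶠ W k h y

end Builders

/-- Primitive ether observers. -/
def E (k : BTok) : Fml Unit := fun m _ => .ext () (k m)

/-- There is a non-empty class of distinguished observers, stationary with respect to each other,
which is closed under trivial transformations. -/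
def AxPrimitiveEther : Fml Unit :=
  exB fun e => IOb e ∧ᶠ allB fun k =>
    (IOb k ∧ᶠ exTriv fun A z => worldviewIs e k A z) ⇔ᶠ E k

/-! ### The theories -/

/-- Axioms common to all theories. -/
def KinFull (X : Type) : Set (Formula X) :=
  {AxEField.done, AxEv.done, AxSelf.done, AxSymD.done, AxLine.done, AxTriv.done, AxNoAcc.done}

/-- Classical kinematics. -/
def ClassicalKinFull : Set BaseFormula :=
  KinFull Empty ∪ {AxAbsTime.done, AxThExpPlus.done, AxEther.done}

/-- Classical kinematics restricted to slower-than-light observers. -/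
def ClassicalKinSTLFull : Set BaseFormula :=
  (ClassicalKinFull ∪ {AxNoFTL.done, AxThExpSTL.done}) \ {AxThExpPlus.done}

/-- Special relativity, in the language extended by `E`. -/
def SpecRelFull : Set EtherFormula :=
  KinFull Unit ∪ {AxPhc.done, AxThExp.done}

/-- Special relativity with a primitive ether. -/
def SpecRelEFull : Set EtherFormula :=
  SpecRelFull ∪ {AxPrimitiveEther.done}

/-! ### Radarization

For a velocity `v` with `n = |v| < c`, the map `Rad_v = R⁻¹ ∘ S ∘ E ∘ G ∘ R`.  Matrix equations are
written with subtractions moved to the other side and denominators cleared. -/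

section Radarization

variable {X : Type}

/-- `R_v(x) = y` for `n = |v|`: the orthogonal map of space with
* matrix `(1/n) [[-v₀, -v₁, -v₂], [v₁, -v₀ - v₂²r, v₁v₂r], [v₂, v₁v₂r, -v₀ - v₁²r]]`, where
  `r = (n - v₀)/(v₁² + v₂²)`, if `v₁ ≠ 0` or `v₂ ≠ 0`;
* the identity if `v₀ ≤ 0` and `v₁ = v₂ = 0`;
* minus the identity if `v₀ > 0` and `v₁ = v₂ = 0`.

It maps `v` to `(-n, 0, 0)`; time is left unchanged. -/
def rotMap (n : QTok) (v : Fin 3 → QTok) (x y : Fin 4 → QTok) : Fml X :=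
  y 0 =ᶠ x 0 ∧ᶠ
  (((¬ᶠ (isZero (v 1)) ∨ᶠ ¬ᶠ (isZero (v 2))) ∧ᶠ
      exQ fun r => r * (v 1 * v 1 + v 2 * v 2) + v 0 =ᶠ n ∧ᶠ
        isZero (n * y 1 + (v 0 * x 1 + v 1 * x 2 + v 2 * x 3)) ∧ᶠ
        n * y 2 + (v 0 + v 2 * v 2 * r) * x 2 =ᶠ v 1 * x 1 + v 1 * v 2 * r * x 3 ∧ᶠ
        n * y 3 + (v 0 + v 1 * v 1 * r) * x 3 =ᶠ v 2 * x 1 + v 1 * v 2 * r * x 2) ∨ᶠ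
    (¬ᶠ (pos (v 0)) ∧ᶠ isZero (v 1) ∧ᶠ isZero (v 2) ∧ᶠ
      y 1 =ᶠ x 1 ∧ᶠ y 2 =ᶠ x 2 ∧ᶠ y 3 =ᶠ x 3) ∨ᶠ
    (pos (v 0) ∧ᶠ isZero (v 1) ∧ᶠ isZero (v 2) ∧ᶠ
      isZero (y 1 + x 1) ∧ᶠ isZero (y 2 + x 2) ∧ᶠ isZero (y 3 + x 3)))

/-- The Galilean boost `G_n(x) = y`, with matrix
`[[1, 0, 0, 0], [n, 1, 0, 0], [0, 0, 1, 0], [0, 0, 0, 1]]`. -/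
def galMap (n : QTok) (x y : Fin 4 → QTok) : Fml X :=
  y 0 =ᶠ x 0 ∧ᶠ y 1 =ᶠ n * x 0 + x 1 ∧ᶠ y 2 =ᶠ x 2 ∧ᶠ y 3 =ᶠ x 3

/-- The Poincaré–Einstein synchronisation `E_n(x) = y`: `y₀ = (x₀ - n x₁/c²)/(1 - n²/c²)`,
`y₁ = (x₁ - n x₀)/(1 - n²/c²)`, `y₂ = x₂/s`, `y₃ = x₃/s`, where `s = √(1 - n²/c²)`. -/
def syncMap (c n s : QTok) (x y : Fin 4 → QTok) : Fml X :=
  c * c * y 0 + n * x 1 =ᶠ c * c * x 0 + n * n * y 0 ∧ᶠ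
  c * c * y 1 + c * c * (n * x 0) =ᶠ c * c * x 1 + n * n * y 1 ∧ᶠ
  s * y 2 =ᶠ x 2 ∧ᶠ s * y 3 =ᶠ x 3

/-- The scaling `S(x) = y` by the factor `s = √(1 - n²/c²)`. -/
def scaleMap (s : QTok) (x y : Fin 4 → QTok) : Fml X :=
  eqPt y fun i => s * x i

/-- `Rad_v(x) = y` with light speed `c`; it is defined only if `|v| < c`. -/
def radMap (c : QTok) (v : Fin 3 → QTok) (x y : Fin 4 → QTok) : Fml X :=
  exQ fun n => nonneg n ∧ᶠ n * n =ᶠ v 0 * v 0 + v 1 * v 1 + v 2 * v 2 ∧ᶠ n <ᶠ c ∧ᶠ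
    exQ fun s => nonneg s ∧ᶠ c * c * (s * s) + n * n =ᶠ c * c ∧ᶠ
      exQ4 fun x₁ => exQ4 fun x₂ => exQ4 fun x₃ => exQ4 fun x₄ =>
        rotMap n v x x₁ ∧ᶠ galMap n x₁ x₂ ∧ᶠ syncMap c n s x₂ x₃ ∧ᶠ scaleMap s x₃ x₄ ∧ᶠ
        rotMap n v y x₄

/-- `Rad_{v̄_k(e)}(x) = y`, with the light speed `𝔠` of special relativity -/
def radObs (k e : BTok) (x y : Fin 4 → QTok) : Fml X :=
  exQ3 fun v => isVelocity k e v ∧ᶠ exQ fun c => isC c ∧ᶠ radMap c v x y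

end Radarization

/-- The translation of `W(k, b, x)`: for every primitive ether observer `e`,
`W(k, b, Rad_{v̄_k(e)}(x))`. -/
def trW (k b : BTok) (x : Fin 4 → QTok) : Fml Unit :=
  allB fun e => E e ⇒ᶠ exQ4 fun y => radObs k e x y ∧ᶠ W k b y

/-- The translation `Tr'₊` from classical kinematics to special relativity with ether. -/
def trPlus' : Translation Empty Unit where
  IOb := (IOb (freeB 0)).done
  IOb_closed := by decide
  Ph := (Ph (freeB 0)).done
  Ph_closed := by decide
  ext := Empty.elim
  ext_closed := fun x => x.elim
  W := (trW (freeB 0) (freeB 1) ![freeQ 0, freeQ 1, freeQ 2, freeQ 3]).done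
  W_closed := by rfl

end KinLogic

/-! The question about derivations is turned into one about models. By completeness of the calculus
for sets of sentences (`provable_of_forall_sat`, a Henkin construction), it suffices that the
translation of a theorem holds in every model `M` of the ether theory. The translation leaves
domains, equality, connectives and quantifiers alone, so it holds in `M` exactly if the original
formula holds in the structure `M.classical`, which has the translated worldview relation
(`sat_apply`). By soundness it remains to verify the axioms of classical kinematics in
`M.classical`; there the quantities form a Euclidean field.

The geometric input is the shape of the worldview transformation from an observer `k` to the ether
observer `e`. Every timelike line is the worldline of some inertial observer, so the transformation
and its inverse map timelike lines to timelike lines. Parallelograms with timelike sides and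
diagonals are then preserved, and additivity follows up to a translation (`exists_add_const`). Let
`v` be the velocity of `e` according to `k`. After composition with the Lorentz boost along `v`, the
map preserves the time axis and light cones, and AxSymD makes it preserve lengths orthogonal to `v`.
This rules out dilations and field automorphisms: what remains is a trivial transformation, possibly
with time reversal (`exists_orth_of_axis`, `exists_boost`).

Radarization is a Galilean shear followed by exactly this boost (`rad_eq_boost`). In `M.classical`
the boosts therefore cancel, and each observer is related to `e` by a Galilean transformation
(`exists_isFrame`). Absolute time, agreement on simultaneous distances, straightness of worldlines
and sameness of events are then immediate. AxSelf holds since radarization preserves the time axis,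
and AxTriv since it is compatible with trivial transformations (`rad_triv`). A Galilean
transformation with `v ≠ 0` destroys isotropy of light, so the ether observers of `M.classical` are
those at rest relative to `e` (`of_lightSpeed`, `ether_iff`). Their worldviews are untouched by
radarization, so the two axioms about slower-than-light motion are inherited from special
relativity. -/

namespace KinLogic

/-! ### Substitution calculus -/

theorem Term.subst_subst (t : Term) (σ τ : ℕ → Term) :
    (t.subst σ).subst τ = t.subst fun i => (σ i).subst τ := by
  induction t with
  | var n => rfl
  | add s t hs ht => simp only [Term.subst, hs, ht]
  | mul s t hs ht => simp only [Term.subst, hs, ht]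

theorem Term.subst_var (t : Term) : t.subst Term.var = t := by
  induction t with
  | var n => rfl
  | add s t hs ht => simp only [Term.subst, hs, ht]
  | mul s t hs ht => simp only [Term.subst, hs, ht]

theorem liftB_liftB (ρ ρ' : ℕ → ℕ) : (fun i => liftB ρ' (liftB ρ i)) = liftB fun i => ρ' (ρ i) := by
  funext i; cases i <;> rfl

theorem liftQ_liftQ (σ τ : ℕ → Term) :
    (fun i => (liftQ σ i).subst (liftQ τ)) = liftQ fun i => (σ i).subst τ := by
  funext i
  cases i with
  | zero => rfl
  | succ i => simp only [liftQ, Term.subst_subst, Term.subst]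

theorem liftB_id : (liftB fun i => i) = fun i => i := by
  funext i; cases i <;> rfl

theorem liftQ_var : liftQ Term.var = Term.var := by
  funext i; cases i <;> rfl

variable {X : Type}

theorem Formula.subst_subst (φ : Formula X) (ρ ρ' : ℕ → ℕ) (σ σ' : ℕ → Term) :
    (φ.subst ρ σ).subst ρ' σ' = φ.subst (fun i => ρ' (ρ i)) fun i => (σ i).subst σ' := by
  induction φ generalizing ρ ρ' σ σ' with
  | imp φ ψ hφ hψ => simp only [Formula.subst, hφ, hψ]
  | allB φ h => simp only [Formula.subst, h, liftB_liftB]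
  | allQ φ h => simp only [Formula.subst, h, liftQ_liftQ]
  | _ => simp only [Formula.subst, Term.subst_subst]

theorem Formula.subst_id (φ : Formula X) : φ.subst (fun i => i) Term.var = φ := by
  induction φ with
  | imp φ ψ hφ hψ => simp only [Formula.subst, hφ, hψ]
  | allB φ h => simp only [Formula.subst, h, liftB_id]
  | allQ φ h => simp only [Formula.subst, h, liftQ_var]
  | _ => simp only [Formula.subst, Term.subst_var]

/-- The sequence `a, β 0, β 1, …`. -/
def push {α : Type} (a : α) (β : ℕ → α) : ℕ → α
  | 0 => a
  | n + 1 => β n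

theorem Formula.instB_eq (φ : Formula X) (k : ℕ) :
    φ.instB k = φ.subst (push k fun i => i) Term.var := by
  unfold Formula.instB
  congr 1

theorem Formula.instQ_eq (φ : Formula X) (t : Term) :
    φ.instQ t = φ.subst (fun i => i) (push t Term.var) := by
  unfold Formula.instQ
  congr 1

theorem Formula.subst_lift_instB (φ : Formula X) (ρ : ℕ → ℕ) (σ : ℕ → Term) (k : ℕ) :
    (φ.subst (liftB ρ) σ).instB k = φ.subst (push k ρ) σ := by
  rw [Formula.instB_eq, Formula.subst_subst]
  congr 1
  · funext i; cases i <;> rfl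
  · funext i; exact Term.subst_var _

theorem Term.subst_shift_push (s t : Term) :
    (s.subst fun i => .var (i + 1)).subst (push t Term.var) = s := by
  rw [Term.subst_subst]
  exact Term.subst_var s

theorem Formula.subst_lift_instQ (φ : Formula X) (ρ : ℕ → ℕ) (σ : ℕ → Term) (t : Term) :
    (φ.subst ρ (liftQ σ)).instQ t = φ.subst ρ (push t σ) := by
  rw [Formula.instQ_eq, Formula.subst_subst]
  congr 1
  funext i
  cases i with
  | zero => rfl
  | succ i => exact Term.subst_shift_push _ _

theorem Formula.instB_subst (φ : Formula X) (ρ : ℕ → ℕ) (σ : ℕ → Term) (k : ℕ) :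
    (φ.instB k).subst ρ σ = (φ.subst (liftB ρ) σ).instB (ρ k) := by
  rw [Formula.subst_lift_instB, Formula.instB_eq, Formula.subst_subst]
  congr 1
  funext i; cases i <;> rfl

theorem Formula.instQ_subst (φ : Formula X) (ρ : ℕ → ℕ) (σ : ℕ → Term) (t : Term) :
    (φ.instQ t).subst ρ σ = (φ.subst ρ (liftQ σ)).instQ (t.subst σ) := by
  rw [Formula.subst_lift_instQ, Formula.instQ_eq, Formula.subst_subst]
  congr 1
  funext i; cases i <;> rfl

theorem Formula.shiftB_subst (φ : Formula X) (ρ : ℕ → ℕ) (σ : ℕ → Term) :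
    φ.shiftB.subst (liftB ρ) σ = (φ.subst ρ σ).shiftB := by
  unfold Formula.shiftB
  rw [Formula.subst_subst, Formula.subst_subst]
  congr 1
  funext i; exact (Term.subst_var _).symm

theorem Formula.shiftQ_subst (φ : Formula X) (ρ : ℕ → ℕ) (σ : ℕ → Term) :
    φ.shiftQ.subst ρ (liftQ σ) = (φ.subst ρ σ).shiftQ := by
  unfold Formula.shiftQ
  rw [Formula.subst_subst, Formula.subst_subst]
  rfl

/-! ### Closed formulas -/

theorem Term.closedAt_mono {t : Term} {n n' : ℕ} (h : n ≤ n') (ht : t.closedAt n = true) :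
    t.closedAt n' = true := by
  induction t with
  | var i => simp only [Term.closedAt, decide_eq_true_eq] at *; omega
  | add s t hs ht' => simp_all [Term.closedAt]
  | mul s t hs ht' => simp_all [Term.closedAt]

theorem Term.exists_closedAt (t : Term) : ∃ n, t.closedAt n = true := by
  induction t with
  | var i => exact ⟨i + 1, by simp [Term.closedAt]⟩
  | add s t hs ht =>
    obtain ⟨a, ha⟩ := hs
    obtain ⟨b, hb⟩ := ht
    exact ⟨max a b, by simp [Term.closedAt, closedAt_mono (le_max_left a b) ha,
      closedAt_mono (le_max_right a b) hb]⟩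
  | mul s t hs ht =>
    obtain ⟨a, ha⟩ := hs
    obtain ⟨b, hb⟩ := ht
    exact ⟨max a b, by simp [Term.closedAt, closedAt_mono (le_max_left a b) ha,
      closedAt_mono (le_max_right a b) hb]⟩

theorem Formula.closedAt_mono {φ : Formula X} {m n m' n' : ℕ} (hm : m ≤ m') (hn : n ≤ n')
    (h : φ.closedAt m n = true) : φ.closedAt m' n' = true := by
  have key : ∀ t : Term, t.closedAt n = true → t.closedAt n' = true :=
    fun t => Term.closedAt_mono hn
  induction φ generalizing m n m' n' with
  | bot => rfl
  | imp φ ψ hφ hψ =>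
    simp only [Formula.closedAt, Bool.and_eq_true] at *
    exact ⟨hφ hm hn h.1 key, hψ hm hn h.2 key⟩
  | allB φ ih => exact ih (by omega) hn h key
  | allQ φ ih => exact ih hm (by omega) h fun t => Term.closedAt_mono (by omega)
  | _ =>
    simp only [Formula.closedAt, Bool.and_eq_true, decide_eq_true_eq] at *
    grind

/-- A formula has finitely many free variables. This supplies the bound above which the variables
serving as Henkin witnesses are fresh. -/
theorem Formula.exists_closedAt (φ : Formula X) : ∃ n, φ.closedAt n n = true := by
  have two : ∀ s t : Term, ∃ n, s.closedAt n = true ∧ t.closedAt n = true := fun s t =>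
    Term.exists_closedAt (s.add t) |>.imp fun n h => by simpa [Term.closedAt] using h
  induction φ with
  | bot => exact ⟨0, rfl⟩
  | imp φ ψ hφ hψ =>
    obtain ⟨a, ha⟩ := hφ
    obtain ⟨b, hb⟩ := hψ
    exact ⟨max a b, by simp [Formula.closedAt,
      closedAt_mono (le_max_left a b) (le_max_left a b) ha,
      closedAt_mono (le_max_right a b) (le_max_right a b) hb]⟩
  | allB φ h => exact h.imp fun n hn => closedAt_mono (φ := φ) n.le_succ le_rfl hn
  | allQ φ h => exact h.imp fun n hn => closedAt_mono (φ := φ) le_rfl n.le_succ hn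
  | eqB k b => exact ⟨max k b + 1, by simp [Formula.closedAt]⟩
  | eqQ s t => exact (two s t).imp fun n h => by simpa [Formula.closedAt] using h
  | le s t => exact (two s t).imp fun n h => by simpa [Formula.closedAt] using h
  | IOb k => exact ⟨k + 1, by simp [Formula.closedAt]⟩
  | Ph k => exact ⟨k + 1, by simp [Formula.closedAt]⟩
  | ext x k => exact ⟨k + 1, by simp [Formula.closedAt]⟩
  | W k b t₀ t₁ t₂ t₃ =>
    obtain ⟨n, h⟩ := Term.exists_closedAt ((t₀.add t₁).add (t₂.add t₃))
    have mono : ∀ t : Term, t.closedAt n = true → t.closedAt (max (max k b + 1) n) = true :=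
      fun t => Term.closedAt_mono (le_max_right _ _)
    refine ⟨max (max k b + 1) n, ?_⟩
    simp only [Term.closedAt, Bool.and_eq_true] at h
    simp only [Formula.closedAt, Bool.and_eq_true, decide_eq_true_eq]
    exact ⟨⟨⟨⟨⟨by omega, by omega⟩, mono _ h.1.1⟩, mono _ h.1.2⟩, mono _ h.2.1⟩, mono _ h.2.2⟩

theorem Term.subst_congr {t : Term} {n : ℕ} (h : t.closedAt n = true) {σ σ' : ℕ → Term}
    (hσ : ∀ i < n, σ i = σ' i) : t.subst σ = t.subst σ' := by
  induction t with
  | var i => exact hσ i (by simpa [Term.closedAt] using h)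
  | add s t hs ht =>
    simp only [Term.closedAt, Bool.and_eq_true] at h
    simp only [Term.subst, hs h.1, ht h.2]
  | mul s t hs ht =>
    simp only [Term.closedAt, Bool.and_eq_true] at h
    simp only [Term.subst, hs h.1, ht h.2]

theorem Formula.subst_congr {φ : Formula X} {m n : ℕ} (h : φ.closedAt m n = true)
    {ρ ρ' : ℕ → ℕ} {σ σ' : ℕ → Term} (hρ : ∀ i < m, ρ i = ρ' i) (hσ : ∀ i < n, σ i = σ' i) :
    φ.subst ρ σ = φ.subst ρ' σ' := by
  have key : ∀ t : Term, t.closedAt n = true → t.subst σ = t.subst σ' :=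
    fun t ht => Term.subst_congr ht hσ
  induction φ generalizing m n ρ ρ' σ σ' with
  | bot => rfl
  | imp φ ψ hφ hψ =>
    simp only [Formula.closedAt, Bool.and_eq_true] at h
    simp only [Formula.subst, hφ h.1 hρ hσ key, hψ h.2 hρ hσ key]
  | allB φ ih =>
    have : ∀ i < m + 1, liftB ρ i = liftB ρ' i := by
      intro i hi
      cases i with
      | zero => rfl
      | succ i => simp only [liftB, hρ i (by omega)]
    simp only [Formula.subst, ih h this hσ key]
  | allQ φ ih =>
    have : ∀ i < n + 1, liftQ σ i = liftQ σ' i := by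
      intro i hi
      cases i with
      | zero => rfl
      | succ i => simp only [liftQ, hσ i (by omega)]
    simp only [Formula.subst, ih h hρ this fun t ht => Term.subst_congr ht this]
  | _ =>
    simp only [Formula.closedAt, Bool.and_eq_true, decide_eq_true_eq] at h
    simp only [Formula.subst]
    grind

/-! ### Structural properties of provability -/

theorem Provable.mono {Γ Δ : Set (Formula X)} {φ : Formula X} (h : Provable Γ φ) (hΓ : Γ ⊆ Δ) :
    Provable Δ φ := by
  induction h generalizing Δ with
  | assumption h => exact .assumption (hΓ h)
  | impI _ ih => exact .impI (ih (Set.insert_subset_insert hΓ))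
  | impE _ _ ih₁ ih₂ => exact .impE (ih₁ hΓ) (ih₂ hΓ)
  | byContra _ ih => exact .byContra (ih (Set.insert_subset_insert hΓ))
  | allBI _ ih => exact .allBI (ih (Set.image_mono hΓ))
  | allBE k _ ih => exact .allBE k (ih hΓ)
  | allQI _ ih => exact .allQI (ih (Set.image_mono hΓ))
  | allQE t _ ih => exact .allQE t (ih hΓ)
  | eqBRefl k => exact .eqBRefl k
  | eqBSubst _ _ ih₁ ih₂ => exact .eqBSubst (ih₁ hΓ) (ih₂ hΓ)
  | eqQRefl t => exact .eqQRefl t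
  | eqQSubst _ _ ih₁ ih₂ => exact .eqQSubst (ih₁ hΓ) (ih₂ hΓ)

/-- In the quantifier rules the lifted substitution commutes with the shift of the assumptions, so
generalizations stay legitimate. The lemma is needed for renamings that turn a fresh variable into
the de Bruijn index `0`. -/
theorem Provable.subst {Γ : Set (Formula X)} {φ : Formula X} (h : Provable Γ φ) (ρ : ℕ → ℕ)
    (σ : ℕ → Term) : Provable ((fun ψ => ψ.subst ρ σ) '' Γ) (φ.subst ρ σ) := by
  induction h generalizing ρ σ with
  | assumption h => exact .assumption (Set.mem_image_of_mem _ h)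
  | impI _ ih => exact .impI (by simpa only [Set.image_insert_eq] using ih ρ σ)
  | impE _ _ ih₁ ih₂ => exact .impE (ih₁ ρ σ) (ih₂ ρ σ)
  | byContra _ ih =>
    exact .byContra (by simpa only [Set.image_insert_eq, Formula.subst] using ih ρ σ)
  | allBI _ ih =>
    refine .allBI ?_
    have := ih (liftB ρ) σ
    simpa only [Set.image_image, Formula.shiftB_subst] using this
  | allBE k _ ih => rw [Formula.instB_subst]; exact .allBE _ (ih ρ σ)
  | allQI _ ih =>
    refine .allQI ?_
    have := ih ρ (liftQ σ)
    simpa only [Set.image_image, Formula.shiftQ_subst] using this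
  | allQE t _ ih => rw [Formula.instQ_subst]; exact .allQE _ (ih ρ σ)
  | eqBRefl k => exact .eqBRefl _
  | eqBSubst _ _ ih₁ ih₂ =>
    rw [Formula.instB_subst] at *
    exact .eqBSubst (ih₁ ρ σ) (by simpa only [Formula.instB_subst] using ih₂ ρ σ)
  | eqQRefl t => exact .eqQRefl _
  | eqQSubst _ _ ih₁ ih₂ =>
    rw [Formula.instQ_subst] at *
    exact .eqQSubst (ih₁ ρ σ) (by simpa only [Formula.instQ_subst] using ih₂ ρ σ)

/-- Generalization over a body variable that is fresh for the assumptions. -/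
theorem Provable.allB_of_fresh {Γ : Set (Formula X)} {φ : Formula X} {m n : ℕ}
    (hΓ : ∀ ψ ∈ Γ, ψ.closedAt m n = true) (hφ : (Formula.allB φ).closedAt m n = true)
    (h : Provable Γ (φ.instB m)) : Provable Γ (.allB φ) := by
  refine .allBI ?_
  -- The renaming sends the fresh variable to `0` and raises all others. On `Γ`, which does not
  -- mention `m`, it is the shift; on the instance of `φ` it undoes the instantiation.
  have := h.subst (fun i => if i = m then 0 else i + 1) Term.var
  have h₁ : (fun ψ : Formula X => ψ.subst (fun i => if i = m then 0 else i + 1) Term.var) '' Γ =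
      Formula.shiftB '' Γ := by
    refine Set.image_congr fun ψ hψ => Formula.subst_congr (hΓ ψ hψ) (fun i hi => ?_) fun _ _ => rfl
    simp only [if_neg hi.ne]
  have h₂ : (φ.instB m).subst (fun i => if i = m then 0 else i + 1) Term.var = φ := by
    conv_rhs => rw [← φ.subst_id]
    rw [Formula.instB_eq, Formula.subst_subst]
    refine Formula.subst_congr (m := m + 1) (n := n) hφ (fun i hi => ?_) fun _ _ => rfl
    cases i with
    | zero => simp [push]
    | succ i => exact if_neg (show ¬i = m by omega)
  rwa [h₁, h₂] at this

/-- Generalization over a quantity variable that is fresh for the assumptions. -/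
theorem Provable.allQ_of_fresh {Γ : Set (Formula X)} {φ : Formula X} {m n : ℕ}
    (hΓ : ∀ ψ ∈ Γ, ψ.closedAt m n = true) (hφ : (Formula.allQ φ).closedAt m n = true)
    (h : Provable Γ (φ.instQ (.var n))) : Provable Γ (.allQ φ) := by
  refine .allQI ?_
  have := h.subst (fun i => i) (fun i => if i = n then .var 0 else .var (i + 1))
  have h₁ : (fun ψ : Formula X => ψ.subst (fun i => i)
      (fun i => if i = n then .var 0 else .var (i + 1))) '' Γ = Formula.shiftQ '' Γ := by
    refine Set.image_congr fun ψ hψ => Formula.subst_congr (hΓ ψ hψ) (fun _ _ => rfl) fun i hi => ?_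
    simp only [if_neg hi.ne]
  have h₂ : (φ.instQ (.var n)).subst (fun i => i)
      (fun i => if i = n then .var 0 else .var (i + 1)) = φ := by
    conv_rhs => rw [← φ.subst_id]
    rw [Formula.instQ_eq, Formula.subst_subst]
    refine Formula.subst_congr (m := m) (n := n + 1) hφ (fun _ _ => rfl) fun i hi => ?_
    cases i with
    | zero => simp [push, Term.subst]
    | succ i => simp only [push, Term.subst]; rw [if_neg (by omega)]
  rwa [h₁, h₂] at this

/-! ### Semantics and soundness -/

/-- Interpretations of the relation symbols on the domains `B` and `Q`; the operations and the
ordering of `Q` are supplied as instances. -/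
structure Model (X B Q : Type) where
  iob : B → Prop
  ph : B → Prop
  ext : X → B → Prop
  W : B → B → (Fin 4 → Q) → Prop

variable {B Q : Type}

theorem push_liftB (ρ : ℕ → ℕ) (b : B) (β : ℕ → B) :
    (fun i => push b β (liftB ρ i)) = push b fun i => β (ρ i) := by
  funext i; cases i <;> rfl

variable [Add Q] [Mul Q]

/-- The value of a term. -/
def Term.eval (κ : ℕ → Q) : Term → Q
  | .var n => κ n
  | .add s t => s.eval κ + t.eval κ
  | .mul s t => s.eval κ * t.eval κ

theorem Term.eval_subst (t : Term) (σ : ℕ → Term) (κ : ℕ → Q) :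
    (t.subst σ).eval κ = t.eval fun i => (σ i).eval κ := by
  induction t with
  | var n => rfl
  | add s t hs ht => simp only [Term.subst, Term.eval, hs, ht]
  | mul s t hs ht => simp only [Term.subst, Term.eval, hs, ht]

theorem eval_liftQ (σ : ℕ → Term) (a : Q) (κ : ℕ → Q) :
    (fun i => (liftQ σ i).eval (push a κ)) = push a fun i => (σ i).eval κ := by
  funext i
  cases i with
  | zero => rfl
  | succ i => exact Term.eval_subst _ _ _

variable [LE Q]

/-- Satisfaction. -/
def Formula.Sat (M : Model X B Q) : Formula X → (ℕ → B) → (ℕ → Q) → Prop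
  | .bot, _, _ => False
  | .imp φ ψ, β, κ => φ.Sat M β κ → ψ.Sat M β κ
  | .allB φ, β, κ => ∀ b, φ.Sat M (push b β) κ
  | .allQ φ, β, κ => ∀ a, φ.Sat M β (push a κ)
  | .eqB k b, β, _ => β k = β b
  | .eqQ s t, _, κ => s.eval κ = t.eval κ
  | .le s t, _, κ => s.eval κ ≤ t.eval κ
  | .IOb k, β, _ => M.iob (β k)
  | .Ph p, β, _ => M.ph (β p)
  | .ext x k, β, _ => M.ext x (β k)
  | .W k b t₀ t₁ t₂ t₃, β, κ =>
      M.W (β k) (β b) ![t₀.eval κ, t₁.eval κ, t₂.eval κ, t₃.eval κ]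

theorem Formula.sat_subst (M : Model X B Q) (φ : Formula X) (ρ : ℕ → ℕ) (σ : ℕ → Term)
    (β : ℕ → B) (κ : ℕ → Q) :
    (φ.subst ρ σ).Sat M β κ ↔ φ.Sat M (fun i => β (ρ i)) fun i => (σ i).eval κ := by
  induction φ generalizing ρ σ β κ with
  | imp φ ψ hφ hψ => simp only [Formula.subst, Formula.Sat, hφ, hψ]
  | allB φ ih => simp only [Formula.subst, Formula.Sat, ih, push_liftB]
  | allQ φ ih => simp only [Formula.subst, Formula.Sat, ih, eval_liftQ]
  | _ => simp only [Formula.subst, Formula.Sat, Term.eval_subst]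

theorem Formula.sat_instB (M : Model X B Q) (φ : Formula X) (k : ℕ) (β : ℕ → B) (κ : ℕ → Q) :
    (φ.instB k).Sat M β κ ↔ φ.Sat M (push (β k) β) κ := by
  rw [Formula.instB_eq, Formula.sat_subst]
  refine iff_of_eq (congrArg₂ _ ?_ rfl)
  funext i; cases i <;> rfl

theorem Formula.sat_instQ (M : Model X B Q) (φ : Formula X) (t : Term) (β : ℕ → B) (κ : ℕ → Q) :
    (φ.instQ t).Sat M β κ ↔ φ.Sat M β (push (t.eval κ) κ) := by
  rw [Formula.instQ_eq, Formula.sat_subst]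
  refine iff_of_eq (congrArg _ ?_)
  funext i; cases i <;> rfl

theorem Formula.sat_shiftB (M : Model X B Q) (φ : Formula X) (b : B) (β : ℕ → B) (κ : ℕ → Q) :
    φ.shiftB.Sat M (push b β) κ ↔ φ.Sat M β κ :=
  φ.sat_subst M _ _ _ _

theorem Formula.sat_shiftQ (M : Model X B Q) (φ : Formula X) (a : Q) (β : ℕ → B) (κ : ℕ → Q) :
    φ.shiftQ.Sat M β (push a κ) ↔ φ.Sat M β κ :=
  φ.sat_subst M _ _ _ _

theorem Provable.sound {Γ : Set (Formula X)} {φ : Formula X} (h : Provable Γ φ)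
    (M : Model X B Q) (β : ℕ → B) (κ : ℕ → Q) (hΓ : ∀ ψ ∈ Γ, ψ.Sat M β κ) : φ.Sat M β κ := by
  induction h generalizing β κ with
  | assumption h => exact hΓ _ h
  | impI _ ih => exact fun h => ih β κ (Set.forall_mem_insert.2 ⟨h, hΓ⟩)
  | impE _ _ ih₁ ih₂ => exact ih₁ β κ hΓ (ih₂ β κ hΓ)
  | byContra _ ih => exact by_contra fun h => ih β κ (Set.forall_mem_insert.2 ⟨h, hΓ⟩)
  | allBI _ ih =>
    exact fun b => ih _ κ (Set.forall_mem_image.2 fun ψ hψ => (ψ.sat_shiftB M b β κ).2 (hΓ ψ hψ))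
  | allBE k _ ih => exact (Formula.sat_instB M _ k β κ).2 (ih β κ hΓ _)
  | allQI _ ih =>
    exact fun a => ih β _ (Set.forall_mem_image.2 fun ψ hψ => (ψ.sat_shiftQ M a β κ).2 (hΓ ψ hψ))
  | allQE t _ ih => exact (Formula.sat_instQ M _ t β κ).2 (ih β κ hΓ _)
  | eqBRefl k => exact rfl
  | eqBSubst _ _ ih₁ ih₂ =>
    have e := ih₁ β κ hΓ
    have h := ih₂ β κ hΓ
    rw [Formula.sat_instB] at h ⊢
    rwa [← show β _ = β _ from e]
  | eqQRefl t => exact rfl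
  | eqQSubst _ _ ih₁ ih₂ =>
    have e := ih₁ β κ hΓ
    have h := ih₂ β κ hΓ
    rw [Formula.sat_instQ] at h ⊢
    rwa [← show Term.eval κ _ = Term.eval κ _ from e]

/-! ### Completeness -/

/-- A code for terms. -/
def Term.code : Term → ℕ
  | .var n => Nat.pair 0 n
  | .add s t => Nat.pair 1 (Nat.pair s.code t.code)
  | .mul s t => Nat.pair 2 (Nat.pair s.code t.code)

theorem Term.code_injective : Function.Injective Term.code := by
  intro s
  induction s with
  | var n => intro t; cases t <;> simp [Term.code]
  | add s₁ s₂ h₁ h₂ =>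
    intro t
    cases t with
    | add t₁ t₂ =>
      simp only [Term.code, Nat.pair_eq_pair, true_and]
      rintro ⟨e₁, e₂⟩
      rw [h₁ e₁, h₂ e₂]
    | _ => simp [Term.code]
  | mul s₁ s₂ h₁ h₂ =>
    intro t
    cases t with
    | mul t₁ t₂ =>
      simp only [Term.code, Nat.pair_eq_pair, true_and]
      rintro ⟨e₁, e₂⟩
      rw [h₁ e₁, h₂ e₂]
    | _ => simp [Term.code]

variable {X : Type}

/-- A code for formulas. -/
noncomputable def Formula.code [Encodable X] : Formula X → ℕ
  | .bot => Nat.pair 0 0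
  | .imp φ ψ => Nat.pair 1 (Nat.pair φ.code ψ.code)
  | .allB φ => Nat.pair 2 φ.code
  | .allQ φ => Nat.pair 3 φ.code
  | .eqB k b => Nat.pair 4 (Nat.pair k b)
  | .eqQ s t => Nat.pair 5 (Nat.pair s.code t.code)
  | .le s t => Nat.pair 6 (Nat.pair s.code t.code)
  | .IOb k => Nat.pair 7 k
  | .Ph k => Nat.pair 8 k
  | .ext x k => Nat.pair 9 (Nat.pair (Encodable.encode x) k)
  | .W k b t₀ t₁ t₂ t₃ => Nat.pair 10 (Nat.pair (Nat.pair k b)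
      (Nat.pair (Nat.pair t₀.code t₁.code) (Nat.pair t₂.code t₃.code)))

theorem Formula.code_injective [Encodable X] :
    Function.Injective (Formula.code : Formula X → ℕ) := by
  intro φ
  induction φ with
  | imp φ₁ φ₂ h₁ h₂ =>
    intro ψ
    cases ψ with
    | imp ψ₁ ψ₂ =>
      simp only [Formula.code, Nat.pair_eq_pair, true_and]
      rintro ⟨e₁, e₂⟩
      rw [h₁ e₁, h₂ e₂]
    | _ => simp [Formula.code]
  | allB φ h =>
    intro ψ
    cases ψ with
    | allB ψ =>
      simp only [Formula.code, Nat.pair_eq_pair, true_and]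
      intro e
      rw [h e]
    | _ => simp [Formula.code]
  | allQ φ h =>
    intro ψ
    cases ψ with
    | allQ ψ =>
      simp only [Formula.code, Nat.pair_eq_pair, true_and]
      intro e
      rw [h e]
    | _ => simp [Formula.code]
  | _ =>
    intro ψ
    cases ψ <;> simp +contextual [Formula.code, Term.code_injective.eq_iff]

/-- Countability lets the Henkin extension run along `ℕ`. Each stage adds finitely many formulas, so
a bound on the free variables persists and fresh variables remain available. -/
instance [Countable X] : Countable (Formula X) :=
  have := Encodable.ofCountable X
  Formula.code_injective.countable

/-- A consistent set of formulas with boundedly many free variables. -/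
def Good (C : Set (Formula X)) : Prop :=
  (∃ m n, ∀ ψ ∈ C, ψ.closedAt m n = true) ∧ ¬Provable C .bot

theorem Provable.ofBot {Γ : Set (Formula X)} {φ : Formula X} (h : Provable Γ .bot) :
    Provable Γ φ :=
  .byContra (h.mono (Set.subset_insert _ _))

theorem exists_bound_insert {C : Set (Formula X)} (φ : Formula X)
    (h : ∃ m n, ∀ ψ ∈ C, ψ.closedAt m n = true) :
    ∃ m n, ∀ ψ ∈ insert φ C, ψ.closedAt m n = true := by
  obtain ⟨m, n, h⟩ := h
  obtain ⟨l, hl⟩ := φ.exists_closedAt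
  refine ⟨max m l, max n l, Set.forall_mem_insert.2 ⟨?_, fun ψ hψ => ?_⟩⟩
  · exact Formula.closedAt_mono (le_max_right _ _) (le_max_right _ _) hl
  · exact Formula.closedAt_mono (le_max_left _ _) (le_max_left _ _) (h ψ hψ)

theorem Good.insert {C : Set (Formula X)} {φ : Formula X} (h : Good C)
    (hφ : ¬Provable C (.imp φ .bot)) : Good (insert φ C) :=
  ⟨exists_bound_insert φ h.1, fun hb => hφ (.impI hb)⟩

theorem Good.insert_not {C : Set (Formula X)} {φ : Formula X} (h : Good C)
    (hφ : ¬Provable C φ) : Good (Insert.insert (.imp φ .bot) C) :=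
  ⟨exists_bound_insert _ h.1, fun hb => hφ (.byContra hb)⟩

/-- `D` decides `φ`, and contains a counterexample to `φ` if `φ` is a universal formula that it
refutes. -/
def Decides (D : Set (Formula X)) (φ : Formula X) : Prop :=
  (φ ∈ D ∨ .imp φ .bot ∈ D) ∧
  (∀ ψ, φ = .allB ψ → φ ∈ D ∨ ∃ k, .imp (ψ.instB k) .bot ∈ D) ∧
  (∀ ψ, φ = .allQ ψ → φ ∈ D ∨ ∃ t, .imp (ψ.instQ t) .bot ∈ D)

/-- If `φ` is not refuted it can be added. If it is refuted, its negation is added, and for a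
universal `φ` also the negation of its instance at a fresh variable: were this inconsistent, that
instance would be provable, and generalization would prove `φ`. -/
theorem Good.exists_decides {C : Set (Formula X)} (h : Good C) (φ : Formula X) :
    ∃ D, C ⊆ D ∧ Good D ∧ Decides D φ := by
  by_cases hφ : Provable C (.imp φ .bot)
  · have hn : ¬Provable C φ := fun hp => h.2 (.impE hφ hp)
    have hD := h.insert_not hn
    obtain ⟨m, n, hb⟩ := exists_bound_insert φ hD.1
    have sub : C ⊆ Insert.insert (Formula.imp φ .bot) C := Set.subset_insert _ _
    have hφ' := hb φ (Set.mem_insert _ _)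
    have hb' : ∀ ψ ∈ Insert.insert (Formula.imp φ .bot) C, ψ.closedAt m n = true :=
      fun ψ hψ => hb ψ (Set.mem_insert_of_mem _ hψ)
    have not_proves : ¬Provable (Insert.insert (Formula.imp φ .bot) C) φ := fun hp =>
      hD.2 (.impE (.assumption (Set.mem_insert _ _)) hp)
    by_cases hB : ∃ ψ, φ = .allB ψ
    · obtain ⟨ψ, rfl⟩ := hB
      refine ⟨_, sub.trans (Set.subset_insert _ _), hD.insert_not (φ := ψ.instB m)
        fun hp => not_proves (.allB_of_fresh hb' hφ' hp), ?_⟩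
      refine ⟨Or.inr (Set.mem_insert_of_mem _ (Set.mem_insert _ _)), ?_, by simp⟩
      rintro ψ' e
      cases e
      exact Or.inr ⟨m, Set.mem_insert _ _⟩
    by_cases hQ : ∃ ψ, φ = .allQ ψ
    · obtain ⟨ψ, rfl⟩ := hQ
      refine ⟨_, sub.trans (Set.subset_insert _ _), hD.insert_not (φ := ψ.instQ (.var n))
        fun hp => not_proves (.allQ_of_fresh hb' hφ' hp), ?_⟩
      refine ⟨Or.inr (Set.mem_insert_of_mem _ (Set.mem_insert _ _)), by simp, ?_⟩
      rintro ψ' e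
      cases e
      exact Or.inr ⟨_, Set.mem_insert _ _⟩
    exact ⟨_, sub, hD, Or.inr (Set.mem_insert _ _), fun ψ e => (hB ⟨ψ, e⟩).elim,
      fun ψ e => (hQ ⟨ψ, e⟩).elim⟩
  · exact ⟨_, Set.subset_insert φ C, h.insert hφ, Or.inl (Set.mem_insert _ _),
      fun _ _ => Or.inl (Set.mem_insert _ _), fun _ _ => Or.inl (Set.mem_insert _ _)⟩

/-- A complete Henkin set: the provable formulas of a chain of consistent sets. -/
structure HenkinSet (D : Set (Formula X)) : Prop where
  not_bot : .bot ∉ D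
  mem_or : ∀ φ, φ ∈ D ∨ .imp φ .bot ∈ D
  closed : ∀ Γ : Set (Formula X), Γ.Finite → Γ ⊆ D → ∀ φ, Provable Γ φ → φ ∈ D
  allB : ∀ φ : Formula X, (∀ k, φ.instB k ∈ D) → .allB φ ∈ D
  allQ : ∀ φ : Formula X, (∀ t, φ.instQ t ∈ D) → .allQ φ ∈ D

/-- The formulas are decided one after another, and the union of the stages is taken. A finite
subset of the union lies in a single stage, which is why deductive closure is only asked for finite
sets of premises. -/
theorem Good.exists_henkinSet [Countable X] {C : Set (Formula X)} (h : Good C) :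
    ∃ D, C ⊆ D ∧ HenkinSet D := by
  have : Nonempty (Formula X) := ⟨.bot⟩
  obtain ⟨f, hf⟩ := exists_surjective_nat (Formula X)
  have step : ∀ (S : {S : Set (Formula X) // Good S}) (φ : Formula X),
      ∃ T : {S : Set (Formula X) // Good S}, S.1 ⊆ T.1 ∧ Decides T.1 φ := fun S φ =>
    let ⟨T, h₁, h₂, h₃⟩ := S.2.exists_decides φ
    ⟨⟨T, h₂⟩, h₁, h₃⟩
  choose next hsub hdec using step
  let c : ℕ → {S : Set (Formula X) // Good S} := fun i =>
    Nat.rec ⟨C, h⟩ (fun i S => next S (f i)) i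
  have mono : Monotone fun i => (c i).1 := monotone_nat_of_le_succ fun i => hsub (c i) (f i)
  have dec : ∀ φ, ∃ i, Decides (c i).1 φ := fun φ => by
    obtain ⟨i, rfl⟩ := hf φ
    exact ⟨i + 1, hdec (c i) (f i)⟩
  have incl : ∀ i, (c i).1 ⊆ ⋃ i, (c i).1 := fun i => Set.subset_iUnion (fun i => (c i).1) i
  have fin : ∀ Γ : Set (Formula X), Γ.Finite → Γ ⊆ ⋃ i, (c i).1 → ∃ i, Γ ⊆ (c i).1 := by
    intro Γ hΓ hsub
    exact DirectedOn.exists_mem_subset_of_finite_of_subset_sUnion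
      (c := Set.range fun i => (c i).1) (Set.range_nonempty _)
      (directedOn_range.2 mono.directed_le) hΓ (by simpa [Set.sUnion_range] using hsub)
      |>.elim fun S hS => by
        obtain ⟨⟨i, rfl⟩, hi⟩ := hS
        exact ⟨i, hi⟩
  have closed : ∀ Γ : Set (Formula X), Γ.Finite → Γ ⊆ ⋃ i, (c i).1 →
      ∀ φ, Provable Γ φ → φ ∈ ⋃ i, (c i).1 := by
    intro Γ hΓ hsub φ hφ
    obtain ⟨i, hi⟩ := fin Γ hΓ hsub
    obtain ⟨j, hj⟩ := dec φ
    rcases hj.1 with hj | hj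
    · exact incl j hj
    · exact ((c (max i j)).2.2 (.impE (.assumption (mono (le_max_right i j) hj))
        (hφ.mono (hi.trans (mono (le_max_left i j)))))).elim
  have not_bot : .bot ∉ ⋃ i, (c i).1 := fun hb => by
    obtain ⟨i, hi⟩ := Set.mem_iUnion.1 hb
    exact (c i).2.2 (.assumption hi)
  have not_both : ∀ φ, φ ∈ ⋃ i, (c i).1 → .imp φ .bot ∈ ⋃ i, (c i).1 → False := by
    intro φ h₁ h₂
    refine not_bot (closed {φ, .imp φ .bot} (Set.toFinite _) ?_ _
      (.impE (φ := φ) (.assumption (by simp)) (.assumption (by simp))))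
    rintro ψ (rfl | rfl)
    exacts [h₁, h₂]
  refine ⟨⋃ i, (c i).1, incl 0, not_bot, fun φ => ?_, closed, fun φ hφ => ?_, fun φ hφ => ?_⟩
  · obtain ⟨i, hi⟩ := dec φ
    exact hi.1.imp (fun h => incl i h) fun h => incl i h
  · obtain ⟨i, hi⟩ := dec (.allB φ)
    rcases hi.2.1 φ rfl with hi | ⟨k, hk⟩
    · exact incl i hi
    · exact (not_both _ (hφ k) (incl i hk)).elim
  · obtain ⟨i, hi⟩ := dec (.allQ φ)
    rcases hi.2.2 φ rfl with hi | ⟨k, hk⟩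
    · exact incl i hi
    · exact (not_both _ (hφ k) (incl i hk)).elim

/-! ### The term model of a complete Henkin set -/

namespace HenkinSet

variable {D : Set (Formula X)}

theorem of_provable (hD : HenkinSet D) {φ : Formula X} (h : Provable ∅ φ) : φ ∈ D :=
  hD.closed ∅ Set.finite_empty (Set.empty_subset _) φ h

theorem of_provable₂ (hD : HenkinSet D) {φ ψ χ : Formula X} (hφ : φ ∈ D) (hψ : ψ ∈ D)
    (h : Provable {φ, ψ} χ) : χ ∈ D :=
  hD.closed _ (Set.toFinite _) (Set.insert_subset hφ (Set.singleton_subset_iff.2 hψ)) χ h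

theorem mp (hD : HenkinSet D) {φ ψ : Formula X} (h : .imp φ ψ ∈ D) (hφ : φ ∈ D) : ψ ∈ D :=
  hD.of_provable₂ h hφ (.impE (φ := φ) (.assumption (by simp)) (.assumption (by simp)))

theorem imp_mem (hD : HenkinSet D) {φ ψ : Formula X} : .imp φ ψ ∈ D ↔ (φ ∈ D → ψ ∈ D) := by
  refine ⟨hD.mp, fun h => ?_⟩
  rcases hD.mem_or φ with hφ | hφ
  · exact hD.of_provable₂ (h hφ) (h hφ) (.impI (.assumption (by simp)))
  · exact hD.of_provable₂ hφ hφ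
      (.impI (.ofBot (.impE (φ := φ) (.assumption (by simp)) (.assumption (by simp)))))

theorem allB_mem (hD : HenkinSet D) {φ : Formula X} : .allB φ ∈ D ↔ ∀ k, φ.instB k ∈ D :=
  ⟨fun h k => hD.of_provable₂ h h (.allBE k (.assumption (by simp))), hD.allB φ⟩

theorem allQ_mem (hD : HenkinSet D) {φ : Formula X} : .allQ φ ∈ D ↔ ∀ t, φ.instQ t ∈ D :=
  ⟨fun h t => hD.of_provable₂ h h (.allQE t (.assumption (by simp))), hD.allQ φ⟩

/-- The rule `eqBSubst` only replaces the variable `0`. Any other place `i` is reached by raising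
the values of the remaining variables by one and using `0` as the hole at `i`. -/
theorem eqB_subst (hD : HenkinSet D) {k b : ℕ} (h : .eqB k b ∈ D) (φ : Formula X) (i : ℕ)
    (ρ : ℕ → ℕ) (σ : ℕ → Term) (hφ : φ.subst (Function.update ρ i k) σ ∈ D) :
    φ.subst (Function.update ρ i b) σ ∈ D := by
  have key : ∀ l, φ.subst (Function.update ρ i l) σ =
      (φ.subst (Function.update (fun j => ρ j + 1) i 0) σ).instB l := by
    intro l
    rw [Formula.instB_eq, Formula.subst_subst]
    congr 1
    · funext j
      by_cases hj : j = i
      · subst hj; simp [push]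
      · simp [hj, push]
    · funext j; exact (Term.subst_var _).symm
  rw [key] at hφ ⊢
  exact hD.of_provable₂ h hφ (.eqBSubst (k := k) (.assumption (by simp)) (.assumption (by simp)))

theorem eqQ_subst (hD : HenkinSet D) {s t : Term} (h : .eqQ s t ∈ D) (φ : Formula X) (i : ℕ)
    (ρ : ℕ → ℕ) (σ : ℕ → Term) (hφ : φ.subst ρ (Function.update σ i s) ∈ D) :
    φ.subst ρ (Function.update σ i t) ∈ D := by
  have key : ∀ u, φ.subst ρ (Function.update σ i u) =
      (φ.subst ρ (Function.update (fun j => (σ j).subst fun l => .var (l + 1)) i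
        (.var 0))).instQ u := by
    intro u
    rw [Formula.instQ_eq, Formula.subst_subst]
    congr 1
    funext j
    by_cases hj : j = i
    · subst hj; simp [push, Term.subst]
    · simp [hj, Term.subst_shift_push]
  rw [key] at hφ ⊢
  exact hD.of_provable₂ h hφ (.eqQSubst (s := s) (.assumption (by simp)) (.assumption (by simp)))

/-- Provable equality of body variables. -/
def setoidB (hD : HenkinSet D) : Setoid ℕ where
  r k b := .eqB k b ∈ D
  iseqv :=
    { refl := fun k => hD.of_provable (.eqBRefl k)
      symm := fun {k b} h => by
        simpa [Formula.subst] using hD.eqB_subst h (.eqB 0 1) 0 (fun _ => k) Term.var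
          (by simpa [Formula.subst] using hD.of_provable (.eqBRefl k))
      trans := fun {k b c} h h' => by
        simpa [Formula.subst] using hD.eqB_subst h' (.eqB 1 0) 0 (fun _ => k) Term.var
          (by simpa [Formula.subst] using h) }

/-- Provable equality of terms. -/
def setoidQ (hD : HenkinSet D) : Setoid Term where
  r s t := .eqQ s t ∈ D
  iseqv :=
    { refl := fun t => hD.of_provable (.eqQRefl t)
      symm := fun {s t} h => by
        simpa [Formula.subst, Term.subst] using
          hD.eqQ_subst h (.eqQ (.var 0) (.var 1)) 0 (fun i => i) (fun _ => s)
            (by simpa [Formula.subst, Term.subst] using hD.of_provable (.eqQRefl s))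
      trans := fun {s t u} h h' => by
        simpa [Formula.subst, Term.subst] using
          hD.eqQ_subst h' (.eqQ (.var 1) (.var 0)) 0 (fun i => i) (fun _ => s)
            (by simpa [Formula.subst, Term.subst] using h) }

/-- Bodies of the term model. -/
abbrev DomB (hD : HenkinSet D) : Type := Quotient hD.setoidB

/-- Quantities of the term model. -/
abbrev DomQ (hD : HenkinSet D) : Type := Quotient hD.setoidQ

/-- The class of a body variable. -/
abbrev clsB (hD : HenkinSet D) (k : ℕ) : hD.DomB := Quotient.mk hD.setoidB k

/-- The class of a term. -/
abbrev clsQ (hD : HenkinSet D) (t : Term) : hD.DomQ := Quotient.mk hD.setoidQ t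

theorem clsB_eq (hD : HenkinSet D) {k b : ℕ} : hD.clsB k = hD.clsB b ↔ .eqB k b ∈ D :=
  Quotient.eq

theorem clsQ_eq (hD : HenkinSet D) {s t : Term} : hD.clsQ s = hD.clsQ t ↔ .eqQ s t ∈ D :=
  Quotient.eq

/-- Formulas do not distinguish provably equal arguments. -/
theorem subst_congrB (hD : HenkinSet D) {k b : ℕ} (h : hD.clsB k = hD.clsB b) (φ : Formula X)
    (i : ℕ) (ρ : ℕ → ℕ) (σ : ℕ → Term) :
    φ.subst (Function.update ρ i k) σ ∈ D ↔ φ.subst (Function.update ρ i b) σ ∈ D :=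
  ⟨hD.eqB_subst (hD.clsB_eq.1 h) φ i ρ σ, hD.eqB_subst (hD.clsB_eq.1 h.symm) φ i ρ σ⟩

theorem subst_congrQ (hD : HenkinSet D) {s t : Term} (h : hD.clsQ s = hD.clsQ t) (φ : Formula X)
    (i : ℕ) (ρ : ℕ → ℕ) (σ : ℕ → Term) :
    φ.subst ρ (Function.update σ i s) ∈ D ↔ φ.subst ρ (Function.update σ i t) ∈ D :=
  ⟨hD.eqQ_subst (hD.clsQ_eq.1 h) φ i ρ σ, hD.eqQ_subst (hD.clsQ_eq.1 h.symm) φ i ρ σ⟩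

theorem eqQ_congr₂ (hD : HenkinSet D) (f : Term → Term → Term)
    (hf : ∀ s t σ, (f s t).subst σ = f (s.subst σ) (t.subst σ)) {s s' t t' : Term}
    (hs : hD.clsQ s = hD.clsQ s') (ht : hD.clsQ t = hD.clsQ t') :
    hD.clsQ (f s t) = hD.clsQ (f s' t') := by
  have h₁ := (hD.subst_congrQ hs (.eqQ (f (.var 1) (.var 2)) (f (.var 0) (.var 2))) 0
    (fun i => i) (fun i => if i = 1 then s else t)).1
  have h₂ := (hD.subst_congrQ ht (.eqQ (f (.var 1) (.var 2)) (f (.var 1) (.var 0))) 0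
    (fun i => i) (fun i => if i = 1 then s' else t)).1
  simp only [Formula.subst, Term.subst, hf, Function.update, OfNat.ofNat_ne_zero, OfNat.ofNat_ne_one, one_ne_zero,
    dite_false, dite_true, if_true, if_false] at h₁ h₂
  exact (hD.clsQ_eq.2 (h₁ (hD.of_provable (.eqQRefl _)))).trans
    (hD.clsQ_eq.2 (h₂ (hD.of_provable (.eqQRefl _))))

instance (hD : HenkinSet D) : Add hD.DomQ :=
  ⟨Quotient.map₂ Term.add fun _ _ hs _ _ ht => Quotient.exact
    (hD.eqQ_congr₂ Term.add (fun _ _ _ => rfl) (Quotient.sound hs) (Quotient.sound ht))⟩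

instance (hD : HenkinSet D) : Mul hD.DomQ :=
  ⟨Quotient.map₂ Term.mul fun _ _ hs _ _ ht => Quotient.exact
    (hD.eqQ_congr₂ Term.mul (fun _ _ _ => rfl) (Quotient.sound hs) (Quotient.sound ht))⟩

instance (hD : HenkinSet D) : LE hD.DomQ :=
  ⟨fun x y => ∃ s t, hD.clsQ s = x ∧ hD.clsQ t = y ∧ .le s t ∈ D⟩

/-- The term model. -/
def model (hD : HenkinSet D) : Model X hD.DomB hD.DomQ where
  iob b := ∃ k, hD.clsB k = b ∧ .IOb k ∈ D
  ph b := ∃ k, hD.clsB k = b ∧ .Ph k ∈ D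
  ext x b := ∃ k, hD.clsB k = b ∧ .ext x k ∈ D
  W k b x := ∃ (k' b' : ℕ) (t : Fin 4 → Term), hD.clsB k' = k ∧ hD.clsB b' = b ∧ (∀ i, hD.clsQ (t i) = x i) ∧
    .W k' b' (t 0) (t 1) (t 2) (t 3) ∈ D

theorem eval_clsQ (hD : HenkinSet D) (t : Term) (σ : ℕ → Term) :
    t.eval (fun i => hD.clsQ (σ i)) = hD.clsQ (t.subst σ) := by
  induction t with
  | var n => rfl
  | add s t hs ht => simp only [Term.eval, hs, ht]; rfl
  | mul s t hs ht => simp only [Term.eval, hs, ht]; rfl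

/-- The truth lemma. It is stated for arbitrary substitutions because every element of the domains
is the class of a variable or a term; under a quantifier the new value is pushed onto the
substitution. -/
theorem sat_model (hD : HenkinSet D) (φ : Formula X) (ρ : ℕ → ℕ) (σ : ℕ → Term) :
    φ.Sat hD.model (fun i => hD.clsB (ρ i)) (fun i => hD.clsQ (σ i)) ↔ φ.subst ρ σ ∈ D := by
  have unary : ∀ (φ : ℕ → Formula X), (∀ k ρ σ, (φ k).subst ρ σ = φ (ρ k)) → ∀ k,
      (∃ k', hD.clsB k' = hD.clsB k ∧ φ k' ∈ D) ↔ φ k ∈ D := by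
    refine fun φ hφ k => ⟨?_, fun h => ⟨k, rfl, h⟩⟩
    rintro ⟨k', e, h⟩
    have := (hD.subst_congrB e (φ 0) 0 (fun i => i) Term.var).1
    simp only [hφ, Function.update_self] at this
    exact this h
  induction φ generalizing ρ σ with
  | bot => exact iff_of_false id hD.not_bot
  | imp φ ψ hφ hψ => simp only [Formula.Sat, Formula.subst, hφ, hψ, hD.imp_mem]
  | allB φ ih =>
    simp only [Formula.Sat, Formula.subst, hD.allB_mem, Formula.subst_lift_instB, ← ih]
    refine ⟨fun h k => ?_, fun h b => ?_⟩
    · convert h (hD.clsB k) using 1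
      funext i; cases i <;> rfl
    · induction b using Quotient.inductionOn with | _ k => ?_
      convert h k using 1
      funext i; cases i <;> rfl
  | allQ φ ih =>
    simp only [Formula.Sat, Formula.subst, hD.allQ_mem, Formula.subst_lift_instQ, ← ih]
    refine ⟨fun h t => ?_, fun h a => ?_⟩
    · convert h (hD.clsQ t) using 1
      funext i; cases i <;> rfl
    · induction a using Quotient.inductionOn with | _ t => ?_
      convert h t using 1
      funext i; cases i <;> rfl
  | eqB k b => exact hD.clsB_eq
  | eqQ s t => simp only [Formula.Sat, Formula.subst, eval_clsQ, clsQ_eq]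
  | le s t =>
    simp only [Formula.Sat, Formula.subst, eval_clsQ]
    refine ⟨?_, fun h => ⟨_, _, rfl, rfl, h⟩⟩
    rintro ⟨s', t', hs, ht, h⟩
    have h₁ := (hD.subst_congrQ hs (.le (.var 0) (.var 1)) 0 (fun i => i) fun _ => t').1
    have h₂ := (hD.subst_congrQ ht (.le (.var 1) (.var 0)) 0 (fun i => i)
      fun _ => s.subst σ).1
    simp only [Formula.subst, Term.subst, Function.update, one_ne_zero, dite_false,
      dite_true] at h₁ h₂
    exact h₂ (h₁ h)
  | IOb k => exact unary .IOb (fun _ _ _ => rfl) _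
  | Ph k => exact unary .Ph (fun _ _ _ => rfl) _
  | ext x k => exact unary (.ext x) (fun _ _ _ => rfl) _
  | W k b t₀ t₁ t₂ t₃ =>
    simp only [Formula.Sat, Formula.subst, eval_clsQ]
    refine ⟨?_, fun h => ⟨ρ k, ρ b, ![t₀.subst σ, t₁.subst σ, t₂.subst σ, t₃.subst σ], rfl, rfl,
      fun i => by fin_cases i <;> rfl, h⟩⟩
    rintro ⟨k', b', t, hk, hb, ht, h⟩
    let φ : Formula X := .W 0 1 (.var 0) (.var 1) (.var 2) (.var 3)
    let τ : Fin 4 → Term := ![t₀.subst σ, t₁.subst σ, t₂.subst σ, t₃.subst σ]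
    have e : ∀ i, hD.clsQ (t i) = hD.clsQ (τ i) := fun i =>
      (ht i).trans (by fin_cases i <;> rfl)
    -- The relation of the model holds for some representatives of the classes. The six arguments
    -- are exchanged for the given ones one at a time.
    have stepB := fun {k b} (h : hD.clsB k = hD.clsB b) i ρ σ => (hD.subst_congrB h φ i ρ σ).1
    have stepQ := fun {s t} (h : hD.clsQ s = hD.clsQ t) i σ =>
      (hD.subst_congrQ h φ i (fun i => if i = 0 then ρ k else ρ b) σ).1
    have h₁ := stepB hk 0 (fun _ => b') fun i => t (Fin.ofNat 4 i)
    have h₂ := stepB hb 1 (fun _ => ρ k) fun i => t (Fin.ofNat 4 i)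
    have h₃ := stepQ (e 0) 0 fun i => t (Fin.ofNat 4 i)
    have h₄ := stepQ (e 1) 1 fun i => if i = 0 then τ 0 else t (Fin.ofNat 4 i)
    have h₅ := stepQ (e 2) 2 fun i => if i = 0 then τ 0 else if i = 1 then τ 1 else t 3
    have h₆ := stepQ (e 3) 3 fun i => if i = 0 then τ 0 else if i = 1 then τ 1 else τ 2
    simp [φ, Formula.subst, Term.subst, Function.update] at h₁ h₂ h₃ h₄ h₅ h₆
    exact h₆ (h₅ (h₄ (h₃ (h₂ (h₁ h)))))

end HenkinSet

/-- Completeness for sets of sentences. -/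
theorem provable_of_forall_sat [Countable X] {Γ : Set (Formula X)}
    (hΓ : ∀ ψ ∈ Γ, ψ.closedAt 0 0 = true) {φ : Formula X}
    (h : ∀ (B Q : Type) [Add Q] [Mul Q] [LE Q] (M : Model X B Q) (β : ℕ → B) (κ : ℕ → Q),
      (∀ ψ ∈ Γ, ψ.Sat M β κ) → φ.Sat M β κ) : Provable Γ φ := by
  by_contra hn
  -- Since `Γ` consists of sentences, adding `¬φ` keeps the free variables bounded, and consistency
  -- is the assumed unprovability of `φ`. The term model then refutes `φ`.
  have good : Good (insert (.imp φ .bot) Γ) :=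
    ⟨exists_bound_insert _ ⟨0, 0, hΓ⟩, fun hb => hn (.byContra hb)⟩
  obtain ⟨D, hsub, hD⟩ := good.exists_henkinSet
  have sat : ∀ ψ ∈ D, ψ.Sat hD.model (fun i => hD.clsB i) (fun i => hD.clsQ (.var i)) :=
    fun ψ hψ => (hD.sat_model ψ (fun i => i) Term.var).2 (by rwa [Formula.subst_id])
  exact sat _ (hsub (Set.mem_insert _ _))
    (h _ _ hD.model _ _ fun ψ hψ => sat ψ (hsub (Set.mem_insert_of_mem _ hψ)))

/-! ### Semantics of formulas with bound-variable names -/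

section Denotation

variable {B Q : Type} [Add Q] [Mul Q]

/-- In a context of `m` body quantifiers, with values `β`, the body variable under construction `t`
denotes `b`, and it keeps this value when further quantifiers are added. -/
class DenB (m : ℕ) (β : ℕ → B) (t : BTok) (b : outParam B) : Prop where
  out : ∀ (l : ℕ) (β' : ℕ → B), (∀ i, β' (i + l) = β i) → β' (t (m + l)) = b

/-- In a context of `n` quantity quantifiers, with values `κ`, the term under construction `t`
denotes `a`, and it keeps this value when further quantifiers are added. -/
class DenQ (n : ℕ) (κ : ℕ → Q) (t : QTok) (a : outParam Q) : Prop where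
  out : ∀ (l : ℕ) (κ' : ℕ → Q), (∀ i, κ' (i + l) = κ i) → (t (n + l)).eval κ' = a

/-- `DenQ` for tuples. -/
class DenV {d : ℕ} (n : ℕ) (κ : ℕ → Q) (t : Fin d → QTok) (x : outParam (Fin d → Q)) : Prop where
  out : ∀ i, DenQ n κ (t i) (x i)

/-- `DenQ` for matrices. -/
class DenM {d d' : ℕ} (n : ℕ) (κ : ℕ → Q) (t : Fin d → Fin d' → QTok)
    (x : outParam (Fin d → Fin d' → Q)) : Prop where
  out : ∀ i, DenV n κ (t i) (x i)

/-- The body variable bound at depth `m`. -/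
def tokB (m : ℕ) : BTok := fun m' => m' - (m + 1)

/-- The quantity variable bound at depth `n`. -/
def tokQ (n : ℕ) : QTok := fun n' => .var (n' - (n + 1))

/-- The point bound at depth `n`. -/
def tok4 (n : ℕ) : Fin 4 → QTok := ![tokQ n, tokQ (n + 1), tokQ (n + 2), tokQ (n + 3)]

/-- The spatial vector bound at depth `n`. -/
def tok3 (n : ℕ) : Fin 3 → QTok := ![tokQ n, tokQ (n + 1), tokQ (n + 2)]

/-- Add the values of a point. -/
def push4 (x : Fin 4 → Q) (κ : ℕ → Q) : ℕ → Q :=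
  push (x 3) (push (x 2) (push (x 1) (push (x 0) κ)))

/-- Add the values of a spatial vector. -/
def push3 (x : Fin 3 → Q) (κ : ℕ → Q) : ℕ → Q := push (x 2) (push (x 1) (push (x 0) κ))

theorem DenB.eq {m : ℕ} {β : ℕ → B} {t : BTok} {b : B} (h : DenB m β t b) : β (t m) = b :=
  h.out 0 β fun _ => rfl

theorem DenQ.eq {n : ℕ} {κ : ℕ → Q} {t : QTok} {a : Q} (h : DenQ n κ t a) : (t n).eval κ = a :=
  h.out 0 κ fun _ => rfl

/-- Instance search computes the value of a token: quantifiers inside its scope are skipped by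
`lift`, and the search ends at its own binder with `tok`. The offset `l` in the class absorbs each
skipped quantifier. -/
instance DenB.lift {m : ℕ} {β : ℕ → B} {t : BTok} {b c : B} [h : DenB m β t b] :
    DenB (m + 1) (push c β) t b where
  out l β' hβ := by
    rw [add_assoc, add_comm 1 l]
    exact h.out (l + 1) β' fun i => by rw [add_comm l 1, ← add_assoc, hβ]; rfl

instance DenB.tok {m : ℕ} {β : ℕ → B} {c : B} : DenB (m + 1) (push c β) (tokB m) c where
  out l β' hβ := by
    have : m + 1 + l - (m + 1) = 0 + l := by omega
    simp only [tokB, this, hβ]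
    rfl

instance DenB.free {β : ℕ → B} {i : ℕ} : DenB 0 β (freeB i) (β i) where
  out l β' hβ := by simp only [freeB, zero_add, hβ]

instance DenQ.lift {n : ℕ} {κ : ℕ → Q} {t : QTok} {a c : Q} [h : DenQ n κ t a] :
    DenQ (n + 1) (push c κ) t a where
  out l κ' hκ := by
    rw [add_assoc, add_comm 1 l]
    exact h.out (l + 1) κ' fun i => by rw [add_comm l 1, ← add_assoc, hκ]; rfl

instance DenQ.tok {n : ℕ} {κ : ℕ → Q} {c : Q} : DenQ (n + 1) (push c κ) (tokQ n) c where
  out l κ' hκ := by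
    have : n + 1 + l - (n + 1) = 0 + l := by omega
    simp only [tokQ, this, Term.eval, hκ]
    rfl

instance DenQ.free {κ : ℕ → Q} {i : ℕ} : DenQ 0 κ (freeQ i) (κ i) where
  out l κ' hκ := by simp only [freeQ, zero_add, Term.eval, hκ]

instance DenQ.lift4 {n : ℕ} {κ : ℕ → Q} {t : QTok} {a : Q} {x : Fin 4 → Q} [DenQ n κ t a] :
    DenQ (n + 4) (push4 x κ) t a :=
  DenQ.lift (n := n + 3)

instance DenQ.lift3 {n : ℕ} {κ : ℕ → Q} {t : QTok} {a : Q} {x : Fin 3 → Q} [DenQ n κ t a] :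
    DenQ (n + 3) (push3 x κ) t a :=
  DenQ.lift (n := n + 2)

instance DenQ.add {n : ℕ} {κ : ℕ → Q} {s t : QTok} {a b : Q} [hs : DenQ n κ s a]
    [ht : DenQ n κ t b] : DenQ n κ (s + t) (a + b) where
  out l κ' hκ := congrArg₂ (· + ·) (hs.out l κ' hκ) (ht.out l κ' hκ)

instance DenQ.mul {n : ℕ} {κ : ℕ → Q} {s t : QTok} {a b : Q} [hs : DenQ n κ s a]
    [ht : DenQ n κ t b] : DenQ n κ (s * t) (a * b) where
  out l κ' hκ := congrArg₂ (· * ·) (hs.out l κ' hκ) (ht.out l κ' hκ)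

instance DenV.lift {d n : ℕ} {κ : ℕ → Q} {t : Fin d → QTok} {x : Fin d → Q} {c : Q}
    [h : DenV n κ t x] : DenV (n + 1) (push c κ) t x where
  out i := have := h.out i; DenQ.lift

instance DenV.lift4 {d n : ℕ} {κ : ℕ → Q} {t : Fin d → QTok} {x : Fin d → Q} {y : Fin 4 → Q}
    [h : DenV n κ t x] : DenV (n + 4) (push4 y κ) t x where
  out i := have := h.out i; DenQ.lift4

instance DenV.lift3 {d n : ℕ} {κ : ℕ → Q} {t : Fin d → QTok} {x : Fin d → Q} {y : Fin 3 → Q}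
    [h : DenV n κ t x] : DenV (n + 3) (push3 y κ) t x where
  out i := have := h.out i; DenQ.lift3

instance DenV.tok4 {n : ℕ} {κ : ℕ → Q} {x : Fin 4 → Q} : DenV (n + 4) (push4 x κ) (tok4 n) x where
  out i := by
    unfold push4 KinLogic.tok4
    fin_cases i
    · exact (inferInstance : DenQ (n + 1 + 1 + 1 + 1) (push (x 3) (push (x 2) (push (x 1) (push (x 0) κ))))
        (tokQ n) (x 0))
    · exact (inferInstance : DenQ (n + 1 + 1 + 1 + 1) (push (x 3) (push (x 2) (push (x 1) (push (x 0) κ))))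
        (tokQ (n + 1)) (x 1))
    · exact (inferInstance : DenQ (n + 1 + 1 + 1 + 1) (push (x 3) (push (x 2) (push (x 1) (push (x 0) κ))))
        (tokQ (n + 1 + 1)) (x 2))
    · exact (inferInstance : DenQ (n + 1 + 1 + 1 + 1) (push (x 3) (push (x 2) (push (x 1) (push (x 0) κ))))
        (tokQ (n + 1 + 1 + 1)) (x 3))

instance DenV.tok3 {n : ℕ} {κ : ℕ → Q} {x : Fin 3 → Q} : DenV (n + 3) (push3 x κ) (tok3 n) x where
  out i := by
    unfold push3 KinLogic.tok3
    fin_cases i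
    · exact (inferInstance : DenQ (n + 1 + 1 + 1) (push (x 2) (push (x 1) (push (x 0) κ)))
        (tokQ n) (x 0))
    · exact (inferInstance : DenQ (n + 1 + 1 + 1) (push (x 2) (push (x 1) (push (x 0) κ)))
        (tokQ (n + 1)) (x 1))
    · exact (inferInstance : DenQ (n + 1 + 1 + 1) (push (x 2) (push (x 1) (push (x 0) κ)))
        (tokQ (n + 1 + 1)) (x 2))

instance DenV.of_four {n : ℕ} {κ : ℕ → Q} {s₀ s₁ s₂ s₃ : QTok} {a₀ a₁ a₂ a₃ : Q}
    [h₀ : DenQ n κ s₀ a₀] [h₁ : DenQ n κ s₁ a₁] [h₂ : DenQ n κ s₂ a₂] [h₃ : DenQ n κ s₃ a₃] :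
    DenV n κ ![s₀, s₁, s₂, s₃] ![a₀, a₁, a₂, a₃] where
  out i := by fin_cases i <;> assumption

instance DenM.of_three {d n : ℕ} {κ : ℕ → Q} {s₀ s₁ s₂ : Fin d → QTok} {a₀ a₁ a₂ : Fin d → Q}
    [h₀ : DenV n κ s₀ a₀] [h₁ : DenV n κ s₁ a₁] [h₂ : DenV n κ s₂ a₂] :
    DenM n κ ![s₀, s₁, s₂] ![a₀, a₁, a₂] where
  out i := by fin_cases i <;> assumption

instance DenM.lift4 {d d' n : ℕ} {κ : ℕ → Q} {t : Fin d → Fin d' → QTok}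
    {x : Fin d → Fin d' → Q} {y : Fin 4 → Q} [h : DenM n κ t x] : DenM (n + 4) (push4 y κ) t x where
  out i := have := h.out i; DenV.lift4

end Denotation

/-! ### Satisfaction of connectives, quantifiers and atomic formulas -/

section Logic

variable {X B Q : Type} [Add Q] [Mul Q] [LE Q] {M : Model X B Q} {m n : ℕ} {β : ℕ → B} {κ : ℕ → Q}

theorem sat_imp {φ ψ : Fml X} :
    ((φ ⇒ᶠ ψ) m n).Sat M β κ ↔ ((φ m n).Sat M β κ → (ψ m n).Sat M β κ) := Iff.rfl

theorem sat_not {φ : Fml X} : ((¬ᶠ φ) m n).Sat M β κ ↔ ¬(φ m n).Sat M β κ := Iff.rfl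

theorem sat_and {φ ψ : Fml X} :
    ((φ ∧ᶠ ψ) m n).Sat M β κ ↔ (φ m n).Sat M β κ ∧ (ψ m n).Sat M β κ := by
  simp only [and, sat_not, sat_imp, Classical.not_imp, not_not]

theorem sat_or {φ ψ : Fml X} :
    ((φ ∨ᶠ ψ) m n).Sat M β κ ↔ (φ m n).Sat M β κ ∨ (ψ m n).Sat M β κ := by
  simp only [or, sat_not, sat_imp, or_iff_not_imp_left]

theorem sat_iff {φ ψ : Fml X} :
    ((φ ⇔ᶠ ψ) m n).Sat M β κ ↔ ((φ m n).Sat M β κ ↔ (ψ m n).Sat M β κ) := by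
  simp only [iff, sat_and, sat_imp, iff_iff_implies_and_implies]

theorem sat_allB {f : BTok → Fml X} :
    (allB f m n).Sat M β κ ↔ ∀ b, (f (tokB m) (m + 1) n).Sat M (push b β) κ := Iff.rfl

theorem sat_exB {f : BTok → Fml X} :
    (exB f m n).Sat M β κ ↔ ∃ b, (f (tokB m) (m + 1) n).Sat M (push b β) κ := by
  simp only [exB, sat_not, sat_allB, not_forall, not_not]

theorem sat_allQ {f : QTok → Fml X} :
    (allQ f m n).Sat M β κ ↔ ∀ a, (f (tokQ n) m (n + 1)).Sat M β (push a κ) := Iff.rfl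

theorem sat_exQ {f : QTok → Fml X} :
    (exQ f m n).Sat M β κ ↔ ∃ a, (f (tokQ n) m (n + 1)).Sat M β (push a κ) := by
  simp only [exQ, sat_not, sat_allQ, not_forall, not_not]

theorem sat_allQ4 {f : (Fin 4 → QTok) → Fml X} :
    (allQ4 f m n).Sat M β κ ↔ ∀ x, (f (tok4 n) m (n + 4)).Sat M β (push4 x κ) :=
  ⟨fun h x => h (x 0) (x 1) (x 2) (x 3), fun h a b c d => h ![a, b, c, d]⟩

theorem sat_exQ4 {f : (Fin 4 → QTok) → Fml X} :
    (exQ4 f m n).Sat M β κ ↔ ∃ x, (f (tok4 n) m (n + 4)).Sat M β (push4 x κ) := by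
  simp only [exQ4, sat_exQ]
  exact ⟨fun ⟨a, b, c, d, h⟩ => ⟨![a, b, c, d], h⟩, fun ⟨x, h⟩ => ⟨x 0, x 1, x 2, x 3, h⟩⟩

theorem sat_allQ3 {f : (Fin 3 → QTok) → Fml X} :
    (allQ3 f m n).Sat M β κ ↔ ∀ x, (f (tok3 n) m (n + 3)).Sat M β (push3 x κ) :=
  ⟨fun h x => h (x 0) (x 1) (x 2), fun h a b c => h ![a, b, c]⟩

theorem sat_exQ3 {f : (Fin 3 → QTok) → Fml X} :
    (exQ3 f m n).Sat M β κ ↔ ∃ x, (f (tok3 n) m (n + 3)).Sat M β (push3 x κ) := by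
  simp only [exQ3, sat_exQ]
  exact ⟨fun ⟨a, b, c, h⟩ => ⟨![a, b, c], h⟩, fun ⟨x, h⟩ => ⟨x 0, x 1, x 2, h⟩⟩

theorem sat_conj3 {f : Fin 3 → Fml X} :
    (conj3 f m n).Sat M β κ ↔ ∀ i, (f i m n).Sat M β κ := by
  simp only [conj3, sat_and, Fin.forall_fin_succ, IsEmpty.forall_iff, and_true, Fin.succ_zero_eq_one, Fin.succ_one_eq_two]

theorem sat_eqQ {s t : QTok} {a b : Q} [hs : DenQ n κ s a] [ht : DenQ n κ t b] :
    ((s =ᶠ t : Fml X) m n).Sat M β κ ↔ a = b := by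
  rw [← hs.eq, ← ht.eq]; rfl

theorem sat_le {s t : QTok} {a b : Q} [hs : DenQ n κ s a] [ht : DenQ n κ t b] :
    ((s ≤ᶠ t : Fml X) m n).Sat M β κ ↔ a ≤ b := by
  rw [← hs.eq, ← ht.eq]; rfl

theorem sat_IOb {k : BTok} {k' : B} [hk : DenB m β k k'] :
    ((IOb k : Fml X) m n).Sat M β κ ↔ M.iob k' := by
  rw [← hk.eq]; rfl

theorem sat_Ph {k : BTok} {k' : B} [hk : DenB m β k k'] :
    ((Ph k : Fml X) m n).Sat M β κ ↔ M.ph k' := by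
  rw [← hk.eq]; rfl

theorem sat_E {M : Model Unit B Q} {k : BTok} {k' : B} [hk : DenB m β k k'] :
    (E k m n).Sat M β κ ↔ M.ext () k' := by
  rw [← hk.eq]; rfl

theorem sat_W {k b : BTok} {x : Fin 4 → QTok} {k' b' : B} {x' : Fin 4 → Q} [hk : DenB m β k k']
    [hb : DenB m β b b'] [hx : DenV n κ x x'] :
    ((W k b x : Fml X) m n).Sat M β κ ↔ M.W k' b' x' := by
  have e : x' = ![(x 0 n).eval κ, (x 1 n).eval κ, (x 2 n).eval κ, (x 3 n).eval κ] := by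
    funext i
    rw [← (hx.out i).eq]
    fin_cases i <;> rfl
  rw [← hk.eq, ← hb.eq, e]; rfl

/-- The assumptions are coordinatewise so that the lemma also applies to points given by a function
such as `fun i => z i + a * x i`, for which no tuple instance is available. -/
theorem sat_eqPt {x y : Fin 4 → QTok} {x' y' : Fin 4 → Q} [hx : ∀ i, DenQ n κ (x i) (x' i)]
    [hy : ∀ i, DenQ n κ (y i) (y' i)] :
    ((eqPt x y : Fml X) m n).Sat M β κ ↔ x' = y' := by
  have e : ∀ i, ((x i =ᶠ y i : Fml X) m n).Sat M β κ ↔ x' i = y' i := fun i => sat_eqQ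
  simp only [eqPt, sat_and, e, funext_iff, Fin.forall_fin_succ, IsEmpty.forall_iff, and_true]
  rfl

theorem sat_sameEvent {k h : BTok} {x y : Fin 4 → QTok} {k' h' : B} {x' y' : Fin 4 → Q}
    [DenB m β k k'] [DenB m β h h'] [DenV n κ x x'] [DenV n κ y y'] :
    ((sameEvent k h x y : Fml X) m n).Sat M β κ ↔ ∀ b, M.W k' b x' ↔ M.W h' b y' := by
  simp only [sameEvent, sat_allB, sat_iff, sat_W]

theorem sat_Ob {k : BTok} {k' : B} [DenB m β k k'] :
    ((Ob k : Fml X) m n).Sat M β κ ↔ ∃ b x, M.W k' b x := by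
  simp only [Ob, sat_exB, sat_exQ4, sat_W]

theorem sat_AxEv : (AxEv : Fml X).done.Sat M β κ ↔
    ∀ k h, M.iob k → M.iob h → ∀ x, ∃ y, ∀ b, M.W k b x ↔ M.W h b y := by
  simp only [Fml.done, AxEv, sat_allB, sat_imp, sat_and, sat_IOb, sat_allQ4, sat_exQ4,
    sat_sameEvent, and_imp]

theorem sat_AxNoAcc : (AxNoAcc : Fml X).done.Sat M β κ ↔ ∀ k b x, M.W k b x → M.iob k := by
  simp only [Fml.done, AxNoAcc, sat_allB, sat_imp, sat_Ob, sat_IOb, forall_exists_index]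

end Logic

/-! ### Quantities -/

/-- An ordered field in which positive elements have square roots. -/
class EuclideanField (Q : Type) [Field Q] [LinearOrder Q] : Prop extends IsStrictOrderedRing Q where
  exists_mul_self : ∀ a : Q, 0 < a → ∃ b, b * b = a

theorem exists_sqrt {Q : Type} [Field Q] [LinearOrder Q] [EuclideanField Q] {a : Q} (ha : 0 ≤ a) :
    ∃ b, 0 ≤ b ∧ b * b = a := by
  rcases ha.eq_or_lt with rfl | ha
  · exact ⟨0, le_rfl, mul_zero 0⟩
  · obtain ⟨b, rfl⟩ := EuclideanField.exists_mul_self a ha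
    exact ⟨|b|, abs_nonneg b, abs_mul_abs_self b⟩

/-- A model of the field axioms is a Euclidean field. -/
theorem exists_euclideanField {X B Q : Type} [iA : Add Q] [iM : Mul Q] [iL : LE Q]
    {M : Model X B Q} {β : ℕ → B} {κ : ℕ → Q} (h : (AxEField : Fml X).done.Sat M β κ) :
    ∃ (F : Field Q) (L : LinearOrder Q), EuclideanField Q ∧ iA = F.toAdd ∧ iM = F.toMul ∧
      iL = L.toLE := by
  simp only [Fml.done, AxEField, sat_and, sat_allQ, sat_eqQ, sat_exQ, isZero, isOne, sat_not,
    sat_imp, sat_or, sat_le, nonneg, pos, lt] at h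
  obtain ⟨h₁, ⟨o, u, ho, hu, hne, hinv⟩, h₂, h₃, h₄, h₅⟩ := h
  choose neg hneg using fun x => (hinv x).1
  choose inv hi using fun x => (hinv x).2
  -- The formulas `nonneg` and `pos` speak of some neutral element; uniqueness identifies it with
  -- the chosen zero.
  have o_unique : ∀ z, (∀ x, x + z = x) → z = o := fun z hz => by
    rw [← ho z, (h₁ z o o).1, hz]
  classical
  let : Zero Q := ⟨o⟩
  let : One Q := ⟨u⟩
  let : Neg Q := ⟨neg⟩
  let : Inv Q := ⟨fun x => if hx : x = o then o else inv x hx⟩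
  let F : Field Q := Field.ofMinimalAxioms Q (fun a b c => (h₁ a b c).2.1)
    (fun a => by rw [(h₁ 0 a a).1]; exact ho a)
    (fun a => by rw [(h₁ (-a) a a).1]; exact hneg a)
    (fun a b c => (h₁ a b c).2.2.2.1) (fun a b => (h₁ a b b).2.2.1)
    (fun a => by rw [(h₁ 1 a a).2.2.1]; exact hu a)
    (fun a ha => by
      have : a⁻¹ = inv a ha := dif_neg ha
      rw [this]
      exact hi a ha)
    (dif_pos rfl) (fun a b c => (h₁ a b c).2.2.2.2) ⟨o, u, hne⟩
  let L : LinearOrder Q :=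
    { le := iL.le
      le_refl := fun a => (h₂ a a a).1
      le_antisymm := fun a b hab hba => (h₂ a b b).2.1 ⟨hab, hba⟩
      le_trans := fun a b c hab hbc => (h₂ a b c).2.2.1 ⟨hab, hbc⟩
      le_total := fun a b => (h₂ a b b).2.2.2
      toDecidableLE := Classical.decRel _ }
  have nn : ∀ a : Q, 0 ≤ a → ∃ z, (∀ x, x + z = x) ∧ z ≤ a := fun a ha => ⟨o, ho, ha⟩
  have nn' : ∀ a : Q, (∃ z, (∀ x, x + z = x) ∧ z ≤ a) → 0 ≤ a := fun a ⟨z, hz, hza⟩ => by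
    rw [o_unique z hz] at hza
    exact hza
  have : IsOrderedAddMonoid Q :=
    { add_le_add_left := fun a b hab c => h₃ a b c hab }
  -- If `1 ≤ 0`, then `0 ≤ -1`, and `1 = (-1) * (-1)` is nonnegative as a product of nonnegative
  -- elements.
  have : ZeroLEOneClass Q := ⟨by
    rcases le_total (0 : Q) 1 with h | h
    · exact h
    · have h' : (0 : Q) ≤ -1 := by simpa using h
      simpa using nn' _ (h₄ (-1) (-1) ⟨nn _ h', nn _ h'⟩)⟩
  refine ⟨F, L, ?_, rfl, rfl, rfl⟩
  have ord : IsStrictOrderedRing Q := IsStrictOrderedRing.of_mul_pos fun a b ha hb =>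
    lt_of_le_of_ne (nn' _ (h₄ a b ⟨nn _ ha.le, nn _ hb.le⟩)) (mul_ne_zero ha.ne' hb.ne').symm
  exact { ord with exists_mul_self := fun a ha => h₅ a ⟨o, ho, ha.le, ha.ne⟩ }

/-! ### Space-time geometry -/

section Geometry

variable {Q : Type} [Field Q]

/-- The spatial part of a point. -/
def sp (x : Fin 4 → Q) : Fin 3 → Q := fun i => x i.succ

/-- The scalar product of spatial vectors. -/
def dot (v w : Fin 3 → Q) : Q := v 0 * w 0 + v 1 * w 1 + v 2 * w 2

/-- The Minkowski form `|x|² - c² t²`. -/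
def mink (c : Q) (x : Fin 4 → Q) : Q := dot (sp x) (sp x) - c * c * (x 0 * x 0)

/-- Orthogonal matrices. -/
def Orth (A : Fin 3 → Fin 3 → Q) : Prop :=
  ∀ i j, A 0 i * A 0 j + A 1 i * A 1 j + A 2 i * A 2 j = if i = j then 1 else 0

/-- The spatial linear map with matrix `A`. -/
def appl (A : Fin 3 → Fin 3 → Q) (s : Fin 3 → Q) : Fin 3 → Q :=
  fun i => A i 0 * s 0 + A i 1 * s 1 + A i 2 * s 2

/-- The trivial transformation with parameters `A` and `z`. -/
def triv (A : Fin 3 → Fin 3 → Q) (z x : Fin 4 → Q) : Fin 4 → Q :=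
  Fin.cons (x 0 + z 0) (appl A (sp x) + sp z)

end Geometry

/-! ### Semantics of the abbreviations -/

section Abbreviations

variable {X B Q : Type} [Field Q] [LinearOrder Q] [EuclideanField Q] {M : Model X B Q} {m n : ℕ}
  {β : ℕ → B} {κ : ℕ → Q}

theorem sat_isZero {u : QTok} {a : Q} [DenQ n κ u a] :
    ((isZero u : Fml X) m n).Sat M β κ ↔ a = 0 := by
  simp only [isZero, sat_allQ, sat_eqQ, add_eq_left, forall_const]

theorem sat_isOne {u : QTok} {a : Q} [DenQ n κ u a] :
    ((isOne u : Fml X) m n).Sat M β κ ↔ a = 1 := by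
  simp only [isOne, sat_allQ, sat_eqQ]
  exact ⟨fun h => by simpa using h 1, fun h x => by rw [h, mul_one]⟩

theorem sat_nonneg {u : QTok} {a : Q} [DenQ n κ u a] :
    ((nonneg u : Fml X) m n).Sat M β κ ↔ 0 ≤ a := by
  simp only [nonneg, sat_exQ, sat_and, sat_isZero, sat_le, exists_eq_left]

theorem sat_lt {u v : QTok} {a b : Q} [DenQ n κ u a] [DenQ n κ v b] :
    ((u <ᶠ v : Fml X) m n).Sat M β κ ↔ a < b := by
  simp only [lt, sat_and, sat_not, sat_eqQ, sat_le, lt_iff_le_and_ne, ne_eq]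

theorem sat_pos {u : QTok} {a : Q} [DenQ n κ u a] :
    ((pos u : Fml X) m n).Sat M β κ ↔ 0 < a := by
  simp only [pos, sat_exQ, sat_and, sat_isZero, sat_lt, exists_eq_left]

theorem sat_isSpace {s : QTok} {x y : Fin 4 → QTok} {s' : Q} {x' y' : Fin 4 → Q} [DenQ n κ s s']
    [hx : DenV n κ x x'] [hy : DenV n κ y y'] :
    ((isSpace s x y : Fml X) m n).Sat M β κ ↔
      0 ≤ s' ∧ s' * s' = dot (sp (x' - y')) (sp (x' - y')) := by
  have den1 (i) : DenQ n κ (x i) (x' i) := hx.out i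
  have den2 (i) : DenQ n κ (y i) (y' i) := hy.out i
  have den3 (n) (κ : ℕ → Q) (d : Fin 3 → Q) (i) : DenQ (n + 3) (push3 d κ) (tok3 n i) (d i) :=
    DenV.tok3.out i
  simp only [isSpace, sat_and, sat_nonneg, sat_exQ3, sat_conj3, sat_eqQ]
  refine and_congr_right fun _ => ⟨?_, fun h => ⟨sp (x' - y'), fun i => ?_, h⟩⟩
  · rintro ⟨d, hd, h⟩
    have : sp (x' - y') = d := funext fun i => sub_eq_iff_eq_add'.2 (hd i)
    rw [this]
    exact h
  · simp [sp]

theorem sat_isTime {t : QTok} {x y : Fin 4 → QTok} {t' : Q} {x' y' : Fin 4 → Q} [DenQ n κ t t']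
    [hx : DenV n κ x x'] [hy : DenV n κ y y'] :
    ((isTime t x y : Fml X) m n).Sat M β κ ↔ t' = |x' 0 - y' 0| := by
  have den4 (i) : DenQ n κ (x i) (x' i) := hx.out i
  have den5 (i) : DenQ n κ (y i) (y' i) := hy.out i
  simp only [isTime, sat_and, sat_or, sat_nonneg, sat_eqQ]
  constructor
  · rintro ⟨h, e | e⟩
    · rw [e, add_sub_cancel_left, abs_of_nonneg h]
    · rw [e, sub_add_cancel_left, abs_neg, abs_of_nonneg h]
  · rintro rfl
    refine ⟨abs_nonneg _, ?_⟩
    rcases abs_choice (x' 0 - y' 0) with h | h <;> rw [h]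
    · left; ring
    · right; ring

/-- For `0 ≤ c'` both sides of `space = c' · time` are nonnegative, so the equation may be squared
without loss. The light cone becomes the zero set of a quadratic form. -/
theorem sat_spaceEq {c : QTok} {x y : Fin 4 → QTok} {c' : Q} {x' y' : Fin 4 → Q} [DenQ n κ c c']
    [DenV n κ x x'] [DenV n κ y y'] (hc : 0 ≤ c') :
    ((spaceEq c x y : Fml X) m n).Sat M β κ ↔ mink c' (x' - y') = 0 := by
  simp only [spaceEq, sat_exQ, sat_and, sat_isSpace, sat_isTime, sat_eqQ, mink, sub_eq_zero]
  have ht := abs_mul_abs_self (x' 0 - y' 0)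
  constructor
  · rintro ⟨s, t, ⟨-, hs⟩, rfl, rfl⟩
    rw [← hs, Pi.sub_apply]
    linear_combination c' * c' * ht
  · intro h
    refine ⟨c' * |x' 0 - y' 0|, _, ⟨by positivity, ?_⟩, rfl, rfl⟩
    rw [h, Pi.sub_apply]
    linear_combination c' * c' * ht

theorem dot_self_nonneg (v : Fin 3 → Q) : 0 ≤ dot v v := by
  unfold dot
  have := mul_self_nonneg (v 0)
  have := mul_self_nonneg (v 1)
  have := mul_self_nonneg (v 2)
  positivity

theorem sat_spaceLt {c : QTok} {x y : Fin 4 → QTok} {c' : Q} {x' y' : Fin 4 → Q} [DenQ n κ c c']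
    [DenV n κ x x'] [DenV n κ y y'] (hc : 0 ≤ c') :
    ((spaceLt c x y : Fml X) m n).Sat M β κ ↔ mink c' (x' - y') < 0 := by
  simp only [spaceLt, sat_exQ, sat_and, sat_isSpace, sat_isTime, sat_lt, mink, sub_neg]
  have ht := abs_mul_abs_self (x' 0 - y' 0)
  have ht' : c' * c' * ((x' - y') 0 * (x' - y') 0) =
      c' * |x' 0 - y' 0| * (c' * |x' 0 - y' 0|) := by
    rw [Pi.sub_apply]
    linear_combination -c' * c' * ht
  rw [ht']
  constructor
  · rintro ⟨s, t, ⟨hs, e⟩, rfl, h⟩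
    rw [← e]
    exact mul_self_lt_mul_self hs h
  · intro h
    obtain ⟨s, hs, e⟩ := exists_sqrt (dot_self_nonneg (sp (x' - y')))
    exact ⟨s, _, ⟨hs, e⟩, rfl, lt_of_mul_self_lt_mul_self₀ (by positivity) (by rwa [e])⟩

theorem sat_sameSpace {x y u v : Fin 4 → QTok} {x' y' u' v' : Fin 4 → Q}
    [DenV n κ x x'] [DenV n κ y y'] [DenV n κ u u'] [DenV n κ v v'] :
    ((sameSpace x y u v : Fml X) m n).Sat M β κ ↔
      dot (sp (x' - y')) (sp (x' - y')) = dot (sp (u' - v')) (sp (u' - v')) := by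
  simp only [sameSpace, sat_exQ, sat_and, sat_isSpace]
  refine ⟨fun ⟨s, ⟨_, h⟩, ⟨_, h'⟩⟩ => h.symm.trans h', fun h => ?_⟩
  obtain ⟨s, hs, e⟩ := exists_sqrt (dot_self_nonneg (sp (x' - y')))
  exact ⟨s, ⟨hs, e⟩, hs, e.trans h⟩

theorem sat_sameTime {x y u v : Fin 4 → QTok} {x' y' u' v' : Fin 4 → Q}
    [DenV n κ x x'] [DenV n κ y y'] [DenV n κ u u'] [DenV n κ v v'] :
    ((sameTime x y u v : Fml X) m n).Sat M β κ ↔ |x' 0 - y' 0| = |u' 0 - v' 0| := by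
  simp only [sameTime, sat_exQ, sat_and, sat_isTime, exists_eq_left]

/-- `b` moves with the speed `v` according to `k`. -/
def Model.IsSpeed (M : Model X B Q) (k b : B) (v : Q) : Prop :=
  (∃ x y, M.W k b x ∧ M.W k b y ∧ x ≠ y) ∧
    ∀ x y, M.W k b x → M.W k b y → mink v (x - y) = 0

/-- `b` moves with the velocity `v` according to `k`. -/
def Model.IsVelocity (M : Model X B Q) (k b : B) (v : Fin 3 → Q) : Prop :=
  (∃ x y, M.W k b x ∧ M.W k b y ∧ x ≠ y) ∧
    ∀ x y, M.W k b x → M.W k b y → ∀ i : Fin 3, y i.succ + v i * x 0 = x i.succ + v i * y 0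

/-- The speed of light is `c` according to `k`. -/
def Model.LightSpeed (M : Model X B Q) (c : Q) (k : B) : Prop :=
  ∀ x y, (∃ p, M.ph p ∧ M.W k p x ∧ M.W k p y) ↔ mink c (x - y) = 0

/-- `k` is an ether observer with light speed `c`. -/
def Model.Ether (M : Model X B Q) (k : B) : Prop := M.iob k ∧ ∃ c, 0 < c ∧ M.LightSpeed c k

/-- The worldview transformation from `k` to `h` is a trivial transformation. -/
def Model.WorldviewIs (M : Model X B Q) (k h : B) (A : Fin 3 → Fin 3 → Q) (z : Fin 4 → Q) : Prop :=
  ∀ x y, (∀ b, M.W k b x ↔ M.W h b y) ↔ y = triv A z x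

theorem sat_eqPt' {x y : Fin 4 → QTok} {x' y' : Fin 4 → Q} [hx : DenV n κ x x']
    [hy : DenV n κ y y'] : ((eqPt x y : Fml X) m n).Sat M β κ ↔ x' = y' :=
  sat_eqPt (hx := hx.out) (hy := hy.out)

theorem sat_isSpeed {k b : BTok} {v : QTok} {k' b' : B} {v' : Q} [DenB m β k k'] [DenB m β b b']
    [DenQ n κ v v'] (hv : 0 ≤ v') :
    ((isSpeed k b v : Fml X) m n).Sat M β κ ↔ M.IsSpeed k' b' v' := by
  simp only [isSpeed, sat_and, sat_exQ4, sat_allQ4, sat_imp, sat_W, sat_not, sat_eqPt',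
    sat_spaceEq hv, Model.IsSpeed, and_imp, ne_eq]

theorem sat_isVelocity {k b : BTok} {v : Fin 3 → QTok} {k' b' : B} {v' : Fin 3 → Q}
    [DenB m β k k'] [DenB m β b b'] [hv : DenV n κ v v'] :
    ((isVelocity k b v : Fml X) m n).Sat M β κ ↔ M.IsVelocity k' b' v' := by
  have den6 (i) : DenQ n κ (v i) (v' i) := hv.out i
  have den7 (n) (κ : ℕ → Q) (d : Fin 4 → Q) (i) : DenQ (n + 4) (push4 d κ) (tok4 n i) (d i) :=
    DenV.tok4.out i
  simp only [isVelocity, sat_and, sat_exQ4, sat_allQ4, sat_imp, sat_W, sat_not, sat_eqPt',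
    sat_conj3, sat_eqQ, Model.IsVelocity, and_imp, ne_eq]

theorem sat_lightSpeed {c : QTok} {k : BTok} {k' : B} {c' : Q} [DenB m β k k'] [DenQ n κ c c']
    (hc : 0 < c') : ((lightSpeed c k : Fml X) m n).Sat M β κ ↔ M.LightSpeed c' k' := by
  simp only [lightSpeed, sat_allQ4, sat_iff, sat_exB, sat_and, sat_Ph, sat_W, sat_spaceEq hc.le,
    Model.LightSpeed]

theorem sat_isC {c : QTok} {c' : Q} [DenQ n κ c c'] :
    ((isC c : Fml X) m n).Sat M β κ ↔ 0 < c' ∧ ∀ k, M.iob k → M.LightSpeed c' k := by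
  simp only [isC, sat_and, sat_pos, sat_allB, sat_imp, sat_IOb]
  exact and_congr_right fun hc => by simp only [sat_lightSpeed hc]

theorem sat_Ether {k : BTok} {k' : B} [DenB m β k k'] :
    ((Ether k : Fml X) m n).Sat M β κ ↔ M.Ether k' := by
  simp only [Ether, sat_and, sat_IOb, sat_exQ, sat_pos, Model.Ether]
  exact and_congr_right fun _ => exists_congr fun c => and_congr_right fun hc => sat_lightSpeed hc

theorem sat_isCe {c : QTok} {c' : Q} [DenQ n κ c c'] :
    ((isCe c : Fml X) m n).Sat M β κ ↔ 0 < c' ∧ ∀ k, M.Ether k → M.LightSpeed c' k := by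
  simp only [isCe, sat_and, sat_pos, sat_allB, sat_imp, sat_Ether]
  exact and_congr_right fun hc => by simp only [sat_lightSpeed hc]

theorem sat_orthogonal {A : Fin 3 → Fin 3 → QTok} {A' : Fin 3 → Fin 3 → Q} [hA : DenM n κ A A'] :
    ((orthogonal A : Fml X) m n).Sat M β κ ↔ Orth A' := by
  have den8 (i j) : DenQ n κ (A i j) (A' i j) := (hA.out i).out j
  simp only [orthogonal, sat_conj3, Orth]
  refine forall_congr' fun i => forall_congr' fun j => ?_
  split_ifs
  · exact sat_isOne
  · exact sat_isZero

theorem sat_trivMap {A : Fin 3 → Fin 3 → QTok} {z x y : Fin 4 → QTok} {A' : Fin 3 → Fin 3 → Q}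
    {z' x' y' : Fin 4 → Q} [hA : DenM n κ A A'] [hz : DenV n κ z z'] [hx : DenV n κ x x']
    [hy : DenV n κ y y'] :
    ((trivMap A z x y : Fml X) m n).Sat M β κ ↔ y' = triv A' z' x' := by
  have den9 (i j) : DenQ n κ (A i j) (A' i j) := (hA.out i).out j
  have den10 (i) : DenQ n κ (z i) (z' i) := hz.out i
  have den11 (i) : DenQ n κ (x i) (x' i) := hx.out i
  have den12 (i) : DenQ n κ (y i) (y' i) := hy.out i
  simp only [trivMap, sat_and, sat_conj3, sat_eqQ, triv, funext_iff, Fin.forall_fin_succ (n := 3)]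
  rfl

theorem sat_worldviewIs {k h : BTok} {A : Fin 3 → Fin 3 → QTok} {z : Fin 4 → QTok} {k' h' : B}
    {A' : Fin 3 → Fin 3 → Q} {z' : Fin 4 → Q} [DenB m β k k'] [DenB m β h h'] [DenM n κ A A']
    [DenV n κ z z'] :
    ((worldviewIs k h A z : Fml X) m n).Sat M β κ ↔ M.WorldviewIs k' h' A' z' := by
  simp only [worldviewIs, sat_allQ4, sat_iff, sat_sameEvent, sat_trivMap, Model.WorldviewIs]

theorem forall_matrix {P : (Fin 3 → Fin 3 → Q) → Prop} :
    (∀ a b c, P ![a, b, c]) ↔ ∀ A, P A := by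
  refine ⟨fun h A => ?_, fun h a b c => h _⟩
  convert h (A 0) (A 1) (A 2)
  funext i
  fin_cases i <;> rfl

end Abbreviations

/-! ### Semantics of the axioms -/

section Axioms

variable {X B Q : Type} [Field Q] [LinearOrder Q] [EuclideanField Q] {M : Model X B Q}
  {β : ℕ → B} {κ : ℕ → Q}

theorem sat_AxSelf : (AxSelf : Fml X).done.Sat M β κ ↔
    ∀ k, M.iob k → ∀ x, M.W k k x ↔ sp x = 0 := by
  have den (n) (κ : ℕ → Q) (d : Fin 4 → Q) (i) : DenQ (n + 4) (push4 d κ) (tok4 n i) (d i) :=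
    DenV.tok4.out i
  simp only [Fml.done, AxSelf, sat_allB, sat_imp, sat_IOb, sat_allQ4, sat_iff, sat_W, sat_and,
    sat_isZero, funext_iff, Fin.forall_fin_succ, IsEmpty.forall_iff, and_true]
  rfl

theorem sat_AxSymD : (AxSymD : Fml X).done.Sat M β κ ↔
    ∀ k h, M.iob k → M.iob h → ∀ x y x' y', x 0 = y 0 → x' 0 = y' 0 →
      (∀ b, M.W k b x ↔ M.W h b x') → (∀ b, M.W k b y ↔ M.W h b y') →
      dot (sp (x - y)) (sp (x - y)) = dot (sp (x' - y')) (sp (x' - y')) := by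
  simp only [Fml.done, AxSymD, sat_allB, sat_imp, sat_and, sat_IOb, sat_allQ4, sat_exQ, sat_isZero,
    sat_isTime, sat_sameEvent, sat_sameSpace, and_imp, exists_eq_left, eq_comm (a := (0 : Q)),
    abs_eq_zero, sub_eq_zero]

theorem sat_AxLine : (AxLine : Fml X).done.Sat M β κ ↔
    ∀ k h, M.iob k → M.iob h → ∀ x y z, M.W k h x → M.W k h y → M.W k h z →
      ∃ a : Q, z + a • x = x + a • y ∨ y + a • x = z + a • z := by
  have den (n) (κ : ℕ → Q) (d : Fin 4 → Q) (i) : DenQ (n + 4) (push4 d κ) (tok4 n i) (d i) :=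
    DenV.tok4.out i
  simp only [Fml.done, AxLine, sat_allB, sat_imp, sat_and, sat_IOb, sat_allQ4, sat_W, sat_exQ,
    sat_or, sat_eqPt, and_imp]
  rfl

theorem sat_AxTriv : (AxTriv : Fml X).done.Sat M β κ ↔
    ∀ (A : Fin 3 → Fin 3 → Q) (z : Fin 4 → Q), Orth A → ∀ k, M.iob k →
      ∃ h, M.iob h ∧ M.WorldviewIs k h A z := by
  simp only [Fml.done, AxTriv, allTriv, sat_allQ3, sat_allQ4, sat_imp, sat_orthogonal, sat_allB,
    sat_IOb, sat_exB, sat_and, sat_worldviewIs]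
  exact forall_matrix (P := fun A => ∀ z : Fin 4 → Q, Orth A → ∀ k, M.iob k →
      ∃ h, M.iob h ∧ M.WorldviewIs k h A z)

theorem sat_AxAbsTime : (AxAbsTime : Fml X).done.Sat M β κ ↔
    ∀ k h, M.iob k → M.iob h → ∀ x y x' y',
      (∀ b, M.W k b x ↔ M.W h b x') → (∀ b, M.W k b y ↔ M.W h b y') →
      |x 0 - y 0| = |x' 0 - y' 0| := by
  simp only [Fml.done, AxAbsTime, sat_allB, sat_imp, sat_and, sat_IOb, sat_allQ4, sat_sameEvent,
    sat_sameTime, and_imp]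

theorem sat_AxEther : (AxEther : Fml X).done.Sat M β κ ↔ ∃ e, M.Ether e := by
  simp only [Fml.done, AxEther, sat_exB, sat_Ether]

/-- One direction suffices because the axiom only has to be verified. A nonnegative speed is
supplied, as the quadratic form of the speed condition requires. -/
theorem sat_AxNoFTL (h : ∀ k e, M.iob k → M.Ether e → ∃ v, 0 ≤ v ∧ M.IsSpeed e k v ∧
      ∃ c, (0 < c ∧ ∀ e, M.Ether e → M.LightSpeed c e) ∧ v < c) :
    (AxNoFTL : Fml X).done.Sat M β κ := by
  simp only [Fml.done, AxNoFTL, sat_allB, sat_imp, sat_and, sat_IOb, sat_Ether, sat_exQ, sat_isCe,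
    sat_lt, and_imp]
  intro k e hk he
  obtain ⟨v, hv, hs, hc⟩ := h k e hk he
  exact ⟨v, (sat_isSpeed hv).2 hs, hc⟩

theorem sat_AxThExpSTL : (AxThExpSTL : Fml X).done.Sat M β κ ↔
    (∃ h, M.iob h) ∧ ∀ e, M.Ether e → ∀ x y c, 0 < c → (∀ e, M.Ether e → M.LightSpeed c e) →
      mink c (x - y) < 0 → ∃ k, M.iob k ∧ M.W e k x ∧ M.W e k y := by
  simp only [Fml.done, AxThExpSTL, sat_and, sat_exB, sat_allB, sat_imp, sat_IOb, sat_Ether,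
    sat_allQ4, sat_exQ, sat_isCe, sat_W, forall_exists_index, and_imp]
  refine and_congr_right fun _ => forall₄_congr fun e he x y => forall_congr' fun c =>
    forall_congr' fun hc => forall_congr' fun _ => ?_
  rw [sat_spaceLt hc.le]

theorem sat_AxPhc : (AxPhc : Fml X).done.Sat M β κ ↔
    ∃ c, 0 < c ∧ ∀ k, M.iob k → M.LightSpeed c k := by
  simp only [Fml.done, AxPhc, sat_exQ, sat_isC]

theorem sat_AxThExp : (AxThExp : Fml X).done.Sat M β κ ↔
    (∃ h, M.iob h) ∧ ∀ e, M.iob e → ∀ x y c, 0 < c → (∀ k, M.iob k → M.LightSpeed c k) →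
      mink c (x - y) < 0 → ∃ k, M.iob k ∧ M.W e k x ∧ M.W e k y := by
  simp only [Fml.done, AxThExp, sat_and, sat_exB, sat_allB, sat_imp, sat_IOb,
    sat_allQ4, sat_exQ, sat_isC, sat_W, forall_exists_index, and_imp]
  refine and_congr_right fun _ => forall₄_congr fun e he x y => forall_congr' fun c =>
    forall_congr' fun hc => forall_congr' fun _ => ?_
  rw [sat_spaceLt hc.le]

theorem sat_AxPrimitiveEther {M : Model Unit B Q} : AxPrimitiveEther.done.Sat M β κ ↔
    ∃ e, M.iob e ∧ ∀ k, (M.iob k ∧ ∃ (A : Fin 3 → Fin 3 → Q) (z : Fin 4 → Q),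
      Orth A ∧ M.WorldviewIs e k A z) ↔ M.ext () k := by
  simp only [Fml.done, AxPrimitiveEther, exTriv, sat_exB, sat_and, sat_IOb, sat_allB, sat_iff,
    sat_exQ3, sat_exQ4, sat_orthogonal, sat_worldviewIs, sat_E]
  refine exists_congr fun e => and_congr_right fun _ => forall_congr' fun k => ?_
  -- The existential version for matrices is obtained from the universal one by negating both sides.
  have := forall_matrix (P := fun A => ¬∃ z : Fin 4 → Q, Orth A ∧ M.WorldviewIs e k A z)
  rw [← not_iff_not] at this
  push Not at this
  rw [this]

end Axioms

/-! ### Orthogonal matrices -/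

section Orthogonal

variable {Q : Type} [Field Q] {A : Fin 3 → Fin 3 → Q}

theorem dot_comm (v w : Fin 3 → Q) : dot v w = dot w v := by
  simp only [dot]; ring

theorem appl_add (A : Fin 3 → Fin 3 → Q) (s t : Fin 3 → Q) :
    appl A (s + t) = appl A s + appl A t := by
  funext i; simp only [appl, Pi.add_apply]; ring

theorem appl_smul (A : Fin 3 → Fin 3 → Q) (a : Q) (s : Fin 3 → Q) :
    appl A (a • s) = a • appl A s := by
  funext i; simp only [appl, Pi.smul_apply, smul_eq_mul]; ring

theorem Orth.dot_appl (h : Orth A) (s t : Fin 3 → Q) : dot (appl A s) (appl A t) = dot s t := by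
  have e (i j) := h i j
  have h00 := e 0 0
  have h01 := e 0 1
  have h02 := e 0 2
  have h11 := e 1 1
  have h12 := e 1 2
  have h22 := e 2 2
  simp only [if_true, Fin.reduceEq, if_false] at h00 h01 h02 h11 h12 h22
  simp only [dot, appl]
  linear_combination s 0 * t 0 * h00 + (s 0 * t 1 + s 1 * t 0) * h01 +
    (s 0 * t 2 + s 2 * t 0) * h02 + s 1 * t 1 * h11 + (s 1 * t 2 + s 2 * t 1) * h12 +
    s 2 * t 2 * h22

theorem orth_iff {A : Fin 3 → Fin 3 → Q} :
    Orth A ↔ (Matrix.of A).transpose * Matrix.of A = 1 := by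
  simp only [Orth, ← Matrix.ext_iff, Matrix.mul_apply, Fin.sum_univ_three, Matrix.transpose_apply,
    Matrix.of_apply, Matrix.one_apply]

/-- A one-sided inverse of a square matrix is two-sided. -/
theorem Orth.transpose (h : Orth A) : Orth fun i j => A j i := by
  rw [orth_iff] at h ⊢
  exact mul_eq_one_comm.1 h

theorem Orth.appl_transpose (h : Orth A) (s : Fin 3 → Q) :
    appl (fun i j => A j i) (appl A s) = s := by
  funext i
  have h0 := h i 0
  have h1 := h i 1
  have h2 := h i 2
  simp only [appl]
  fin_cases i <;> simp at h0 h1 h2 ⊢ <;> linear_combination s 0 * h0 + s 1 * h1 + s 2 * h2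

theorem Orth.transpose_appl (h : Orth A) (s : Fin 3 → Q) :
    appl A (appl (fun i j => A j i) s) = s :=
  h.transpose.appl_transpose s

theorem Orth.injective (h : Orth A) : Function.Injective (appl A) :=
  Function.LeftInverse.injective h.appl_transpose

end Orthogonal

/-! ### Radarization -/

section Radarization

variable {Q : Type} [Field Q]

/-- The radarization with velocity `v`, where `s = √(1 - |v|²/c²)`. -/
def rad (c s : Q) (v : Fin 3 → Q) (x : Fin 4 → Q) : Fin 4 → Q :=
  Fin.cons (s * x 0 + dot v (sp x) / (c * c * s))
    (sp x + (dot v (sp x) / (c * c * s * (1 + s))) • v)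

theorem sp_cons (t : Q) (s : Fin 3 → Q) : sp (Fin.cons t s : Fin 4 → Q) = s := rfl

theorem cons_sp (x : Fin 4 → Q) : (Fin.cons (x 0) (sp x) : Fin 4 → Q) = x := by
  funext i; refine Fin.cases ?_ (fun i => ?_) i <;> rfl

theorem pt_ext {x y : Fin 4 → Q} (h₀ : x 0 = y 0) (h : sp x = sp y) : x = y := by
  rw [← cons_sp x, ← cons_sp y, h₀, h]

variable [LinearOrder Q] [EuclideanField Q]

/-- `s = √(1 - |v|²/c²)` -/
def IsFactor (c : Q) (v : Fin 3 → Q) (s : Q) : Prop :=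
  0 < s ∧ c * c * (s * s) + dot v v = c * c

variable {X B : Type} {M : Model X B Q} {m n : ℕ} {β : ℕ → B} {κ : ℕ → Q}

theorem sat_rotMap {l : QTok} {v : Fin 3 → QTok} {x y : Fin 4 → QTok} {l' : Q} {v' : Fin 3 → Q}
    {x' y' : Fin 4 → Q} [DenQ n κ l l'] [hv : DenV n κ v v'] [hx : DenV n κ x x']
    [hy : DenV n κ y y'] : ((rotMap l v x y : Fml X) m n).Sat M β κ ↔ y' 0 = x' 0 ∧
      (((v' 1 ≠ 0 ∨ v' 2 ≠ 0) ∧ ∃ r, r * (v' 1 * v' 1 + v' 2 * v' 2) + v' 0 = l' ∧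
          l' * y' 1 + (v' 0 * x' 1 + v' 1 * x' 2 + v' 2 * x' 3) = 0 ∧
          l' * y' 2 + (v' 0 + v' 2 * v' 2 * r) * x' 2 = v' 1 * x' 1 + v' 1 * v' 2 * r * x' 3 ∧
          l' * y' 3 + (v' 0 + v' 1 * v' 1 * r) * x' 3 = v' 2 * x' 1 + v' 1 * v' 2 * r * x' 2) ∨
        (¬0 < v' 0 ∧ v' 1 = 0 ∧ v' 2 = 0 ∧ y' 1 = x' 1 ∧ y' 2 = x' 2 ∧ y' 3 = x' 3) ∨
        (0 < v' 0 ∧ v' 1 = 0 ∧ v' 2 = 0 ∧ y' 1 + x' 1 = 0 ∧ y' 2 + x' 2 = 0 ∧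
          y' 3 + x' 3 = 0)) := by
  have den₁ (i) : DenQ n κ (v i) (v' i) := hv.out i
  have den₂ (i) : DenQ n κ (x i) (x' i) := hx.out i
  have den₃ (i) : DenQ n κ (y i) (y' i) := hy.out i
  simp only [rotMap, sat_and, sat_or, sat_not, sat_eqQ, sat_isZero, sat_pos, sat_exQ, ne_eq]

theorem eq_triv_iff {A : Fin 3 → Fin 3 → Q} {z x y : Fin 4 → Q} :
    y = triv A z x ↔ y 0 = x 0 + z 0 ∧ sp y = appl A (sp x) + sp z :=
  ⟨fun h => by subst h; exact ⟨rfl, rfl⟩, fun h => pt_ext h.1 h.2⟩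

/-- The matrix of a rotation that maps `v` to the negative `x`-axis, for `l = |v|`. -/
def rotMat (l r : Q) (v : Fin 3 → Q) : Fin 3 → Fin 3 → Q :=
  ![![l⁻¹ * -v 0, l⁻¹ * -v 1, l⁻¹ * -v 2],
    ![l⁻¹ * v 1, l⁻¹ * (-v 0 - v 2 * v 2 * r), l⁻¹ * (v 1 * v 2 * r)],
    ![l⁻¹ * v 2, l⁻¹ * (v 1 * v 2 * r), l⁻¹ * (-v 0 - v 1 * v 1 * r)]]

/-- The sum `r * hr + hk` says `r² (v₁² + v₂²) + 2 r v₀ = 1`. This normalizes the last two columns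
and makes them orthogonal to each other; the remaining entries need only `l² = |v|²` or ring
identities. -/
theorem orth_rotMat {l r : Q} {v : Fin 3 → Q} (hl : l ≠ 0) (h : l * l = dot v v)
    (hr : r * (v 1 * v 1 + v 2 * v 2) + v 0 = l) (hk : r * (l + v 0) = 1) :
    Orth (rotMat l r v) := by
  have hi : l⁻¹ * l = 1 := inv_mul_cancel₀ hl
  have hi2 : l⁻¹ * l⁻¹ * (l * l) = 1 := by linear_combination (l⁻¹ * l + 1) * hi
  simp only [dot] at h
  intro i j
  fin_cases i <;> fin_cases j <;> simp [rotMat]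
  · linear_combination -(l⁻¹ * l⁻¹) * h + hi2
  · ring
  · ring
  · ring
  · linear_combination (l⁻¹ * l⁻¹) * (v 2 * v 2 * (r * hr + hk) - h) + hi2
  · linear_combination -(l⁻¹ * l⁻¹) * (v 1 * v 2 * (r * hr + hk))
  · ring
  · linear_combination -(l⁻¹ * l⁻¹) * (v 1 * v 2 * (r * hr + hk))
  · linear_combination (l⁻¹ * l⁻¹) * (v 1 * v 1 * (r * hr + hk) - h) + hi2

/-- The three cases in the definition of the rotation are merged here. Afterwards only orthogonality
and the image of `v` matter. -/
theorem exists_rot {l : Q} {v : Fin 3 → Q} (hl : 0 ≤ l) (h : l * l = dot v v) :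
    ∃ A : Fin 3 → Fin 3 → Q, Orth A ∧ appl A v = ![-l, 0, 0] ∧
      ∀ (n : ℕ) (κ : ℕ → Q) (l' : QTok) (v' : Fin 3 → QTok) (x y : Fin 4 → QTok)
        (x' y' : Fin 4 → Q) [DenQ n κ l' l] [DenV n κ v' v] [DenV n κ x x'] [DenV n κ y y'],
        ((rotMap l' v' x y : Fml X) m n).Sat M β κ ↔ y' = triv A 0 x' := by
  by_cases hv : v 1 = 0 ∧ v 2 = 0
  · obtain ⟨h1, h2⟩ := hv
    simp only [dot, h1, h2, mul_zero, add_zero] at h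
    by_cases h0 : 0 < v 0
    · have e : l = v 0 := (mul_self_inj hl h0.le).1 h
      refine ⟨fun i j => if i = j then -1 else 0, ?_, ?_, ?_⟩
      · intro i j
        fin_cases i <;> fin_cases j <;> simp
      · funext i
        fin_cases i <;> simp [appl, h1, h2, e]
      · intro n κ l' v' x y x' y' _ _ _ _
        rw [sat_rotMap, eq_triv_iff]
        simp [h1, h2, h0, funext_iff, Fin.forall_fin_succ, sp, appl, eq_neg_iff_add_eq_zero]
    · have e : l = -v 0 := (mul_self_inj hl (by linarith)).1 (by rw [h]; ring)
      refine ⟨fun i j => if i = j then 1 else 0, ?_, ?_, ?_⟩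
      · intro i j
        fin_cases i <;> fin_cases j <;> simp
      · funext i
        fin_cases i <;> simp [appl, h1, h2, e]
      · intro n κ l' v' x y x' y' _ _ _ _
        rw [sat_rotMap, eq_triv_iff]
        simp [h1, h2, h0, funext_iff, Fin.forall_fin_succ, sp, appl]
  · have hv' : v 1 ≠ 0 ∨ v 2 ≠ 0 := by tauto
    have hw : 0 < v 1 * v 1 + v 2 * v 2 := by
      rcases hv' with hv' | hv'
      · exact add_pos_of_pos_of_nonneg (mul_self_pos.2 hv') (mul_self_nonneg _)
      · exact add_pos_of_nonneg_of_pos (mul_self_nonneg _) (mul_self_pos.2 hv')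
    have hl0 : l ≠ 0 := by
      rintro rfl
      simp only [dot] at h
      nlinarith [mul_self_nonneg (v 0)]
    obtain ⟨r, hr⟩ : ∃ r, r * (v 1 * v 1 + v 2 * v 2) + v 0 = l :=
      ⟨(l - v 0) / (v 1 * v 1 + v 2 * v 2), by rw [div_mul_cancel₀ _ hw.ne']; ring⟩
    -- From `(l - v₀)(l + v₀) = v₁² + v₂²`, so `r` is also the reciprocal of `l + v₀`.
    have hk : r * (l + v 0) = 1 := by
      refine mul_right_cancel₀ hw.ne' ?_
      simp only [dot] at h
      linear_combination (l + v 0) * hr + h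
    have hi : l⁻¹ * l = 1 := inv_mul_cancel₀ hl0
    refine ⟨rotMat l r v, orth_rotMat hl0 h hr hk, ?_, ?_⟩
    · simp only [dot] at h
      funext i
      fin_cases i <;> simp [rotMat, appl]
      · linear_combination l⁻¹ * h - l * hi
      · ring
      · ring
    · intro n κ l' v' x y x' y' _ _ _ _
      rw [sat_rotMap, eq_triv_iff]
      have r_unique : ∀ r', r' * (v 1 * v 1 + v 2 * v 2) + v 0 = l ↔ r' = r := fun r' =>
        ⟨fun h' => mul_right_cancel₀ hw.ne' (by linear_combination h' - hr), fun h' => by rw [h', hr]⟩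
      have solve : ∀ a b : Q, a = l⁻¹ * b ↔ l * a = b := fun a b => eq_inv_mul_iff_mul_eq₀ hl0
      have neg_cases : ¬(v 1 = 0 ∧ v 2 = 0) := hv
      have e1 : y' 1 = appl (rotMat l r v) (sp x') 0 ↔
          l * y' 1 + (v 0 * x' 1 + v 1 * x' 2 + v 2 * x' 3) = 0 := by
        rw [show appl (rotMat l r v) (sp x') 0 =
          l⁻¹ * -(v 0 * x' 1 + v 1 * x' 2 + v 2 * x' 3) by simp [appl, rotMat, sp]; ring, solve,
          eq_neg_iff_add_eq_zero]
      have e2 : y' 2 = appl (rotMat l r v) (sp x') 1 ↔ l * y' 2 + (v 0 + v 2 * v 2 * r) * x' 2 =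
          v 1 * x' 1 + v 1 * v 2 * r * x' 3 := by
        rw [show appl (rotMat l r v) (sp x') 1 =
          l⁻¹ * (v 1 * x' 1 + v 1 * v 2 * r * x' 3 - (v 0 + v 2 * v 2 * r) * x' 2) by
            simp [appl, rotMat, sp]; ring, solve, eq_sub_iff_add_eq]
      have e3 : y' 3 = appl (rotMat l r v) (sp x') 2 ↔ l * y' 3 + (v 0 + v 1 * v 1 * r) * x' 3 =
          v 2 * x' 1 + v 1 * v 2 * r * x' 2 := by
        rw [show appl (rotMat l r v) (sp x') 2 =
          l⁻¹ * (v 2 * x' 1 + v 1 * v 2 * r * x' 2 - (v 0 + v 1 * v 1 * r) * x' 3) by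
            simp [appl, rotMat, sp]; ring, solve, eq_sub_iff_add_eq]
      have e : sp y' = appl (rotMat l r v) (sp x') + sp 0 ↔ y' 1 = appl (rotMat l r v) (sp x') 0 ∧
          y' 2 = appl (rotMat l r v) (sp x') 1 ∧ y' 3 = appl (rotMat l r v) (sp x') 2 := by
        simp [funext_iff, Fin.forall_fin_succ, sp]
      rw [e, e1, e2, e3]
      simp only [r_unique, exists_eq_left, hv', true_and, Pi.zero_apply, add_zero]
      refine and_congr_right fun _ => or_iff_left ?_
      rintro (⟨-, h1, h2, -⟩ | ⟨-, h1, h2, -⟩) <;> exact hv ⟨h1, h2⟩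

/-- Because `A` is orthogonal and turns `v` into `(-l, 0, 0)`, the scalar product with `v` is `-l`
times the first rotated coordinate. The composition can thus be evaluated in rotated coordinates,
and the closed form `rad` no longer depends on the choice of rotation. -/
theorem rad_eq_iff {c l s : Q} {v : Fin 3 → Q} {A : Fin 3 → Fin 3 → Q} {x y : Fin 4 → Q}
    (hA : Orth A) (hv : appl A v = ![-l, 0, 0]) (hc : 0 < c) (hs : 0 < s)
    (h : c * c * (s * s) + l * l = c * c) :
    (∃ x₁ x₂ x₃ x₄ : Fin 4 → Q, x₁ = triv A 0 x ∧
      (x₂ 0 = x₁ 0 ∧ x₂ 1 = l * x₁ 0 + x₁ 1 ∧ x₂ 2 = x₁ 2 ∧ x₂ 3 = x₁ 3) ∧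
      (c * c * x₃ 0 + l * x₂ 1 = c * c * x₂ 0 + l * l * x₃ 0 ∧
        c * c * x₃ 1 + c * c * (l * x₂ 0) = c * c * x₂ 1 + l * l * x₃ 1 ∧
        s * x₃ 2 = x₂ 2 ∧ s * x₃ 3 = x₂ 3) ∧ x₄ = s • x₃ ∧ x₄ = triv A 0 y) ↔
      y = rad c s v x := by
  have hcs : c * c * (s * s) ≠ 0 := by positivity
  have hvx : dot v (sp x) = -l * appl A (sp x) 0 := by
    rw [← hA.dot_appl, hv]; simp [dot]
  have h1 : (1 + s) ≠ 0 := by positivity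
  have key0 : ∀ a t : Q, c * c * t + l * (l * x 0 + a) = c * c * x 0 + l * l * t ↔
      s * t = s * x 0 + -l * a / (c * c * s) := by
    intro a t
    have e : s * x 0 + -l * a / (c * c * s) = (c * c * (s * s) * x 0 - l * a) / (c * c * s) := by
      field_simp
      ring
    rw [e, eq_div_iff (by positivity)]
    exact ⟨fun e => by linear_combination e + (t - x 0) * h,
      fun e => by linear_combination e - (t - x 0) * h⟩
  -- Along `v` the shear cancels the time term of the synchronisation, which leaves `s * t = a / s`.
  -- The right-hand side has this value because `l² = c² (1 - s²)`.
  have key1 : ∀ a t : Q, c * c * t + c * c * (l * x 0) = c * c * (l * x 0 + a) + l * l * t ↔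
      s * t = a + -l * a / (c * c * s * (1 + s)) * -l := by
    intro a t
    have e : a + -l * a / (c * c * s * (1 + s)) * -l = a / s := by
      field_simp
      linear_combination a * h
    rw [e, eq_div_iff hs.ne']
    constructor
    · intro e
      refine mul_left_cancel₀ (a := c * c) (by positivity) ?_
      linear_combination e + t * h
    · intro e
      linear_combination c * c * e - t * h
  have main : y = rad c s v x ↔
      y 0 = s * x 0 + -l * appl A (sp x) 0 / (c * c * s) ∧
      appl A (sp y) 0 = appl A (sp x) 0 + -l * appl A (sp x) 0 / (c * c * s * (1 + s)) * -l ∧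
      appl A (sp y) 1 = appl A (sp x) 1 ∧ appl A (sp y) 2 = appl A (sp x) 2 := by
    have : sp y = sp (rad c s v x) ↔ appl A (sp y) = appl A (sp (rad c s v x)) :=
      hA.injective.eq_iff.symm
    have e : y = rad c s v x ↔ y 0 = rad c s v x 0 ∧ sp y = sp (rad c s v x) :=
      ⟨fun h => by subst h; exact ⟨rfl, rfl⟩, fun h => pt_ext h.1 h.2⟩
    rw [e, this]
    simp only [rad, sp_cons, appl_add, appl_smul, hv, hvx, funext_iff, Fin.forall_fin_succ]
    simp
  rw [main]
  constructor
  · rintro ⟨x₁, x₂, x₃, x₄, rfl, ⟨e0, e1, e2, e3⟩, ⟨f0, f1, f2, f3⟩, rfl, hy⟩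
    have ht : triv A 0 x 0 = x 0 := add_zero _
    have ht' : triv A 0 y 0 = y 0 := add_zero _
    have hs' : ∀ (x : Fin 4 → Q) (i : Fin 3), triv A 0 x i.succ = appl A (sp x) i :=
      fun x i => add_zero _
    have g0 := congrFun hy 0
    have g1 := congrFun hy (Fin.succ 0)
    have g2 := congrFun hy (Fin.succ 1)
    have g3 := congrFun hy (Fin.succ 2)
    rw [hs'] at g1 g2 g3
    rw [ht'] at g0
    change x₂ 1 = l * _ + triv A 0 x (Fin.succ 0) at e1
    change x₂ 2 = triv A 0 x (Fin.succ 1) at e2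
    change x₂ 3 = triv A 0 x (Fin.succ 2) at e3
    rw [hs'] at e1 e2 e3
    rw [ht] at e0 e1
    rw [e1, e0] at f0 f1
    rw [key0] at f0
    rw [key1] at f1
    exact ⟨g0.symm.trans f0, g1.symm.trans f1, g2.symm.trans (f2.trans e2),
      g3.symm.trans (f3.trans e3)⟩
  · rintro ⟨e0, e1, e2, e3⟩
    have hs' : ∀ a, s * (a / s) = a := fun a => mul_div_cancel₀ a hs.ne'
    refine ⟨triv A 0 x, Fin.cons (x 0) ![l * x 0 + appl A (sp x) 0, appl A (sp x) 1,
      appl A (sp x) 2], Fin.cons (y 0 / s) ![appl A (sp y) 0 / s, appl A (sp y) 1 / s,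
      appl A (sp y) 2 / s], triv A 0 y, rfl, ?_, ?_, ?_, rfl⟩
    · refine ⟨(add_zero _).symm, ?_, ?_, ?_⟩
      · change _ = l * (x 0 + 0) + (appl A (sp x) 0 + 0)
        simp
      · exact (add_zero _).symm
      · exact (add_zero _).symm
    · refine ⟨(key0 _ _).2 ((hs' _).trans e0), (key1 _ _).2 ((hs' _).trans e1),
        (hs' _).trans e2, (hs' _).trans e3⟩
    · funext i
      refine Fin.cases ?_ (fun i => ?_) i
      · exact (add_zero _).trans (hs' _).symm
      · refine (add_zero _).trans ?_
        fin_cases i <;> exact (hs' _).symm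

theorem sat_radMap {c : QTok} {v : Fin 3 → QTok} {x y : Fin 4 → QTok} {c' : Q} {v' : Fin 3 → Q}
    {x' y' : Fin 4 → Q} [DenQ n κ c c'] [hv : DenV n κ v v'] [hx : DenV n κ x x']
    [hy : DenV n κ y y'] (hc : 0 < c') : ((radMap c v x y : Fml X) m n).Sat M β κ ↔
      ∃ s, IsFactor c' v' s ∧ y' = rad c' s v' x' := by
  have den₁ (i) : DenQ n κ (v i) (v' i) := hv.out i
  have den₂ (n) (κ : ℕ → Q) (d : Fin 4 → Q) (i) : DenQ (n + 4) (push4 d κ) (tok4 n i) (d i) :=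
    DenV.tok4.out i
  simp only [radMap, galMap, syncMap, scaleMap, sat_exQ, sat_exQ4, sat_and, sat_nonneg, sat_eqQ,
    sat_lt, sat_eqPt]
  constructor
  · rintro ⟨l, hl, hll, hlc, s, hs, h, H⟩
    obtain ⟨A, hA, hAv, hR⟩ := exists_rot (M := M) (m := m) (β := β) hl hll
    -- The formula only provides `0 ≤ s`; the value `s = 0` would give `l² = c²`, against `l < c`.
    have hs' : 0 < s := hs.lt_of_ne' (by
      rintro rfl
      have := mul_self_lt_mul_self hl hlc
      linarith)
    refine ⟨s, ⟨hs', by rwa [← show l * l = dot v' v' from hll]⟩,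
      (rad_eq_iff hA hAv hc hs' h).1 ?_⟩
    simp only [hR] at H
    exact H
  · rintro ⟨s, ⟨hs, h⟩, e⟩
    obtain ⟨l, hl, hll⟩ := exists_sqrt (dot_self_nonneg v')
    obtain ⟨A, hA, hAv, hR⟩ := exists_rot (M := M) (m := m) (β := β) hl hll
    rw [← hll] at h
    refine ⟨l, hl, hll, lt_of_mul_self_lt_mul_self₀ hc.le ?_, s, hs.le, h, ?_⟩
    · have : 0 < c' * c' * (s * s) := by positivity
      linarith
    · simp only [hR]
      exact (rad_eq_iff hA hAv hc hs h).2 e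

/-- `y` is the radarization of `x` for the velocity of `e` according to `k`. -/
theorem sat_radObs {k e : BTok} {x y : Fin 4 → QTok} {k' e' : B} {x' y' : Fin 4 → Q}
    [DenB m β k k'] [DenB m β e e'] [hx : DenV n κ x x'] [hy : DenV n κ y y'] :
    ((radObs k e x y : Fml X) m n).Sat M β κ ↔ ∃ v, M.IsVelocity k' e' v ∧ ∃ c,
      (0 < c ∧ ∀ k, M.iob k → M.LightSpeed c k) ∧ ∃ s, IsFactor c v s ∧ y' = rad c s v x' := by
  simp only [radObs, sat_exQ3, sat_exQ, sat_and, sat_isVelocity, sat_isC]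
  exact exists_congr fun v => and_congr_right fun _ => exists_congr fun c =>
    and_congr_right fun hc => sat_radMap hc.1

end Radarization

/-! ### The translation -/

section Translation

variable {B Q : Type} [Add Q] [Mul Q] [LE Q] {M : Model Unit B Q} {β : ℕ → B} {κ : ℕ → Q}

/-- The model of the base language defined by the translation. -/
def Model.classical (M : Model Unit B Q) : Model Empty B Q where
  iob := M.iob
  ph := M.ph
  ext := Empty.elim
  W k b x := trPlus'.W.Sat M (fun | 0 => k | _ => b)
    (fun | 0 => x 0 | 1 => x 1 | 2 => x 2 | _ => x 3)

/-- Both structures have the same domains, and only the interpretation of `W` is changed. That case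
is the substitution lemma applied to the translating formula. -/
theorem sat_apply (φ : BaseFormula) :
    (trPlus'.apply φ).Sat M β κ ↔ φ.Sat M.classical β κ := by
  induction φ generalizing β κ with
  | imp φ ψ hφ hψ => simp only [Translation.apply, Formula.Sat, hφ, hψ]
  | allB φ ih => simp only [Translation.apply, Formula.Sat, ih]
  | allQ φ ih => simp only [Translation.apply, Formula.Sat, ih]
  | ext x => exact x.elim
  | W k b t₀ t₁ t₂ t₃ =>
    simp only [Translation.apply, Formula.Sat, Formula.sat_subst, Model.classical]
    refine iff_of_eq (congrArg₂ _ ?_ ?_)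
    · funext i
      rcases i with _ | i <;> rfl
    · funext i
      rcases i with _ | _ | _ | i <;> rfl
  | _ => exact Iff.rfl

end Translation

theorem classical_W {B Q : Type} [Field Q] [LinearOrder Q] [EuclideanField Q]
    {M : Model Unit B Q} {k b : B} {x : Fin 4 → Q} : M.classical.W k b x ↔
      ∀ e, M.ext () e → ∃ y, (∃ v, M.IsVelocity k e v ∧ ∃ c,
        (0 < c ∧ ∀ k, M.iob k → M.LightSpeed c k) ∧ ∃ s, IsFactor c v s ∧ y = rad c s v x) ∧
        M.W k b y := by
  simp only [Model.classical, trPlus', Fml.done, trW, sat_allB, sat_imp, sat_E, sat_exQ4, sat_and,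
    sat_radObs, sat_W]
  have : ![x 0, x 1, x 2, x 3] = x := by
    funext i; fin_cases i <;> rfl
  simp only [this]

/-! ### Bijections that preserve timelike lines -/

section Affine

/-- `f` maps lines with directions in `T` into such lines. -/
def MapsLines {Q V : Type} [Field Q] [AddCommGroup V] [Module Q V] (T : V → Prop) (f : V → V) :
    Prop :=
  ∀ x y, T (y - x) → T (f y - f x) ∧ ∀ a : Q, ∃ b : Q, f (x + a • (y - x)) = f x + b • (f y - f x)

variable {Q V : Type} [Field Q] [AddCommGroup V] [Module Q V] {T : V → Prop} {f : V ≃ V}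

/-- A common point of the two image lines would be carried by `f.symm` to a point on both original
lines, which are parallel and distinct. -/
theorem MapsLines.lines_disjoint (hf : MapsLines (Q := Q) T f) (hg : MapsLines (Q := Q) T f.symm)
    {x p q : V} (hp : T p) (hpq : ∀ a : Q, q ≠ a • p) (a b : Q) :
    f x + a • (f (x + p) - f x) ≠ f (x + q) + b • (f (x + q + p) - f (x + q)) := by
  intro e
  obtain ⟨a', ha⟩ := (hg _ _ (hf x (x + p) (by simpa using hp)).1).2 a
  obtain ⟨b', hb⟩ := (hg _ _ (hf (x + q) (x + q + p) (by simpa using hp)).1).2 b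
  rw [e, hb] at ha
  simp only [Equiv.symm_apply_apply, add_sub_cancel_left] at ha
  refine hpq (a' - b') ?_
  rw [sub_smul, eq_sub_iff_add_eq, ← add_right_inj x, ← add_assoc, ha]

/-- If `β ≠ 1`, the images of the two parallel lines are coplanar and not parallel, so they meet;
the parameters `(1 - β)⁻¹ * α` and `(1 - β)⁻¹` give the meeting point. -/
theorem MapsLines.coeff_eq_one (hf : MapsLines (Q := Q) T f) (hg : MapsLines (Q := Q) T f.symm)
    {x p q : V} (hp : T p) (hpq : ∀ a : Q, q ≠ a • p) {α β : Q}
    (h : f (x + q + p) - f x = α • (f (x + p) - f x) + β • (f (x + q) - f x)) : β = 1 := by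
  by_contra hβ
  have hβ' : 1 - β ≠ 0 := fun h => hβ (sub_eq_zero.1 h).symm
  refine hf.lines_disjoint hg (x := x) hp hpq ((1 - β)⁻¹ * α) (1 - β)⁻¹ ?_
  have e : f (x + q + p) - f (x + q) =
      α • (f (x + p) - f x) - (1 - β) • (f (x + q) - f x) := by
    rw [← sub_sub_sub_cancel_right _ _ (f x), h]
    module
  rw [e, smul_sub (1 - β)⁻¹, smul_smul, smul_smul, inv_mul_cancel₀ hβ']
  module

variable [LinearOrder Q] [IsStrictOrderedRing Q]

/-- The diagonals also have directions in `T`, and their crossing puts the image of the fourth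
vertex into the plane of the other three. Disjointness of the images of opposite sides then fixes
both of its coefficients as `1`. -/
theorem MapsLines.parallelogram (hf : MapsLines (Q := Q) T f) (hg : MapsLines (Q := Q) T f.symm)
    {x p q : V} (hp : T p) (hq : T q) (hs : T (p + q)) (hd : T (q - p))
    (hpq : ∀ a : Q, q ≠ a • p) (hqp : ∀ a : Q, p ≠ a • q) :
    f (x + p + q) - f (x + p) = f (x + q) - f x := by
  obtain ⟨b, hb⟩ := (hf x (x + p + q) (by simpa [add_assoc] using hs)).2 2⁻¹
  obtain ⟨b', hb'⟩ := (hf (x + p) (x + q) (by simpa using hd)).2 2⁻¹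
  -- The diagonals share their midpoint, whose image can be written along either image line.
  have mid : x + p + (2⁻¹ : Q) • (x + q - (x + p)) = x + (2⁻¹ : Q) • (x + p + q - x) := by
    module
  rw [mid, hb] at hb'
  have hb0 : b ≠ 0 := by
    rintro rfl
    rw [zero_smul, add_zero, EmbeddingLike.apply_eq_iff_eq, add_eq_left,
      smul_eq_zero, or_iff_right (by norm_num : (2⁻¹ : Q) ≠ 0), add_assoc, add_sub_cancel_left] at hb
    exact hpq (-1) (by rw [neg_one_smul]; exact (neg_eq_of_add_eq_zero_right hb).symm)
  have hσ : f (x + p + q) - f x =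
      (b⁻¹ * (1 - b')) • (f (x + p) - f x) + (b⁻¹ * b') • (f (x + q) - f x) := by
    have : b • (f (x + p + q) - f x) = (1 - b') • (f (x + p) - f x) + b' • (f (x + q) - f x) := by
      rw [← add_right_inj (f x), hb']
      module
    rw [mul_smul, mul_smul, ← smul_add, ← this, smul_smul, inv_mul_cancel₀ hb0, one_smul]
  have h₁ := hf.coeff_eq_one hg hp hpq (by rw [add_right_comm]; exact hσ)
  have h₂ := hf.coeff_eq_one hg hq hqp (hσ.trans (add_comm _ _))
  rw [h₁, h₂, one_smul, one_smul] at hσ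
  rw [← sub_sub_sub_cancel_right _ _ (f x), hσ, add_sub_cancel_left]

end Affine

/-! ### Additivity of bijections that preserve timelike lines -/

section Minkowski

variable {Q : Type} [Field Q] {c : Q}

/-- The polarization of `mink`. -/
def minkB (c : Q) (x y : Fin 4 → Q) : Q := dot (sp x) (sp y) - c * c * (x 0 * y 0)

theorem mink_add_smul (v u : Fin 4 → Q) (N : Q) :
    mink c (v + N • u) = mink c v + 2 * N * minkB c v u + N * N * mink c u := by
  simp only [mink, minkB, dot, sp, Pi.add_apply, Pi.smul_apply, smul_eq_mul]
  ring

theorem mink_smul (a : Q) (u : Fin 4 → Q) : mink c (a • u) = a * a * mink c u := by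
  simp only [mink, dot, sp, Pi.smul_apply, smul_eq_mul]
  ring

theorem mink_neg (u : Fin 4 → Q) : mink c (-u) = mink c u := by
  simp only [mink, dot, sp, Pi.neg_apply]
  ring

theorem mink_zero : mink c (0 : Fin 4 → Q) = 0 := by
  simp [mink, dot, sp]

variable [LinearOrder Q] [IsStrictOrderedRing Q]

theorem exists_timelike_add {u : Fin 4 → Q} (hu : mink c u < 0) (v : Fin 4 → Q) :
    ∃ N₀ : Q, ∀ N, N₀ ≤ N → mink c (v + N • u) < 0 := by
  -- For this bound `N * -mink c u` exceeds the sum of the absolute values of the other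
  -- coefficients. One more factor `N ≥ 1` makes the quadratic term dominate.
  refine ⟨1 + (|mink c v| + 2 * |minkB c v u|) / -mink c u, fun N hN => ?_⟩
  have ha : 0 < -mink c u := by linarith
  have h0 : 0 ≤ (|mink c v| + 2 * |minkB c v u|) / -mink c u := by positivity
  have hN1 : 1 ≤ N := by linarith
  have h : -mink c u + (|mink c v| + 2 * |minkB c v u|) ≤ N * -mink c u := by
    have := mul_le_mul_of_nonneg_right hN ha.le
    rwa [add_mul, one_mul, div_mul_cancel₀ _ ha.ne'] at this
  have h' := mul_le_mul_of_nonneg_left h (by linarith : 0 ≤ N)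
  rw [mink_add_smul]
  have h2 : N * minkB c v u ≤ N * |minkB c v u| :=
    mul_le_mul_of_nonneg_left (le_abs_self _) (by linarith)
  have h3 : |mink c v| ≤ N * |mink c v| := le_mul_of_one_le_left (abs_nonneg _) hN1
  have h4 := le_abs_self (mink c v)
  have h5 : 0 < N * -mink c u := by positivity
  nlinarith

theorem exists_timelike_noncollinear (hc : 0 < c) (q : Fin 4 → Q) :
    ∃ u, mink c u < 0 ∧ ∀ a : Q, u ≠ a • q := by
  by_cases h : sp q = 0
  · refine ⟨![2, c, 0, 0], ?_, fun a e => hc.ne' ?_⟩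
    · simp [mink, dot, sp]
      nlinarith [mul_pos hc hc]
    · have h1 := congrFun e 1
      have h0 : q 1 = 0 := congrFun h 0
      simpa [h0] using h1
  · refine ⟨![1, 0, 0, 0], ?_, fun a e => h ?_⟩
    · simp [mink, dot, sp, hc]
    · have ha : a ≠ 0 := by
        rintro rfl
        simpa using congrFun e 0
      have h1 := congrFun e 1
      have h2 := congrFun e 2
      have h3 := congrFun e 3
      simp [ha] at h1 h2 h3
      funext i
      fin_cases i <;> simp [sp, h1, h2, h3]

/-- The base points `x` and `x + v` are both compared with the remote point `x - N • u`. For large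
`N` all sides and diagonals of the two parallelograms involved are timelike, so both increments
along `q` equal the one at the remote point. -/
theorem exists_add_const_of_timelike (hc : 0 < c) {f : (Fin 4 → Q) ≃ (Fin 4 → Q)}
    (hf : MapsLines (Q := Q) (fun d => mink c d < 0) f)
    (hg : MapsLines (Q := Q) (fun d => mink c d < 0) f.symm)
    {q : Fin 4 → Q} (hq : mink c q < 0) (x v : Fin 4 → Q) :
    f (x + v + q) - f (x + v) = f (x + q) - f x := by
  have swap : ∀ {p : Fin 4 → Q}, (∀ a : Q, p ≠ a • q) → ∀ a : Q, q ≠ a • p := by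
    rintro p hp a e
    have ha : a ≠ 0 := by
      rintro rfl
      rw [e, zero_smul, mink_zero] at hq
      exact lt_irrefl _ hq
    exact hp a⁻¹ (by rw [e, smul_smul, inv_mul_cancel₀ ha, one_smul])
  have good : ∀ (x p : Fin 4 → Q), (∀ a : Q, p ≠ a • q) → mink c p < 0 → mink c (q + p) < 0 →
      mink c (-q + p) < 0 → f (x + p + q) - f (x + p) = f (x + q) - f x := fun x p h h₁ h₂ h₃ =>
    hf.parallelogram hg h₁ hq (by rwa [add_comm]) (by rwa [← mink_neg, neg_sub, sub_eq_neg_add])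
      (swap h) h
  obtain ⟨u, hu, huq⟩ := exists_timelike_noncollinear hc q
  obtain ⟨N₁, h₁⟩ := exists_timelike_add hu q
  obtain ⟨N₂, h₂⟩ := exists_timelike_add hu (-q)
  obtain ⟨N₃, h₃⟩ := exists_timelike_add hu v
  obtain ⟨N₄, h₄⟩ := exists_timelike_add hu (q + v)
  obtain ⟨N₅, h₅⟩ := exists_timelike_add hu (-q + v)
  obtain ⟨N₀, h₀⟩ : ∃ N₀, 1 ≤ N₀ ∧ N₁ ≤ N₀ ∧ N₂ ≤ N₀ ∧ N₃ ≤ N₀ ∧ N₄ ≤ N₀ ∧ N₅ ≤ N₀ := by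
    refine ⟨max 1 (max N₁ (max N₂ (max N₃ (max N₄ N₅)))), ?_⟩
    simp only [le_max_iff, le_refl, true_or, or_true, and_self]
  -- As `u` is not a multiple of `q`, collinearity with `q` can occur for at most one `N`; so `N₀`
  -- or `N₀ + 1` works.
  obtain ⟨N, hN, hv⟩ : ∃ N, N₀ ≤ N ∧ ∀ a : Q, v + N • u ≠ a • q := by
    by_cases h : ∃ a : Q, v + N₀ • u = a • q
    · obtain ⟨a, ha⟩ := h
      refine ⟨N₀ + 1, by linarith, fun b hb => huq (b - a) ?_⟩
      rw [sub_smul, ← hb, ← ha]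
      module
    · push Not at h
      exact ⟨N₀, le_rfl, h⟩
  have hN0 : N ≠ 0 := by linarith [h₀.1]
  have step := good (x - N • u) (v + N • u) hv (h₃ N (by linarith))
    (by rw [← add_assoc]; exact h₄ N (by linarith)) (by rw [← add_assoc]; exact h₅ N (by linarith))
  have step' := good (x - N • u) (N • u) (fun a e => huq (N⁻¹ * a) (by
      rw [mul_smul, ← e, smul_smul, inv_mul_cancel₀ hN0, one_smul]))
    (by rw [mink_smul]; exact mul_neg_of_pos_of_neg (mul_self_pos.2 hN0) hu)
    (h₁ N (by linarith)) (h₂ N (by linarith))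
  have e : x - N • u + (v + N • u) = x + v := by module
  rw [e] at step
  rw [sub_add_cancel] at step'
  rw [step, step']

/-- Every vector is a difference `(y + w) - w` of timelike ones. Homogeneity is not claimed: a field
automorphism acting on the coordinates is excluded only later, by AxSymD. -/
theorem exists_add_const (hc : 0 < c) {f : (Fin 4 → Q) ≃ (Fin 4 → Q)}
    (hf : MapsLines (Q := Q) (fun d => mink c d < 0) f)
    (hg : MapsLines (Q := Q) (fun d => mink c d < 0) f.symm) (x y : Fin 4 → Q) :
    f (x + y) - f x = f y - f 0 := by
  have key : ∀ q, mink c q < 0 → ∀ x, f (x + q) = f x + (f q - f 0) := fun q hq x => by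
    have := exists_add_const_of_timelike hc hf hg hq 0 x
    rw [zero_add, zero_add] at this
    rw [← this]
    abel
  obtain ⟨u, hu, -⟩ : ∃ u : Fin 4 → Q, mink c u < 0 ∧ True :=
    ⟨![1, 0, 0, 0], by simp [mink, dot, sp, hc], trivial⟩
  obtain ⟨N, hN⟩ := exists_timelike_add hu y
  have h₁ := hN (max N 1) (le_max_left _ _)
  have h₂ : mink c (max N 1 • u) < 0 := by
    have : 0 < max N 1 := lt_max_of_lt_right one_pos
    rw [mink_smul]
    exact mul_neg_of_pos_of_neg (by positivity) hu
  set w := max N 1 • u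
  have e : ∀ x, f (x + y) = f x + ((f (y + w) - f 0) - (f w - f 0)) := fun x => by
    have a := key _ h₁ x
    have b := key _ h₂ (x + y)
    rw [add_assoc, a] at b
    rw [eq_sub_of_add_eq b.symm]
    abel
  have e0 := e 0
  rw [zero_add] at e0
  rw [e x, e0]
  abel

end Minkowski

/-! ### Worldviews in special relativity -/

section Lorentz

variable {Q : Type} [Field Q]

theorem dot_add_left (u v w : Fin 3 → Q) : dot (u + v) w = dot u w + dot v w := by
  simp only [dot, Pi.add_apply]; ring

theorem dot_smul_left (a : Q) (u v : Fin 3 → Q) : dot (a • u) v = a * dot u v := by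
  simp only [dot, Pi.smul_apply, smul_eq_mul]; ring

theorem dot_sub_left (u v w : Fin 3 → Q) : dot (u - v) w = dot u w - dot v w := by
  simp only [dot, Pi.sub_apply]; ring

theorem dot_add_self (u v : Fin 3 → Q) :
    dot (u + v) (u + v) = dot u u + 2 * dot u v + dot v v := by
  simp only [dot, Pi.add_apply]; ring

theorem sp_add (x y : Fin 4 → Q) : sp (x + y) = sp x + sp y := rfl

theorem sp_sub (x y : Fin 4 → Q) : sp (x - y) = sp x - sp y := rfl

theorem sp_smul (a : Q) (x : Fin 4 → Q) : sp (a • x) = a • sp x := rfl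

theorem mink_cons (c t : Q) (s : Fin 3 → Q) :
    mink c (Fin.cons t s) = dot s s - c * c * (t * t) := rfl

/-- The Lorentz boost that maps the time axis to the direction `(1, v)`. -/
def boost (c s : Q) (v : Fin 3 → Q) (x : Fin 4 → Q) : Fin 4 → Q :=
  Fin.cons (x 0 / s + dot v (sp x) / (c * c * s))
    (sp x + (x 0 / s + dot v (sp x) / (c * c * s * (1 + s))) • v)

theorem boost_add (c s : Q) (v : Fin 3 → Q) (x y : Fin 4 → Q) :
    boost c s v (x + y) = boost c s v x + boost c s v y := by
  have h : dot v (sp x + sp y) = dot v (sp x) + dot v (sp y) := by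
    rw [dot_comm, dot_add_left, dot_comm _ v, dot_comm _ v]
  funext i
  refine Fin.cases ?_ (fun i => ?_) i
  · simp only [boost, Fin.cons_zero, Pi.add_apply, sp_add, h]; ring
  · simp only [boost, Fin.cons_succ, Pi.add_apply, h, sp_add, Pi.smul_apply, smul_eq_mul]; ring

variable [LinearOrder Q] [EuclideanField Q] {c s : Q} {v : Fin 3 → Q}

theorem dot_self_eq_zero {v : Fin 3 → Q} : dot v v = 0 ↔ v = 0 := by
  refine ⟨fun h => ?_, fun h => by simp [h, dot]⟩
  simp only [dot] at h
  have h0 := mul_self_nonneg (v 0)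
  have h1 := mul_self_nonneg (v 1)
  have h2 := mul_self_nonneg (v 2)
  have e0 : v 0 = 0 := mul_self_eq_zero.1 (by linarith)
  have e1 : v 1 = 0 := mul_self_eq_zero.1 (by linarith)
  have e2 : v 2 = 0 := mul_self_eq_zero.1 (by linarith)
  funext i
  fin_cases i
  exacts [e0, e1, e2]

theorem mink_boost (hc : 0 < c) (hs : IsFactor c v s) (x : Fin 4 → Q) :
    mink c (boost c s v x) = mink c x := by
  obtain ⟨hs, h⟩ := hs
  have h1 : 1 + s ≠ 0 := by positivity
  have hv : dot v v = c * c - c * c * (s * s) := by linear_combination h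
  rw [boost, mink_cons, dot_add_self, dot_comm _ (_ • v), dot_smul_left, dot_smul_left,
    dot_comm v (_ • v), dot_smul_left, hv, mink]
  field_simp
  ring

/-- The key identity: radarization first shears the velocity `v` away as in Galilean kinematics and
then boosts. Since the worldview transformation to the ether undoes the boost, only the Galilean
part survives. -/
theorem rad_eq_boost (hc : 0 < c) (hs : IsFactor c v s) (x : Fin 4 → Q) :
    rad c s v x = boost c s v (Fin.cons (x 0) (sp x - x 0 • v)) := by
  obtain ⟨hs, h⟩ := hs
  have h1 : 1 + s ≠ 0 := by positivity
  have hv : dot v v = c * c - c * c * (s * s) := by linear_combination h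
  have e : dot v (sp x - x 0 • v) = dot v (sp x) - x 0 * (c * c - c * c * (s * s)) := by
    rw [dot_comm, dot_sub_left, dot_smul_left, hv, dot_comm]
  simp only [rad, boost, Fin.cons_zero, sp_cons, e]
  funext i
  refine Fin.cases ?_ (fun i => ?_) i
  · simp only [Fin.cons_zero]
    field_simp
    ring
  · simp only [Fin.cons_succ, Pi.add_apply, Pi.sub_apply, Pi.smul_apply, smul_eq_mul]
    field_simp
    ring

theorem boost_axis (t : Q) : boost c s v (Fin.cons t 0) = (t / s) • Fin.cons 1 v := by
  funext i
  refine Fin.cases ?_ (fun i => ?_) i <;> simp [boost, sp_cons, dot]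

/-- These are the events simultaneous with the origin before and after the boost, to which AxSymD
can be applied. -/
theorem boost_orthogonal {σ : Fin 3 → Q} (h : dot v σ = 0) :
    boost c s v (Fin.cons 0 σ) = Fin.cons 0 σ := by
  simp [boost, sp_cons, h]

theorem exists_isFactor (hc : 0 < c) (h : dot v v < c * c) : ∃ s, IsFactor c v s := by
  obtain ⟨s, hs, e⟩ := exists_sqrt (a := (c * c - dot v v) / (c * c))
    (div_nonneg (by linarith) (by positivity))
  have hs0 : 0 < s * s := by
    rw [e]
    exact div_pos (by linarith) (by positivity)
  refine ⟨s, hs.lt_of_ne' (by rintro rfl; simp at hs0), ?_⟩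
  rw [e, mul_div_cancel₀ _ (by positivity)]
  ring

/-- There is a spatial vector of any given length that is orthogonal to `v`. -/
theorem exists_orthogonal (v : Fin 3 → Q) (r : Q) : ∃ σ, dot v σ = 0 ∧ dot σ σ = r * r := by
  obtain ⟨u, hu, h⟩ : ∃ u, dot v u = 0 ∧ 0 < dot u u := by
    by_cases hv : v 0 = 0 ∧ v 1 = 0
    · exact ⟨![1, 0, 0], by simp [dot, hv], by simp [dot]⟩
    · refine ⟨![-v 1, v 0, 0], by simp [dot]; ring, ?_⟩
      refine (dot_self_nonneg _).lt_of_ne' fun h => hv ?_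
      have h0 := congrFun (dot_self_eq_zero.1 h) 0
      have h1 := congrFun (dot_self_eq_zero.1 h) 1
      simp at h0 h1
      exact ⟨h1, h0⟩
  obtain ⟨l, hl, e⟩ := exists_sqrt h.le
  have hl0 : l ≠ 0 := by
    rintro rfl
    simp [← e] at h
  refine ⟨(r / l) • u, ?_, ?_⟩
  · rw [dot_comm, dot_smul_left, dot_comm, hu, mul_zero]
  · rw [dot_smul_left, dot_comm, dot_smul_left, ← e]
    field_simp

/-- An additive map that preserves light cones and the time axis, and lengths on a plane, is a
trivial transformation up to time reversal. -/
theorem exists_orth_of_axis (hc : 0 < c) (g : (Fin 4 → Q) → Fin 4 → Q)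
    (hadd : ∀ x y, g (x + y) = g x + g y) (hnull : ∀ x, mink c x = 0 → mink c (g x) = 0)
    (haxis : ∀ t, sp (g (Fin.cons t 0)) = 0) (hinj : ∀ t, g (Fin.cons t 0) = 0 → t = 0)
    (v : Fin 3 → Q) (hplane : ∀ σ, dot v σ = 0 → g (Fin.cons 0 σ) 0 = 0 →
      dot (sp (g (Fin.cons 0 σ))) (sp (g (Fin.cons 0 σ))) = dot σ σ) :
    ∃ (ε : Q) (A : Fin 3 → Fin 3 → Q), ε * ε = 1 ∧ Orth A ∧
      ∀ x, g x = Fin.cons (ε * x 0) (appl A (sp x)) := by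
  obtain ⟨φ, hφ⟩ : ∃ φ : Q → Q, ∀ t, φ t = g (Fin.cons t 0) 0 := ⟨_, fun _ => rfl⟩
  obtain ⟨ψ, hψ⟩ : ∃ ψ : (Fin 3 → Q) → Fin 3 → Q, ∀ σ, ψ σ = sp (g (Fin.cons 0 σ)) :=
    ⟨_, fun _ => rfl⟩
  have gt : ∀ t, g (Fin.cons t 0) = Fin.cons (φ t) 0 := fun t => by
    rw [← cons_sp (g _), haxis, hφ]
  have φadd : ∀ a b, φ (a + b) = φ a + φ b := fun a b => by
    have : (Fin.cons (a + b) 0 : Fin 4 → Q) = Fin.cons a 0 + Fin.cons b 0 := by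
      funext i; refine Fin.cases ?_ (fun i => ?_) i <;> simp
    rw [hφ, this, hadd, Pi.add_apply, ← hφ, ← hφ]
  have φ0 : φ 0 = 0 := by simpa using φadd 0 0
  have φneg : ∀ a, φ (-a) = -φ a := fun a => by
    rw [eq_neg_iff_add_eq_zero, ← φadd, neg_add_cancel, φ0]
  have φne : ∀ r, φ r = 0 → r = 0 := fun r h => hinj r (by
    rw [gt, h]; funext i; refine Fin.cases ?_ (fun i => ?_) i <;> rfl)
  have ψadd : ∀ a b, ψ (a + b) = ψ a + ψ b := fun a b => by
    have : (Fin.cons 0 (a + b) : Fin 4 → Q) = Fin.cons 0 a + Fin.cons 0 b := by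
      funext i; refine Fin.cases ?_ (fun i => ?_) i <;> simp
    rw [hψ, this, hadd, sp_add, ← hψ, ← hψ]
  have split : ∀ t (σ : Fin 3 → Q),
      (Fin.cons t σ : Fin 4 → Q) = Fin.cons t 0 + Fin.cons 0 σ := by
    intro t σ
    funext i; refine Fin.cases ?_ (fun i => ?_) i <;> simp
  have g0 : g 0 = 0 := by simpa using hadd 0 0
  -- Both `(r, σ)` and `(-r, σ)` are null, as are their images. The difference of the two equations
  -- shows that `g` gives `(0, σ)` no time component.
  have radar : ∀ σ r, dot σ σ = c * c * (r * r) →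
      g (Fin.cons 0 σ) 0 = 0 ∧ dot (ψ σ) (ψ σ) = c * c * (φ r * φ r) := by
    intro σ r h
    have null : ∀ r, dot σ σ = c * c * (r * r) →
        dot (ψ σ) (ψ σ) = c * c * ((φ r + g (Fin.cons 0 σ) 0) * (φ r + g (Fin.cons 0 σ) 0)) := by
      intro r h
      have := hnull (Fin.cons r σ) (by rw [mink_cons, h, sub_self])
      rwa [split, hadd, gt, mink, sp_add, sp_cons, zero_add, ← hψ, sub_eq_zero] at this
    have h₁ := null r h
    have h₂ := null (-r) (by rw [h, neg_mul_neg])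
    rw [φneg] at h₂
    have h₃ : φ r * g (Fin.cons 0 σ) 0 = 0 := by
      have : (c * c * 4) * (φ r * g (Fin.cons 0 σ) 0) = 0 := by linear_combination h₂ - h₁
      exact (mul_eq_zero.1 this).resolve_left (by positivity)
    have h₄ : g (Fin.cons 0 σ) 0 = 0 := by
      rcases mul_eq_zero.1 h₃ with h₃ | h₃
      · rw [φne r h₃, mul_zero, mul_zero, dot_self_eq_zero] at h
        have : (Fin.cons 0 σ : Fin 4 → Q) = 0 := by
          rw [h]; funext i; refine Fin.cases ?_ (fun i => ?_) i <;> rfl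
        rw [this, g0]; rfl
      · exact h₃
    rw [h₄, add_zero] at h₁
    exact ⟨h₄, h₁⟩
  -- A vector orthogonal to `v` of length `c |r|` keeps its length, and the light cone transfers
  -- this to the time `r`.
  have φsq : ∀ r, φ r * φ r = r * r := by
    intro r
    obtain ⟨σ, hσ, e⟩ := exists_orthogonal v (c * r)
    obtain ⟨h₁, h₂⟩ := radar σ r (by rw [e]; ring)
    have h₃ := hplane σ hσ h₁
    rw [← hψ, h₂, e] at h₃
    refine mul_left_cancel₀ (a := c * c) (by positivity) ?_
    rw [h₃]; ring
  -- Polarizing `φ(r)² = r²` at `1` and `r` gives `φ(1) φ(r) = r`; with `φ(1)² = 1` this is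
  -- linearity, which excludes field automorphisms.
  have φlin : ∀ r, φ r = φ 1 * r := by
    intro r
    have h₁ := φsq 1
    have h₂ := φsq r
    have h₃ := φsq (1 + r)
    rw [φadd] at h₃
    linear_combination φ 1 * (h₃ - h₁ - h₂) / 2 - φ r * h₁
  have rad_exists : ∀ σ : Fin 3 → Q, ∃ r, dot σ σ = c * c * (r * r) := fun σ => by
    obtain ⟨l, -, e⟩ := exists_sqrt (dot_self_nonneg σ)
    exact ⟨l / c, by rw [← e]; field_simp⟩
  have ψsq : ∀ σ, dot (ψ σ) (ψ σ) = dot σ σ := fun σ => by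
    obtain ⟨r, hr⟩ := rad_exists σ
    rw [(radar σ r hr).2, φsq, hr]
  have ψdot : ∀ σ τ, dot (ψ σ) (ψ τ) = dot σ τ := fun σ τ => by
    have := ψsq (σ + τ)
    rw [ψadd, dot_add_self, dot_add_self, ψsq, ψsq] at this
    linarith
  -- Homogeneity follows from the preserved scalar product: the difference of both sides has length
  -- zero.
  have ψsmul : ∀ (a : Q) σ, ψ (a • σ) = a • ψ σ := fun a σ => by
    rw [← sub_eq_zero, ← dot_self_eq_zero]
    have : dot (ψ (a • σ) - a • ψ σ) (ψ (a • σ) - a • ψ σ) = dot (ψ (a • σ)) (ψ (a • σ)) -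
        2 * a * dot (ψ (a • σ)) (ψ σ) + a * a * dot (ψ σ) (ψ σ) := by
      simp only [dot, Pi.sub_apply, Pi.smul_apply, smul_eq_mul]; ring
    rw [this, ψdot, ψdot, ψdot, dot_smul_left, dot_smul_left, dot_comm σ, dot_smul_left]
    ring
  let b : Fin 3 → Fin 3 → Q := fun j i => if i = j then 1 else 0
  refine ⟨φ 1, fun i j => ψ (b j) i, by rw [φsq, one_mul], fun i j => ?_, fun x => ?_⟩
  · have := ψdot (b i) (b j)
    simp only [dot] at this
    rw [this]
    fin_cases i <;> fin_cases j <;> simp [b]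
  · have decomp : sp x = sp x 0 • b 0 + sp x 1 • b 1 + sp x 2 • b 2 := by
      funext i
      fin_cases i <;> simp [b]
    obtain ⟨r, hr⟩ := rad_exists (sp x)
    have hx : g (Fin.cons 0 (sp x)) = Fin.cons 0 (ψ (sp x)) := by
      rw [← cons_sp (g _), (radar _ r hr).1, hψ]
    have hA : appl (fun i j => ψ (b j) i) (sp x) = ψ (sp x) := by
      conv_rhs => rw [decomp, ψadd, ψadd, ψsmul, ψsmul, ψsmul]
      funext i
      simp only [appl, Pi.add_apply, Pi.smul_apply, smul_eq_mul]
      ring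
    rw [hA, ← φlin, ← cons_sp x, split, hadd, gt, sp_add, sp_cons, sp_cons, hx]
    funext i; refine Fin.cases ?_ (fun i => ?_) i <;> simp

end Lorentz

/-- The axioms of special relativity, in a model over a Euclidean field. -/
structure Model.SpecRel {X B Q : Type} [Field Q] [LinearOrder Q] [EuclideanField Q]
    (M : Model X B Q) (c : Q) : Prop where
  c_pos : 0 < c
  light : ∀ k, M.iob k → M.LightSpeed c k
  exists_observer : ∀ k, M.iob k → ∀ x y, mink c (x - y) < 0 → ∃ h, M.iob h ∧ M.W k h x ∧ M.W k h y
  ev : ∀ k h, M.iob k → M.iob h → ∀ x, ∃ y, ∀ b, M.W k b x ↔ M.W h b y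
  self : ∀ k, M.iob k → ∀ x, M.W k k x ↔ sp x = 0
  symD : ∀ k h, M.iob k → M.iob h → ∀ x y x' y', x 0 = y 0 → x' 0 = y' 0 →
    (∀ b, M.W k b x ↔ M.W h b x') → (∀ b, M.W k b y ↔ M.W h b y') →
    dot (sp (x - y)) (sp (x - y)) = dot (sp (x' - y')) (sp (x' - y'))
  line : ∀ k h, M.iob k → M.iob h → ∀ x y z, M.W k h x → M.W k h y → M.W k h z →
    ∃ a : Q, z + a • x = x + a • y ∨ y + a • x = z + a • z
  triv : ∀ (A : Fin 3 → Fin 3 → Q) (z : Fin 4 → Q), Orth A → ∀ k, M.iob k →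
    ∃ h, M.iob h ∧ M.WorldviewIs k h A z
  noAcc : ∀ k b x, M.W k b x → M.iob k

/-! ### Worldlines and worldview transformations between inertial observers -/

namespace Model.SpecRel

variable {X B Q : Type} [Field Q] [LinearOrder Q] [EuclideanField Q] {M : Model X B Q} {c : Q}

/-- Points with the same bodies have the same light cone. Hence `d = x - y` is null, and so is its
time reflection `(-d₀, d⃗)`. Attached to `x`, the latter ends at the point `y + (0, 2 d⃗)`, which
must lie on the cone of `y`; this forces `d⃗ = 0` and then `d₀ = 0`. -/
theorem event_injective (hM : M.SpecRel c) {k : B} (hk : M.iob k) {x y : Fin 4 → Q}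
    (h : ∀ b, M.W k b x ↔ M.W k b y) : x = y := by
  have key : ∀ w, mink c (w - x) = 0 → mink c (w - y) = 0 := fun w hw => by
    obtain ⟨p, hp, hpw, hpx⟩ := (hM.light k hk w x).2 hw
    exact (hM.light k hk w y).1 ⟨p, hp, hpw, (h p).1 hpx⟩
  have h₁ := key x (by rw [sub_self, mink_zero])
  have h₂ := key (x + Fin.cons ((x - y) 0) (sp (x - y)))
    (by rw [add_sub_cancel_left, mink_cons]; exact h₁)
  have h₃ := key (x + Fin.cons (-(x - y) 0) (sp (x - y)))
    (by rw [add_sub_cancel_left, mink_cons, neg_mul_neg]; exact h₁)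
  have hc := hM.c_pos
  have hs : dot (sp (x - y)) (sp (x - y)) = 0 := by
    simp only [mink, dot, sp, Pi.sub_apply, Pi.add_apply, Fin.cons_zero, Fin.cons_succ] at h₁ h₃ ⊢
    linear_combination h₃ / 4
  have ht : (x - y) 0 = 0 := by
    rw [mink, hs, zero_sub, neg_eq_zero] at h₁
    exact mul_self_eq_zero.1 ((mul_eq_zero.1 h₁).resolve_left (by positivity))
  exact sub_eq_zero.1 (pt_ext ht (dot_self_eq_zero.1 hs))

theorem exists_worldview (hM : M.SpecRel c) {k h : B} (hk : M.iob k) (hh : M.iob h) :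
    ∃ f : (Fin 4 → Q) ≃ (Fin 4 → Q), ∀ b x, M.W k b x ↔ M.W h b (f x) := by
  choose f hf using hM.ev k h hk hh
  choose g hg using hM.ev h k hh hk
  exact ⟨⟨f, g, fun x => hM.event_injective hk fun b => by rw [← hg, ← hf],
    fun x => hM.event_injective hh fun b => by rw [← hf, ← hg]⟩, fun b x => hf x b⟩

theorem mink_eq_zero_iff (hM : M.SpecRel c) {k h : B} (hk : M.iob k) (hh : M.iob h)
    {f : (Fin 4 → Q) → Fin 4 → Q} (hf : ∀ b x, M.W k b x ↔ M.W h b (f x)) (x y : Fin 4 → Q) :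
    mink c (x - y) = 0 ↔ mink c (f x - f y) = 0 := by
  rw [← hM.light k hk, ← hM.light h hh]
  simp only [hf]

/-- Every event can be reached by light from the worldline of an inertial observer. -/
theorem exists_light_related (hM : M.SpecRel c) {k h : B} (hk : M.iob k) (hh : M.iob h)
    (x : Fin 4 → Q) : ∃ y, M.W k h y ∧ mink c (x - y) = 0 := by
  obtain ⟨f, hf⟩ := hM.exists_worldview hk hh
  obtain ⟨l, -, hl⟩ := exists_sqrt (dot_self_nonneg (sp (f x)))
  have hc := hM.c_pos
  refine ⟨f.symm (Fin.cons (f x 0 - l / c) 0), ?_, ?_⟩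
  · rw [hf, Equiv.apply_symm_apply, hM.self h hh]; rfl
  · rw [hM.mink_eq_zero_iff hk hh hf, Equiv.apply_symm_apply, mink, sp_sub, sp_cons, sub_zero, ← hl,
      Pi.sub_apply, Fin.cons_zero, sub_sub_cancel]
    field_simp
    ring

/-- In the coordinates of `h` both points lie on the time axis, which contains no nonzero null
vector. -/
theorem eq_of_light_related (hM : M.SpecRel c) {k h : B} (hk : M.iob k) (hh : M.iob h)
    {x y : Fin 4 → Q} (hx : M.W k h x) (hy : M.W k h y) (h₀ : mink c (x - y) = 0) : x = y := by
  obtain ⟨f, hf⟩ := hM.exists_worldview hk hh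
  rw [hf, hM.self h hh] at hx hy
  rw [hM.mink_eq_zero_iff hk hh hf, mink, sp_sub, hx, hy, sub_self] at h₀
  have hc := hM.c_pos
  refine f.injective (sub_eq_zero.1 (pt_ext ?_ (by rw [sp_sub, hx, hy, sub_self]; rfl)))
  have h₁ : c * c * ((f x - f y) 0 * (f x - f y) 0) = 0 := by
    simpa [dot] using h₀
  exact mul_self_eq_zero.1 ((mul_eq_zero.1 h₁).resolve_left (by positivity))

theorem exists_two_points (hM : M.SpecRel c) {k h : B} (hk : M.iob k) (hh : M.iob h) :
    ∃ x y, M.W k h x ∧ M.W k h y ∧ x ≠ y := by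
  obtain ⟨f, hf⟩ := hM.exists_worldview hk hh
  refine ⟨f.symm 0, f.symm (Fin.cons 1 0), ?_, ?_, fun e => ?_⟩
  · rw [hf, Equiv.apply_symm_apply, hM.self h hh]; rfl
  · rw [hf, Equiv.apply_symm_apply, hM.self h hh]; rfl
  · exact zero_ne_one (congrFun (f.symm.injective e) 0)

/-- The worldline of an inertial observer is a timelike line. -/
theorem worldline (hM : M.SpecRel c) {k h : B} (hk : M.iob k) (hh : M.iob h) {x y : Fin 4 → Q}
    (hx : M.W k h x) (hy : M.W k h y) (hxy : x ≠ y) :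
    mink c (y - x) < 0 ∧ ∀ z, M.W k h z ↔ ∃ a : Q, z = x + a • (y - x) := by
  have on_line : ∀ z, M.W k h z → ∃ a : Q, z = x + a • (y - x) := by
    intro z hz
    obtain ⟨a, e | e⟩ := hM.line k h hk hh x y z hx hy hz
    · refine ⟨a, ?_⟩
      rw [eq_sub_of_add_eq e]
      module
    · have e' : y - x = (1 + a) • (z - x) := by
        rw [eq_sub_of_add_eq e]
        module
      have ha : 1 + a ≠ 0 := by
        intro ha
        rw [ha, zero_smul] at e'
        exact hxy (sub_eq_zero.1 e').symm
      refine ⟨(1 + a)⁻¹, ?_⟩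
      rw [e', smul_smul, inv_mul_cancel₀ ha, one_smul, add_sub_cancel]
  have not_null : mink c (y - x) ≠ 0 := fun h₀ =>
    hxy (hM.eq_of_light_related hk hh hy hx h₀).symm
  refine ⟨not_null.lt_of_le (not_lt.1 fun hpos => ?_), fun z => ⟨on_line z, ?_⟩⟩
  -- If the direction `d` were spacelike, the separation of `x + (0, σ)` from each point of the
  -- line, with `σ ⊥ d` of unit length, would have the form value `1 + a² · mink c d > 0`, so no
  -- light could connect them.
  · obtain ⟨σ, hσ, e⟩ := exists_orthogonal (sp (y - x)) 1
    obtain ⟨z, hz, h₀⟩ := hM.exists_light_related hk hh (x + Fin.cons 0 σ)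
    obtain ⟨a, rfl⟩ := on_line z hz
    have : x + Fin.cons 0 σ - (x + a • (y - x)) = Fin.cons 0 σ + (-a) • (y - x) := by module
    rw [this, mink_add_smul, minkB, sp_cons, dot_comm, hσ, mink_cons, e, Fin.cons_zero] at h₀
    have := mul_nonneg (mul_self_nonneg (-a)) hpos.le
    linarith
  · rintro ⟨a, rfl⟩
    -- Some point of the worldline is light-related to the given point. Both lie on one line with
    -- non-null direction, so they coincide.
    obtain ⟨z, hz, h₀⟩ := hM.exists_light_related hk hh (x + a • (y - x))
    obtain ⟨b, rfl⟩ := on_line z hz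
    have : x + a • (y - x) - (x + b • (y - x)) = (a - b) • (y - x) := by module
    rw [this, mink_smul] at h₀
    have hab := mul_self_eq_zero.1 ((mul_eq_zero.1 h₀).resolve_right not_null)
    rwa [sub_eq_zero.1 hab]

/-- Each timelike line is the worldline of some inertial observer, and this worldline is a timelike
line in the other worldview too. -/
theorem mapsLines (hM : M.SpecRel c) {k h : B} (hk : M.iob k) (hh : M.iob h)
    {f : (Fin 4 → Q) → Fin 4 → Q} (hinj : f.Injective) (hf : ∀ b x, M.W k b x ↔ M.W h b (f x)) :
    MapsLines (Q := Q) (fun d => mink c d < 0) f := by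
  intro x y hxy
  obtain ⟨m, hm, hy, hx⟩ := hM.exists_observer k hk y x hxy
  have ne : x ≠ y := by
    rintro rfl
    rw [sub_self, mink_zero] at hxy
    exact lt_irrefl _ hxy
  obtain ⟨h₁, h₂⟩ := hM.worldline hh hm ((hf m x).1 hx) ((hf m y).1 hy) (hinj.ne ne)
  refine ⟨h₁, fun a => ?_⟩
  rw [← h₂, ← hf, (hM.worldline hk hm hx hy ne).2]
  exact ⟨a, rfl⟩

/-- Every worldview transformation is the composition of the inverse of a boost with a trivial
transformation, up to time reversal. -/
theorem exists_boost (hM : M.SpecRel c) {k e : B} (hk : M.iob k) (he : M.iob e) :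
    ∃ (v : Fin 3 → Q) (s ε : Q) (A : Fin 3 → Fin 3 → Q) (z : Fin 4 → Q),
      IsFactor c v s ∧ ε * ε = 1 ∧ Orth A ∧ ∀ b x, M.W k b (boost c s v x) ↔
        M.W e b (Fin.cons (ε * x 0 + z 0) (appl A (sp x) + sp z)) := by
  have hc := hM.c_pos
  obtain ⟨f, hf⟩ := hM.exists_worldview hk he
  have hf' : ∀ b x, M.W e b x ↔ M.W k b (f.symm x) := fun b x => by
    rw [hf, Equiv.apply_symm_apply]
  have hadd := exists_add_const hc (hM.mapsLines hk he f.injective hf)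
    (hM.mapsLines he hk f.symm.injective hf')
  obtain ⟨x₀, y₀, hx₀, hy₀, hne⟩ := hM.exists_two_points hk he
  obtain ⟨htl, hline⟩ := hM.worldline hk he hx₀ hy₀ hne
  set d := y₀ - x₀
  have hd0 : d 0 ≠ 0 := by
    intro h0
    rw [mink, h0, mul_zero, mul_zero, sub_zero] at htl
    exact (dot_self_nonneg _).not_gt htl
  obtain ⟨δ, hδ⟩ : ∃ δ, δ = d 0 := ⟨_, rfl⟩
  rw [← hδ] at hd0
  obtain ⟨v, hv⟩ : ∃ v : Fin 3 → Q, v = δ⁻¹ • sp d := ⟨_, rfl⟩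
  have hdv : d = δ • Fin.cons 1 v := by
    refine pt_ext (by simp [hδ]) ?_
    rw [sp_smul, sp_cons, hv, smul_smul, mul_inv_cancel₀ hd0, one_smul]
  have hvc : dot v v < c * c := by
    rw [hdv, mink_smul, mink_cons] at htl
    have := (mul_neg_iff.1 htl).resolve_right fun h => (mul_self_nonneg _).not_gt h.1
    linarith [this.2]
  obtain ⟨s, hs⟩ := exists_isFactor hc hvc
  have hs0 := hs.1.ne'
  -- By additivity the increment may be computed from the point `x₀` on the worldline of `e`. Moving
  -- along `(1, v)` stays on it, and `e` sees its own worldline as the time axis.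
  have axis : ∀ a : Q, sp (f (a • Fin.cons 1 v) - f 0) = 0 := fun a => by
    have h₁ : M.W k e (x₀ + a • Fin.cons 1 v) := by
      refine (hline _).2 ⟨a / δ, ?_⟩
      rw [hdv, smul_smul, div_mul_cancel₀ _ hd0]
    rw [hf, hM.self e he] at h₁ hx₀
    rw [← hadd x₀, sp_sub, h₁, hx₀, sub_self]
  obtain ⟨ε, A, hε, hA, hg⟩ := exists_orth_of_axis hc (fun x => f (boost c s v x) - f 0)
    (fun x y => by
      rw [boost_add, eq_add_of_sub_eq (hadd (boost c s v x) (boost c s v y))]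
      abel)
    (fun x hx => by
      rw [← hM.mink_eq_zero_iff hk he hf, sub_zero, mink_boost hc hs, hx])
    (fun t => by rw [boost_axis]; exact axis _)
    (fun t ht => by
      have h₁ := f.injective (sub_eq_zero.1 ht)
      rw [boost_axis] at h₁
      have h₂ := congrFun h₁ 0
      simpa [hs0] using h₂)
    v (fun σ hσ h₀ => by
      rw [boost_orthogonal hσ] at h₀ ⊢
      -- The boost fixes `(0, σ)`, so this event is simultaneous with the origin for `k`; by `h₀` it
      -- is so for `e` as well.
      have := hM.symD k e hk he (Fin.cons 0 σ) 0 _ _ rfl (sub_eq_zero.1 h₀)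
        (fun b => hf b _) (fun b => hf b _)
      rw [sub_zero, sp_cons] at this
      exact this.symm)
  refine ⟨v, s, ε, A, f 0, hs, hε, hA, fun b x => ?_⟩
  rw [hf, ← sub_add_cancel (f (boost c s v x)) (f 0), hg]
  refine iff_of_eq (congrArg _ ?_)
  funext i; refine Fin.cases ?_ (fun i => ?_) i <;> rfl

end Model.SpecRel

/-! ### Classical worldviews -/

section Frames

variable {Q : Type} [Field Q]

/-- The linear part of a Galilean transformation with time reversal. -/
def galLin (ε : Q) (A : Fin 3 → Fin 3 → Q) (v : Fin 3 → Q) (d : Fin 4 → Q) : Fin 4 → Q :=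
  Fin.cons (ε * d 0) (appl A (sp d - d 0 • v))

/-- A Galilean transformation with time reversal. -/
def gal (ε : Q) (A : Fin 3 → Fin 3 → Q) (z : Fin 4 → Q) (v : Fin 3 → Q) (x : Fin 4 → Q) :
    Fin 4 → Q :=
  Fin.cons (ε * x 0 + z 0) (appl A (sp x - x 0 • v) + sp z)

variable {ε : Q} {A : Fin 3 → Fin 3 → Q} {z : Fin 4 → Q} {v : Fin 3 → Q}

theorem gal_eq (x : Fin 4 → Q) : gal ε A z v x = galLin ε A v x + z := by
  funext i; refine Fin.cases ?_ (fun i => ?_) i <;> rfl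

theorem galLin_add (x y : Fin 4 → Q) :
    galLin ε A v (x + y) = galLin ε A v x + galLin ε A v y := by
  have : sp (x + y) - (x + y) 0 • v = (sp x - x 0 • v) + (sp y - y 0 • v) := by
    rw [sp_add, Pi.add_apply]; module
  rw [galLin, this, appl_add]
  funext i; refine Fin.cases ?_ (fun i => ?_) i
  · simp [galLin, mul_add]
  · rfl

theorem galLin_smul (a : Q) (x : Fin 4 → Q) : galLin ε A v (a • x) = a • galLin ε A v x := by
  have : sp (a • x) - (a • x) 0 • v = a • (sp x - x 0 • v) := by
    rw [sp_smul, Pi.smul_apply]; module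
  rw [galLin, this, appl_smul]
  funext i; refine Fin.cases ?_ (fun i => ?_) i
  · simp [galLin]; ring
  · rfl

theorem gal_sub (x y : Fin 4 → Q) :
    gal ε A z v x - gal ε A z v y = galLin ε A v (x - y) := by
  have h := galLin_add (ε := ε) (A := A) (v := v) (x - y) y
  rw [sub_add_cancel] at h
  rw [gal_eq, gal_eq, h]
  abel

theorem galLin_injective (hε : ε * ε = 1) (hA : Orth A) :
    Function.Injective (galLin ε A v) := by
  intro x y h
  have hε0 : ε ≠ 0 := left_ne_zero_of_mul_eq_one hε
  have h0 : x 0 = y 0 := mul_left_cancel₀ hε0 (congrFun h 0)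
  have hs : sp x - x 0 • v = sp y - y 0 • v := hA.injective (congrArg sp h)
  rw [h0] at hs
  exact pt_ext h0 (sub_left_injective hs)

theorem gal_surjective (hε : ε * ε = 1) (hA : Orth A) : Function.Surjective (gal ε A z v) := by
  intro y
  refine ⟨Fin.cons (ε * (y 0 - z 0))
    (appl (fun i j => A j i) (sp y - sp z) + (ε * (y 0 - z 0)) • v), pt_ext ?_ ?_⟩
  · simp only [gal, Fin.cons_zero]
    linear_combination (y 0 - z 0) * hε
  · simp only [gal, sp_cons, Fin.cons_zero]
    rw [add_sub_cancel_right, hA.transpose_appl, sub_add_cancel]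

theorem gal_injective (hε : ε * ε = 1) (hA : Orth A) : Function.Injective (gal ε A z v) := by
  intro x y h
  rw [gal_eq, gal_eq] at h
  exact galLin_injective hε hA (add_right_cancel h)

theorem dot_galLin (hA : Orth A) (d : Fin 4 → Q) :
    dot (sp (galLin ε A v d)) (sp (galLin ε A v d)) =
      dot (sp d - d 0 • v) (sp d - d 0 • v) := hA.dot_appl _ _

theorem triv_injective (hA : Orth A) : Function.Injective (triv A z) := fun _ _ h =>
  pt_ext (add_right_cancel (congrFun h 0)) (hA.injective (add_right_cancel (congrArg sp h)))

theorem triv_surjective (hA : Orth A) : Function.Surjective (triv A z) := fun y =>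
  ⟨Fin.cons (y 0 - z 0) (appl (fun i j => A j i) (sp y - sp z)), pt_ext (sub_add_cancel _ _) (by
    rw [triv, sp_cons, sp_cons, hA.transpose_appl, sub_add_cancel])⟩

/-- The closed form of `rad` uses only scalar products with `v` and multiples of `v`, so it commutes
with rotations when `v` is rotated too. Linearity turns the translation `z` into its radarization.
-/
theorem rad_triv (hA : Orth A) (c s : Q) (x : Fin 4 → Q) :
    rad c s (appl A v) (triv A z x) = triv A (rad c s (appl A v) z) (rad c s v x) := by
  have h : dot (appl A v) (appl A (sp x) + sp z) = dot v (sp x) + dot (appl A v) (sp z) := by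
    rw [dot_comm, dot_add_left, dot_comm, hA.dot_appl, dot_comm (sp z)]
  refine pt_ext ?_ ?_
  · simp only [rad, triv, Fin.cons_zero, sp_cons, h]
    ring
  · simp only [rad, triv, sp_cons, h, appl_add, appl_smul, add_div, add_smul]
    abel

variable [LinearOrder Q] [EuclideanField Q] {c s : Q}

/-- Taking the scalar product of the image with `v` divides `dot v (sp x)` by `s`. If the image is
on the time axis, this product vanishes, and then `rad` does not change the spatial part. -/
theorem sp_rad_eq_zero (hc : 0 < c) (hs : IsFactor c v s) {x : Fin 4 → Q} :
    sp (rad c s v x) = 0 ↔ sp x = 0 := by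
  obtain ⟨hs, hv⟩ := hs
  have h1 : 1 + s ≠ 0 := by positivity
  have hv' : dot v v = c * c - c * c * (s * s) := by linear_combination hv
  rw [rad, sp_cons]
  constructor
  · intro h
    have h₂ : dot (sp x + (dot v (sp x) / (c * c * s * (1 + s))) • v) v = dot v (sp x) / s := by
      rw [dot_add_left, dot_smul_left, hv', dot_comm]
      field_simp
      ring
    rw [h, show dot 0 v = 0 by simp [dot], eq_comm, div_eq_zero_iff, or_iff_left hs.ne'] at h₂
    rwa [h₂, zero_div, zero_smul, add_zero] at h
  · intro h
    rw [h]
    simp [dot]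

theorem IsFactor.unique {s' : Q} (hc : 0 < c) (h : IsFactor c v s) (h' : IsFactor c v s') :
    s' = s := by
  refine (mul_self_inj h'.1.le h.1.le).1 (mul_left_cancel₀ (a := c * c) (by positivity) ?_)
  linear_combination h'.2 - h.2

theorem rad_zero (hc : 0 < c) (h : IsFactor c 0 s) (x : Fin 4 → Q) : rad c s 0 x = x := by
  have h1 : IsFactor c 0 (1 : Q) := ⟨one_pos, by simp [dot]⟩
  rw [h1.unique hc h]
  exact pt_ext (by simp [rad, dot]) (by simp [rad, sp_cons])

end Frames

/-! ### Uniqueness of light speed and velocity, and rotation of velocities -/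

section Velocity

variable {X B Q : Type} [Field Q] [LinearOrder Q] [EuclideanField Q] {M : Model X B Q}

theorem Model.LightSpeed.unique {c c' : Q} {k : B} (hc : 0 < c) (hc' : 0 < c')
    (h : M.LightSpeed c k) (h' : M.LightSpeed c' k) : c' = c := by
  have h₁ : mink c (![1, c, 0, 0] - 0) = 0 := by simp [mink, dot, sp]
  rw [← h, h'] at h₁
  simp [mink, dot, sp] at h₁
  exact ((mul_self_inj hc.le hc'.le).1 (sub_eq_zero.1 h₁)).symm

theorem Model.IsVelocity.of_line {k b : B} {p : Fin 4 → Q} {v : Fin 3 → Q}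
    (h : ∀ z, M.W k b z ↔ ∃ a : Q, z = p + a • Fin.cons 1 v) : M.IsVelocity k b v := by
  refine ⟨⟨p, p + (1 : Q) • Fin.cons 1 v, (h _).2 ⟨0, by simp⟩, (h _).2 ⟨1, rfl⟩, fun e => ?_⟩, ?_⟩
  · have := congrFun e 0
    simp at this
  · intro x y hx hy i
    obtain ⟨a, rfl⟩ := (h _).1 hx
    obtain ⟨b, rfl⟩ := (h _).1 hy
    simp only [Pi.add_apply, Pi.smul_apply, Fin.cons_succ, Fin.cons_zero, smul_eq_mul]
    ring

theorem Model.IsVelocity.unique {k b : B} {v w : Fin 3 → Q} (hv : M.IsVelocity k b v)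
    (hw : M.IsVelocity k b w) : w = v := by
  obtain ⟨⟨x, y, hx, hy, hne⟩, hv⟩ := hv
  have hv := hv x y hx hy
  have hw := hw.2 x y hx hy
  have h0 : y 0 - x 0 ≠ 0 := fun h0 => hne (pt_ext (sub_eq_zero.1 h0).symm (funext fun i => by
    have := hv i
    rw [sub_eq_zero.1 h0] at this
    exact (add_right_cancel this).symm))
  funext i
  exact mul_right_cancel₀ h0 (by linear_combination hv i - hw i)

theorem Model.IsVelocity.triv {k h b : B} {v : Fin 3 → Q} {A : Fin 3 → Fin 3 → Q} {z : Fin 4 → Q}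
    (hA : Orth A) (hW : ∀ x, M.W k b x ↔ M.W h b (triv A z x)) (hv : M.IsVelocity k b v) :
    M.IsVelocity h b (appl A v) := by
  obtain ⟨⟨x, y, hx, hy, hne⟩, hv⟩ := hv
  refine ⟨⟨_, _, (hW x).1 hx, (hW y).1 hy, (triv_injective hA).ne hne⟩, fun X Y hx hy i => ?_⟩
  obtain ⟨x, rfl⟩ := triv_surjective (z := z) hA X
  obtain ⟨y, rfl⟩ := triv_surjective (z := z) hA Y
  have e : sp y + x 0 • v = sp x + y 0 • v := funext fun j => by
    have := hv x y ((hW x).2 hx) ((hW y).2 hy) j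
    simpa [sp, mul_comm] using this
  have e' := congrFun (congrArg (appl A) e) i
  simp only [appl_add, appl_smul, Pi.add_apply, Pi.smul_apply, smul_eq_mul] at e'
  simp only [KinLogic.triv, Fin.cons_succ, Fin.cons_zero, Pi.add_apply]
  linear_combination e'

end Velocity

/-- Special relativity with a primitive ether observer `e`. -/
structure Model.SpecRelE {B Q : Type} [Field Q] [LinearOrder Q] [EuclideanField Q]
    (M : Model Unit B Q) (c : Q) (e : B) : Prop extends M.SpecRel c where
  iob_e : M.iob e
  prim : ∀ k, (M.iob k ∧ ∃ (A : Fin 3 → Fin 3 → Q) (z : Fin 4 → Q),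
    Orth A ∧ M.WorldviewIs e k A z) ↔ M.ext () k

/-! ### The classical worldviews obtained by radarization -/

namespace Model.SpecRelE

variable {B Q : Type} [Field Q] [LinearOrder Q] [EuclideanField Q] {M : Model Unit B Q} {c : Q}
  {e : B}

theorem ext_e (hM : M.SpecRelE c e) : M.ext () e := by
  refine (hM.prim e).1 ⟨hM.iob_e, fun i j => if i = j then 1 else 0, 0, fun i j => ?_, fun x y => ?_⟩
  · fin_cases i <;> fin_cases j <;> simp
  · have : triv (fun i j => if i = j then 1 else 0) 0 x = x := by
      refine pt_ext (add_zero _) ?_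
      rw [triv, sp_cons]
      funext i
      fin_cases i <;> simp [appl, sp]
    rw [this]
    exact ⟨fun h => (hM.event_injective hM.iob_e h).symm, fun h b => by rw [h]⟩

/-- The worldviews of the classical model. -/
structure IsFrame (M : Model Unit B Q) (c : Q) (e k : B) (v : Fin 3 → Q) (s ε : Q)
    (A : Fin 3 → Fin 3 → Q) (z : Fin 4 → Q) : Prop where
  factor : IsFactor c v s
  sq : ε * ε = 1
  orth : Orth A
  vel : M.IsVelocity k e v
  rad_iff : ∀ b x, M.classical.W k b x ↔ M.W k b (rad c s v x)
  gal_iff : ∀ b x, M.classical.W k b x ↔ M.W e b (gal ε A z v x)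

/-- All primitive ether observers are at rest relative to `e` and so have the same velocity `v` for
`k`. The quantifier over them in the translation thus collapses to one radarization, whose boost
cancels against the one in `exists_boost`. -/
theorem exists_isFrame (hM : M.SpecRelE c e) {k : B} (hk : M.iob k) :
    ∃ v s ε A z, IsFrame M c e k v s ε A z := by
  obtain ⟨v, s, ε, A, z, hs, hε, hA, hW⟩ := hM.exists_boost hk hM.iob_e
  have hc := hM.c_pos
  have hs0 := hs.1.ne'
  have vel : ∀ e', M.ext () e' → M.IsVelocity k e' v := by
    intro e' he'
    obtain ⟨hi, A', z', hA', hw⟩ := (hM.prim e').2 he'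
    have hW' : ∀ x, M.W k e' (boost c s v x) ↔ appl A' (appl A (sp x) + sp z) + sp z' = 0 := by
      intro x
      rw [hW, ((hw _ _).2 rfl) e', hM.self e' hi]
      rfl
    -- In boosted coordinates `e'` rests at a fixed place `σ`, found by inverting the two
    -- isometries.
    obtain ⟨σ, hσ⟩ : ∃ σ, appl A' (appl A σ + sp z) + sp z' = 0 := by
      refine ⟨appl (fun i j => A j i) (appl (fun i j => A' j i) (-sp z') - sp z), ?_⟩
      rw [hA.transpose_appl, sub_add_cancel, hA'.transpose_appl, neg_add_cancel]
    have h₁ : M.W k e' (boost c s v (Fin.cons 0 σ)) := (hW' _).2 hσ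
    have h₂ : M.W k e' (boost c s v (Fin.cons 0 σ) + Fin.cons 1 v) := by
      -- A displacement by `(1, v)` is only a lapse of the time `s` in boosted coordinates, so it
      -- does not leave the worldline.
      have : (Fin.cons 1 v : Fin 4 → Q) = boost c s v (Fin.cons s 0) := by
        rw [boost_axis, div_self hs0, one_smul]
      rw [this, ← boost_add, hW']
      have : sp (Fin.cons 0 σ + Fin.cons s 0 : Fin 4 → Q) = σ := by
        rw [sp_add, sp_cons, sp_cons, add_zero]
      rw [this]
      exact hσ
    have hline := (hM.worldline hk hi h₁ h₂ (fun h => by simpa using congrFun h 0)).2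
    rw [add_sub_cancel_left] at hline
    exact .of_line hline
  have rad_iff : ∀ b x, M.classical.W k b x ↔ M.W k b (rad c s v x) := by
    intro b x
    rw [classical_W]
    constructor
    · intro h
      obtain ⟨y, ⟨v', hv', c', ⟨hc', hl⟩, s', hs', rfl⟩, hy⟩ := h e hM.ext_e
      obtain rfl := (vel e hM.ext_e).unique hv'
      obtain rfl := Model.LightSpeed.unique hc hc' (hM.light k hk) (hl k hk)
      rwa [hs.unique hc hs'] at hy
    · exact fun h e' he' =>
        ⟨_, ⟨v, vel e' he', c, ⟨hc, hM.light⟩, s, hs, rfl⟩, h⟩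
  refine ⟨v, s, ε, A, z, hs, hε, hA, vel e hM.ext_e, rad_iff, fun b x => ?_⟩
  rw [rad_iff, rad_eq_boost hc hs, hW]
  rfl

theorem iob_of_classical_W (hM : M.SpecRelE c e) {k b : B} {x : Fin 4 → Q}
    (h : M.classical.W k b x) : M.iob k := by
  rw [classical_W] at h
  obtain ⟨y, -, hy⟩ := h e hM.ext_e
  exact hM.noAcc k b y hy

theorem IsFrame.gal_eq_of_event (hM : M.SpecRelE c e) {k h : B} {v v' : Fin 3 → Q} {s s' ε ε' : Q}
    {A A' : Fin 3 → Fin 3 → Q} {z z' : Fin 4 → Q} (hk : IsFrame M c e k v s ε A z)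
    (hh : IsFrame M c e h v' s' ε' A' z') {x y : Fin 4 → Q}
    (H : ∀ b, M.classical.W k b x ↔ M.classical.W h b y) : gal ε A z v x = gal ε' A' z' v' y :=
  hM.event_injective hM.iob_e fun b => by rw [← hk.gal_iff, ← hh.gal_iff, H]

/-- Galilean transformations shift the sphere of light velocities: `|σ| = c'` must be equivalent to
`|σ - v| = c`. With `v = l • u`, the two points `(l ± c) • u` of the second sphere give `(l + c)² =
c'² = (l - c)²`, whence `l = 0`. -/
theorem IsFrame.of_lightSpeed (hM : M.SpecRelE c e) {k : B} {v : Fin 3 → Q} {s ε : Q}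
    {A : Fin 3 → Fin 3 → Q} {z : Fin 4 → Q} (hk : IsFrame M c e k v s ε A z) {c' : Q}
    (hc' : 0 < c') (hl : M.classical.LightSpeed c' k) : v = 0 ∧ c' = c := by
  have hc := hM.c_pos
  have key : ∀ σ, dot σ σ = c' * c' ↔ dot (σ - v) (σ - v) = c * c := by
    intro σ
    have h₁ := hl (Fin.cons 1 σ) 0
    have h₂ := hM.light e hM.iob_e (gal ε A z v (Fin.cons 1 σ)) (gal ε A z v 0)
    rw [sub_zero, mink_cons, sub_eq_zero, mul_one, mul_one] at h₁
    rw [gal_sub, sub_zero, mink, dot_galLin hk.orth, sp_cons, Fin.cons_zero, one_smul,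
      sub_eq_zero, show galLin ε A v (Fin.cons 1 σ) 0 = ε by simp [galLin], hk.sq, mul_one] at h₂
    rw [← h₁, ← h₂]
    exact exists_congr fun p => and_congr_right fun _ => by rw [hk.gal_iff, hk.gal_iff]
  -- A unit vector along `v`; any unit vector serves if `v = 0`.
  obtain ⟨u, l, hl, hu, rfl⟩ : ∃ (u : Fin 3 → Q) (l : Q), 0 ≤ l ∧ dot u u = 1 ∧ v = l • u := by
    by_cases hv : v = 0
    · exact ⟨![1, 0, 0], 0, le_rfl, by simp [dot], by rw [hv, zero_smul]⟩
    · obtain ⟨l, hl, hll⟩ := exists_sqrt (dot_self_nonneg v)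
      have hl0 : l ≠ 0 := by
        rintro rfl
        exact hv (dot_self_eq_zero.1 (by rw [← hll, mul_zero]))
      refine ⟨l⁻¹ • v, l, hl, ?_, by rw [smul_smul, mul_inv_cancel₀ hl0, one_smul]⟩
      rw [dot_smul_left, dot_comm, dot_smul_left, ← hll]
      field_simp
  have hsq : ∀ a : Q, dot (a • u) (a • u) = a * a := fun a => by
    rw [dot_smul_left, dot_comm, dot_smul_left, hu, mul_one]
  have h₁ := (key ((l + c) • u)).2 (by rw [← sub_smul, hsq]; ring)
  have h₂ := (key ((l - c) • u)).2 (by rw [← sub_smul, hsq]; ring)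
  rw [hsq] at h₁ h₂
  have hl0 : l = 0 := by
    have : l * (c * 4) = 0 := by linear_combination h₁ - h₂
    exact (mul_eq_zero.1 this).resolve_right (by positivity)
  refine ⟨by rw [hl0, zero_smul], (mul_self_inj hc'.le hc.le).1 ?_⟩
  rw [← h₁, hl0, zero_add]

theorem IsFrame.classical_W_of_rest (hM : M.SpecRelE c e) {k : B} {s ε : Q}
    {A : Fin 3 → Fin 3 → Q} {z : Fin 4 → Q} (hk : IsFrame M c e k 0 s ε A z) (b : B)
    (x : Fin 4 → Q) : M.classical.W k b x ↔ M.W k b x := by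
  rw [hk.rad_iff, rad_zero hM.c_pos hk.factor]

/-- Isotropic light forces rest relative to `e`, where radarization is the identity. Conversely, an
unchanged worldview inherits the relativistic light speed. On ether observers the two models agree,
so statements about them can be read in special relativity. -/
theorem ether_iff (hM : M.SpecRelE c e) {k : B} :
    M.classical.Ether k ↔ M.iob k ∧ ∀ b x, M.classical.W k b x ↔ M.W k b x := by
  refine and_congr_right fun hk => ⟨?_, fun h => ⟨c, hM.c_pos, fun x y => ?_⟩⟩
  · rintro ⟨c', hc', hl⟩
    obtain ⟨v, s, ε, A, z, hf⟩ := hM.exists_isFrame hk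
    obtain ⟨rfl, -⟩ := hf.of_lightSpeed hM hc' hl
    exact hf.classical_W_of_rest hM
  · simp only [h]
    exact hM.light k hk x y

theorem lightSpeed_of_ether (hM : M.SpecRelE c e) {k : B} (hk : M.classical.Ether k) :
    M.classical.LightSpeed c k := by
  obtain ⟨hi, h⟩ := hM.ether_iff.1 hk
  intro x y
  simp only [h]
  exact hM.light k hi x y

theorem ether_e (hM : M.SpecRelE c e) : M.classical.Ether e := by
  obtain ⟨v, s, ε, A, z, hf⟩ := hM.exists_isFrame hM.iob_e
  have rest : M.IsVelocity e e 0 := by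
    refine ⟨hM.exists_two_points hM.iob_e hM.iob_e, fun x y hx hy i => ?_⟩
    rw [hM.self e hM.iob_e] at hx hy
    have := congrFun (hx.trans hy.symm) i
    simpa [sp] using this.symm
  obtain rfl := rest.unique hf.vel
  exact hM.ether_iff.2 ⟨hM.iob_e, hf.classical_W_of_rest hM⟩

/-! ### The axioms of classical kinematics -/

variable {β : ℕ → B} {κ : ℕ → Q}

theorem sat_classical_AxEv (hM : M.SpecRelE c e) : AxEv.done.Sat M.classical β κ := by
  rw [sat_AxEv]
  intro k h hk hh x
  obtain ⟨v, s, ε, A, z, hf⟩ := hM.exists_isFrame hk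
  obtain ⟨v', s', ε', A', z', hf'⟩ := hM.exists_isFrame hh
  obtain ⟨y, hy⟩ := gal_surjective (v := v') (z := z') hf'.sq hf'.orth (gal ε A z v x)
  exact ⟨y, fun b => by rw [hf.gal_iff, hf'.gal_iff, hy]⟩

theorem sat_classical_AxSelf (hM : M.SpecRelE c e) : AxSelf.done.Sat M.classical β κ := by
  rw [sat_AxSelf]
  intro k hk x
  obtain ⟨v, s, ε, A, z, hf⟩ := hM.exists_isFrame hk
  rw [hf.rad_iff, hM.self k hk, sp_rad_eq_zero hM.c_pos hf.factor]

theorem sat_classical_AxSymD (hM : M.SpecRelE c e) : AxSymD.done.Sat M.classical β κ := by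
  rw [sat_AxSymD]
  intro k h hk hh x y x' y' h₁ h₂ H₁ H₂
  obtain ⟨v, s, ε, A, z, hf⟩ := hM.exists_isFrame hk
  obtain ⟨v', s', ε', A', z', hf'⟩ := hM.exists_isFrame hh
  have e₁ := dot_galLin (ε := ε) (v := v) hf.orth (x - y)
  have e₂ := dot_galLin (ε := ε') (v := v') hf'.orth (x' - y')
  rw [Pi.sub_apply, h₁, sub_self, zero_smul, sub_zero] at e₁
  rw [Pi.sub_apply, h₂, sub_self, zero_smul, sub_zero] at e₂
  rw [← e₁, ← e₂, ← gal_sub (z := z), ← gal_sub (z := z'), hf.gal_eq_of_event hM hf' H₁,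
    hf.gal_eq_of_event hM hf' H₂]

theorem sat_classical_AxAbsTime (hM : M.SpecRelE c e) : AxAbsTime.done.Sat M.classical β κ := by
  rw [sat_AxAbsTime]
  intro k h hk hh x y x' y' H₁ H₂
  obtain ⟨v, s, ε, A, z, hf⟩ := hM.exists_isFrame hk
  obtain ⟨v', s', ε', A', z', hf'⟩ := hM.exists_isFrame hh
  have abs_one : ∀ ε : Q, ε * ε = 1 → |ε| = 1 := fun ε h => by
    rcases mul_self_eq_one_iff.1 h with rfl | rfl <;> simp
  have key : ∀ (ε : Q) A v (d : Fin 4 → Q), ε * ε = 1 → |galLin ε A v d 0| = |d 0| :=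
    fun ε A v d hε => by
      rw [galLin, Fin.cons_zero, abs_mul, abs_one ε hε, one_mul]
  refine (key ε A v (x - y) hf.sq).symm.trans (Eq.trans ?_ (key ε' A' v' (x' - y') hf'.sq))
  rw [← gal_sub (z := z), ← gal_sub (z := z'), hf.gal_eq_of_event hM hf' H₁,
    hf.gal_eq_of_event hM hf' H₂]

theorem sat_classical_AxLine (hM : M.SpecRelE c e) : AxLine.done.Sat M.classical β κ := by
  rw [sat_AxLine]
  intro k h hk hh x y z hx hy hz
  obtain ⟨v, s, ε, A, w, hf⟩ := hM.exists_isFrame hk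
  rw [hf.gal_iff] at hx hy hz
  obtain ⟨a, ha⟩ := hM.line e h hM.iob_e hh _ _ _ hx hy hz
  refine ⟨a, ?_⟩
  have inj := galLin_injective (v := v) hf.sq hf.orth
  simp only [gal_eq] at ha
  refine ha.imp (fun ha => inj ?_) fun ha => inj ?_ <;>
  -- In both alternatives each side has total weight `1 + a`, so the translation contributes `(1 +
  -- a) • w` to each and cancels.
  · rw [galLin_add, galLin_add, galLin_smul, galLin_smul, ← add_left_inj ((1 + a) • w)]
    refine Eq.trans ?_ (ha.trans ?_) <;> module

theorem sat_classical_AxTriv (hM : M.SpecRelE c e) : AxTriv.done.Sat M.classical β κ := by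
  rw [sat_AxTriv]
  intro A z hA k hk
  obtain ⟨v, s, ε, A₁, z₁, hf⟩ := hM.exists_isFrame hk
  -- The translation is radarized in advance, for the rotated velocity `appl A v` that the ether has
  -- for the new observer, so that `rad_triv` returns the prescribed `z`.
  obtain ⟨h, hh, hw⟩ := hM.triv A (rad c s (appl A v) z) hA k hk
  obtain ⟨v', s', ε', A₂, z₂, hf'⟩ := hM.exists_isFrame hh
  have hW : ∀ x b, M.W k b x ↔ M.W h b (KinLogic.triv A (rad c s (appl A v) z) x) :=
    fun x => (hw x _).2 rfl
  obtain rfl := (hf.vel.triv hA fun x => hW x e).unique hf'.vel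
  have hfac : IsFactor c (appl A v) s := ⟨hf.factor.1, by rw [hA.dot_appl]; exact hf.factor.2⟩
  obtain rfl := hfac.unique hM.c_pos hf'.factor
  have key : ∀ x b, M.classical.W k b x ↔ M.classical.W h b (KinLogic.triv A z x) := fun x b => by
    rw [hf.rad_iff, hf'.rad_iff, rad_triv hA, hW]
  refine ⟨h, hh, fun x y => ⟨fun H => ?_, fun H b => by rw [H, key]⟩⟩
  exact gal_injective hf'.sq hf'.orth
    (hf'.gal_eq_of_event hM hf' fun b => by rw [← key, H])

theorem sat_classical_AxNoAcc (hM : M.SpecRelE c e) : AxNoAcc.done.Sat M.classical β κ :=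
  sat_AxNoAcc.2 fun _ _ _ h => hM.iob_of_classical_W h

theorem sat_classical_AxEther (hM : M.SpecRelE c e) : AxEther.done.Sat M.classical β κ :=
  sat_AxEther.2 ⟨e, hM.ether_e⟩

theorem sat_classical_AxNoFTL (hM : M.SpecRelE c e) : AxNoFTL.done.Sat M.classical β κ := by
  refine sat_AxNoFTL fun k e' hk he' => ?_
  have hc := hM.c_pos
  obtain ⟨hi, hW⟩ := hM.ether_iff.1 he'
  obtain ⟨x, y, hx, hy, hne⟩ := hM.exists_two_points hi hk
  obtain ⟨htl, hline⟩ := hM.worldline hi hk hx hy hne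
  set d := y - x
  have hlt : dot (sp d) (sp d) < c * c * (d 0 * d 0) := sub_neg.1 htl
  have hd0 : 0 < d 0 * d 0 := by
    refine (mul_self_nonneg _).lt_of_ne' fun h => ?_
    rw [h, mul_zero] at hlt
    exact (dot_self_nonneg _).not_gt hlt
  -- The speed is the root of `|d⃗|² / d₀²` for the direction `d` of the worldline; it is below `c`
  -- because `d` is timelike.
  obtain ⟨v, hv, hvv⟩ := exists_sqrt (div_nonneg (dot_self_nonneg (sp d)) hd0.le)
  refine ⟨v, hv, ⟨⟨x, y, (hW _ _).2 hx, (hW _ _).2 hy, hne⟩, fun x' y' hx' hy' => ?_⟩, c,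
    ⟨hc, fun k hk => hM.lightSpeed_of_ether hk⟩, ?_⟩
  · obtain ⟨a, rfl⟩ := (hline _).1 ((hW _ _).1 hx')
    obtain ⟨b, rfl⟩ := (hline _).1 ((hW _ _).1 hy')
    have : x + a • d - (x + b • d) = (a - b) • d := by module
    rw [this, mink_smul, mink, hvv, div_mul_cancel₀ _ hd0.ne', sub_self, mul_zero]
  · refine lt_of_mul_self_lt_mul_self₀ hc.le ?_
    rwa [hvv, div_lt_iff₀ hd0]

theorem sat_classical_AxThExpSTL (hM : M.SpecRelE c e) : AxThExpSTL.done.Sat M.classical β κ := by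
  refine sat_AxThExpSTL.2 ⟨⟨e, hM.iob_e⟩, fun e' he' x y c' hc' hl hlt => ?_⟩
  obtain ⟨hi, hW⟩ := hM.ether_iff.1 he'
  obtain rfl := (hM.lightSpeed_of_ether he').unique hM.c_pos hc' (hl e' he')
  simp only [hW]
  exact hM.exists_observer e' hi x y hlt

end Model.SpecRelE

/-! ### All axioms in the classical model, and the interpretation -/

theorem sat_AxEField {X B Q : Type} [Field Q] [LinearOrder Q] [EuclideanField Q] {M : Model X B Q}
    {β : ℕ → B} {κ : ℕ → Q} : (AxEField : Fml X).done.Sat M β κ := by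
  simp only [Fml.done, AxEField, sat_and, sat_allQ, sat_eqQ, sat_exQ, sat_isZero, sat_isOne,
    sat_not, sat_imp, sat_or, sat_le, sat_nonneg, sat_pos]
  refine ⟨fun x y z => ⟨add_comm x y, add_assoc x y z, mul_comm x y, mul_assoc x y z,
    mul_add x y z⟩, ⟨0, 1, rfl, rfl, zero_ne_one, fun x => ⟨⟨-x, add_neg_cancel x⟩, fun hx =>
    ⟨x⁻¹, mul_inv_cancel₀ hx⟩⟩⟩, fun x y z => ⟨le_rfl, fun h => le_antisymm h.1 h.2,
    fun h => le_trans h.1 h.2, le_total x y⟩, fun x y z h => by gcongr,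
    fun x y h => mul_nonneg h.1 h.2, EuclideanField.exists_mul_self⟩

theorem closedAt_of_mem_specRelEFull :
    ∀ ψ ∈ SpecRelEFull, ψ.closedAt 0 0 = true := by
  rintro ψ (((rfl | rfl | rfl | rfl | rfl | rfl | rfl) | rfl | rfl) | rfl) <;> rfl

theorem sat_classical {B Q : Type} [Field Q] [LinearOrder Q] [EuclideanField Q]
    {M : Model Unit B Q} {β : ℕ → B} {κ : ℕ → Q} (h : ∀ ψ ∈ SpecRelEFull, ψ.Sat M β κ) :
    ∀ ψ ∈ ClassicalKinSTLFull, ψ.Sat M.classical β κ := by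
  have hEv := sat_AxEv.1 (h AxEv.done (by simp [SpecRelEFull, SpecRelFull, KinFull]))
  have hSelf := sat_AxSelf.1 (h AxSelf.done (by simp [SpecRelEFull, SpecRelFull, KinFull]))
  have hSymD := sat_AxSymD.1 (h AxSymD.done (by simp [SpecRelEFull, SpecRelFull, KinFull]))
  have hLine := sat_AxLine.1 (h AxLine.done (by simp [SpecRelEFull, SpecRelFull, KinFull]))
  have hTriv := sat_AxTriv.1 (h AxTriv.done (by simp [SpecRelEFull, SpecRelFull, KinFull]))
  have hNoAcc := sat_AxNoAcc.1 (h AxNoAcc.done (by simp [SpecRelEFull, SpecRelFull, KinFull]))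
  obtain ⟨c, hc, hl⟩ := sat_AxPhc.1 (h AxPhc.done (by simp [SpecRelEFull, SpecRelFull]))
  have hThExp := sat_AxThExp.1 (h AxThExp.done (by simp [SpecRelEFull, SpecRelFull]))
  obtain ⟨e, he, hprim⟩ :=
    sat_AxPrimitiveEther.1 (h AxPrimitiveEther.done (by simp [SpecRelEFull]))
  have hM : M.SpecRelE c e := ⟨⟨hc, hl, fun k hk x y => hThExp.2 k hk x y c hc hl, hEv, hSelf,
    hSymD, hLine, hTriv, hNoAcc⟩, he, hprim⟩
  rintro ψ ⟨((rfl | rfl | rfl | rfl | rfl | rfl | rfl) | rfl | rfl | rfl) | rfl | rfl, hψ⟩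
  · exact sat_AxEField
  · exact hM.sat_classical_AxEv
  · exact hM.sat_classical_AxSelf
  · exact hM.sat_classical_AxSymD
  · exact hM.sat_classical_AxLine
  · exact hM.sat_classical_AxTriv
  · exact hM.sat_classical_AxNoAcc
  · exact hM.sat_classical_AxAbsTime
  -- `AxThExpPlus` has been removed from the theory.
  · exact (hψ rfl).elim
  · exact hM.sat_classical_AxEther
  · exact hM.sat_classical_AxNoFTL
  · exact hM.sat_classical_AxThExpSTL

theorem isInterpretation_trPlus' :
    trPlus'.IsInterpretation ClassicalKinSTLFull SpecRelEFull := by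
  intro φ hφ
  refine provable_of_forall_sat closedAt_of_mem_specRelEFull fun B Q _ _ _ M β κ h => ?_
  -- Completeness provides bare operations and a bare relation on `Q`. The field axioms make them a
  -- Euclidean field with the same operations and ordering, which the equations substitute.
  obtain ⟨F, L, hE, rfl, rfl, rfl⟩ := exists_euclideanField
    (h AxEField.done (by simp [SpecRelEFull, SpecRelFull, KinFull]))
  exact (sat_apply φ).2 (hφ.sound M.classical β κ (sat_classical h))

end KinLogic

theorem mainTheorem7 :
    KinLogic.trPlus'.IsInterpretation KinLogic.ClassicalKinSTLFull KinLogic.SpecRelEFull ∧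
      ∀ φ ∈ KinLogic.ClassicalKinSTLFull,
        KinLogic.Provable KinLogic.SpecRelEFull (KinLogic.trPlus'.apply φ) :=
  ⟨KinLogic.isInterpretation_trPlus',
    fun φ hφ => KinLogic.isInterpretation_trPlus' φ (.assumption hφ)⟩
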